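/- **Setting.** Let $A\in\mathbb R^{n\times n}$, $B\in\mathbb R^{n\times m}$, $C\in\mathbb R^{r\times n}$ with $m,r\ge1$, and let $Q,R,\Sigma\succ0$. Let $\mathcal S$ be the set of $K\in\mathbb R^{m\times r}$ for which all eigenvalues of $A-BKC$ have negative real part, and for $K\in\mathcal S$ let $f(K)=\mathrm{Tr}(X\Sigma)$, where $X\succ0$ solves $(A-BKC)^{\rm T}X+X(A-BKC)+C^{\rm T}K^{\rm T}RKC+Q=0$; off $\mathcal S$ put $f=+\infty$. Let $K_0\in\mathcal S$, let $\mathcal S_0$ be a connected component of $\{K\in\mathcal S: f(K)\le f(K_0)\}$ and $K_1\in\mathcal S_0$. Let $L_1,L_2>0$ be such that $\|\nabla^2f(K)\|\le L_1$ on $\mathcal S_0$ and $\|\nabla^2 f(K)-\nabla^2 f(K')\|\le L_2\|K-K'\|_F$ whenever the segment $[K,K']$ lies in $\mathcal S_0$. Let $f(K_1)-\inf_{\mathcal S}f\le\Delta_f$, $\delta\in(0,1)$, $0<\epsilon\le\min\{\Delta_f^{2/3}L_2^{1/3},L_1^2/L_2\}$ and $\alpha=\sqrt{L_2\epsilon}$.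 **Algorithm A-OLQR.** Put $\Xi=\lceil1+\Delta_f(12L_2^2/\alpha^3+\sqrt{10}L_2/(\alpha\epsilon))\rceil$, $\delta''=\delta/\Xi$, $\delta'=\delta''/(1+L_2^2\Delta_f/\alpha^3)$. For $k=1,2,\dots$: 1. (Negative curvature descent, NCD.) Set $K\leftarrow K_k$. Repeat: by a leading-eigenvector computation find $v$ with $\|v\|_F=1$ and, with probability at least $1-\delta'$, $\nabla^2f(K)[v,v]\le\lambda_1(\nabla^2f(K))+\alpha/2$; if $\nabla^2f(K)[v,v]\le-\alpha/2$, replace $K$ by $K-\frac{2|\nabla^2f(K)[v,v]|}{L_2}\,\mathrm{sign}(\langle v,\nabla f(K)\rangle)\,v$ with the convention $\mathrm{sign}(0)=1$; otherwise stop with $\hat K_k=K$. 2. If $\|\nabla f(\hat K_k)\|_F<\epsilon$, return $\hat K_k$. 3. (Semiconvex-NAG.) Let $f_k(K)=f(K)+L_1\big[\|K-\hat K_k\|_F-\alpha/L_2\big]_+^2$ and $K_{k,0}=\hat K_k$. For $j=1,2,\dots$: if $\|\nabla f_k(K_{k,j-1})\|_F<\epsilon/2$, set $K_{k+1}=K_{k,j-1}$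 and leave this loop; otherwise let $f_{k,j}(K)=f_k(K)+3\alpha\|K-K_{k,j-1}\|_F^2$ and let $K_{k,j}$ be the output of NAG for $f_{k,j}$ from $K_{k,j-1}$. NAG for $\phi=f_{k,j}$ from $Z$: with $L=3L_1+6\alpha$, $\kappa=L/(3\alpha)$, $\beta=\frac{\sqrt\kappa-1}{\sqrt\kappa+1}$ and $\epsilon'=\frac\epsilon2\sqrt{\frac{3\alpha}{50L}}$, start with $K=y=Z$; return $K$ as soon as $\|\nabla\phi(K)\|_F<\epsilon'$; otherwise compute $y^+=K-\frac1L\nabla\phi(K)$, $K^+=(1+\beta)y^+-\beta y$. If $\phi(K^+)<\phi(Z)$ continue with $(K^+,y^+)$, otherwise restart, i.e. continue with $(K,K)$. **Assumptions on the executions.** (i) All iterates of NCD lie in $\mathcal S_0$. (ii) For all $k,j$ there is a convex set $D\subseteq\mathcal S_0$ with $\hat K_k\in D$ which contains a global minimizer of $f_{k,j}$ and the sublevel set $\{K: f_{k,j}(K)\le f_{k,j}(K_{k,j-1})\}$. (iii) In each call of NAG at most $S$ restarts occur. **Cost.** Each evaluation of $f$ or $\nabla f$, each Hessian-vector product of $f$,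 and each arithmetic operation on vectors of dimension at most $mr$ (affine combination, inner product, drawing a random vector with i.i.d. coordinates of a finite law) takes time $T_{\rm grad}$; operations on scalars are not counted. The leading-eigenvector computation is any randomized procedure that is built from these operations and, for every symmetric $H$ on a $d$-dimensional space with $\|H\|\le L$ and all $a\in(0,L]$, $\delta_0\in(0,1)$, always returns a unit vector $v$ after at most $c_0\sqrt{L/a}\,(1+\log(d/\delta_0))$ operations, with $v^{\rm T}Hv\le\lambda_1(H)+a$ with probability at least $1-\delta_0$; NCD uses it with $H=\nabla^2f(K)$, $d=mr$, $L=L_1$, $a=\alpha/2$, $\delta_0=\delta'$. **Theorem.** A leading-eigenvector computation of this kind exists, for some absolute constant $c_0$. With any such computation, under the above assumptions and with probability at least $1-\delta$, A-OLQR returns a point $K\in\mathcal S$ with $$\|\nabla f(K)\|_F\le\epsilon,\qquad \lambda_1(\nabla^2f(K))\ge-2L_2^{1/2}\epsilon^{1/2}$$ in time at most $$c\;T_{\rm grad}\,\frac{\Delta_fL_1^{1/2}L_2^{1/4}}{\epsilon^{7/4}}\left(1+\log\frac{mr\sqrt{L_1\Delta_f}}{\delta\epsilon}\right),$$ where the constant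 $c$ depends only on $S$ and $c_0$. -/

import Mathlib

noncomputable section

/-! ## Randomised vector programs (the eigenvector subroutine) -/

/-- A randomised program working on vectors held in registers.  The program never sees the
coordinates of a vector: it can apply the (hidden) Hessian to a register, form an affine combination
of two registers, draw a random vector, and branch on the inner product of two registers.
Each of these is one elementary operation. -/
inductive VProg : Type
  /-- stop and return register `i` -/
  | ret (i : ℕ) : VProg
  /-- register `d` becomes the Hessian-vector product of register `i` -/
  | hvp (d i : ℕ) (k : VProg) : VProg
  /-- register `d` becomes `a` times register `i` plus `b` times register `j` -/
  | lin (d : ℕ) (a : ℝ) (i : ℕ) (b : ℝ) (j : ℕ) (k : VProg) : VProg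
  /-- compute the inner product of the registers `i` and `j`; the rest may depend on its value -/
  | dot (i j : ℕ) (k : ℝ → VProg) : VProg
  /-- register `d` becomes a random vector whose coordinates are independent, each of them equal to
  `c u` with `u` uniform on a set of `N + 1` elements -/
  | rand (d N : ℕ) (c : Fin (N + 1) → ℝ) (k : VProg) : VProg

/-- The joint law of the returned vector and the number of elementary operations, when the program
runs with Hessian `H` from register contents `ρ`, `t` operations having been spent already. -/
def VProg.eval {ι : Type} [Fintype ι]
    (H : EuclideanSpace ℝ ι →L[ℝ] EuclideanSpace ℝ ι) :
    VProg → (ℕ → EuclideanSpace ℝ ι) → ℕ → PMF (EuclideanSpace ℝ ι × ℕ)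
  | .ret i, ρ, t => PMF.pure (ρ i, t)
  | .hvp d i k, ρ, t => VProg.eval H k (Function.update ρ d (H (ρ i))) (t + 1)
  | .lin d a i b j k, ρ, t =>
      VProg.eval H k (Function.update ρ d (a • ρ i + b • ρ j)) (t + 1)
  | .dot i j k, ρ, t => VProg.eval H (k (inner ℝ (ρ i) (ρ j))) ρ (t + 1)
  | .rand d N c k, ρ, t => by
      classical exact
        (PMF.uniformOfFintype (ι → Fin (N + 1))).bind fun u =>
          VProg.eval H k (Function.update ρ d (WithLp.toLp 2 fun i => c (u i))) (t + 1)

/-- An eigenvector routine: one program for each dimension `d`, smoothness bound `L`, additive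
accuracy `a` and failure probability `δ`. -/
abbrev EigRoutine : Type := (d : ℕ) → (L a δ : ℝ) → VProg

/-- The law of (returned vector, number of operations) of a routine run on `H`. -/
def EigRoutine.law {ι : Type} [Fintype ι] (eig : EigRoutine) (L a δ : ℝ)
    (H : EuclideanSpace ℝ ι →L[ℝ] EuclideanSpace ℝ ι) : PMF (EuclideanSpace ℝ ι × ℕ) :=
  VProg.eval H (eig (Fintype.card ι) L a δ) (fun _ => 0) 0

/-- `eig` computes additive approximate smallest eigenvectors: for every symmetric `H` with
`‖H‖ ≤ L` and all `a ∈ (0, L]`, `δ ∈ (0, 1)` it always returns a unit vector `v`, uses at most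
`c₀ * √(L / a) * (1 + log (d / δ))` operations, and with probability at least `1 - δ`
satisfies `⟪H v, v⟫ ≤ λ₁(H) + a`. -/
def IsApproxSmallestEig (c₀ : ℝ) (eig : EigRoutine) : Prop :=
  ∀ (ι : Type) [Fintype ι] [Nonempty ι]
    (H : EuclideanSpace ℝ ι →L[ℝ] EuclideanSpace ℝ ι) (L a δ : ℝ),
    (∀ x y, inner ℝ (H x) y = inner ℝ x (H y)) → ‖H‖ ≤ L → 0 < a → a ≤ L → 0 < δ → δ < 1 →
    (∀ p ∈ (eig.law L a δ H).support, ‖p.1‖ = 1 ∧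
      (p.2 : ℝ) ≤ c₀ * √(L / a) * (1 + Real.log ((Fintype.card ι : ℝ) / δ))) ∧
    ENNReal.ofReal (1 - δ) ≤ (eig.law L a δ H).toOuterMeasure
      {p | ∀ w, ‖w‖ = 1 → inner ℝ (H p.1) p.1 ≤ inner ℝ (H w) w + a}

/-! ## The output-feedback LQR cost -/

/-- The data of an output-feedback LQR problem: `ẋ = A x + B u`, `y = C x`, initial covariance `Sig`,
state and input weights `Q` and `R`. -/
structure LQR (n m r : ℕ) where
  A : Matrix (Fin n) (Fin n) ℝ
  B : Matrix (Fin n) (Fin m) ℝ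
  C : Matrix (Fin r) (Fin n) ℝ
  Q : Matrix (Fin n) (Fin n) ℝ
  R : Matrix (Fin m) (Fin m) ℝ
  Sig : Matrix (Fin n) (Fin n) ℝ

/-- The space of the gains `K ∈ ℝ^{m × r}`, with the Frobenius norm and inner product. -/
abbrev Gain (m r : ℕ) : Type := EuclideanSpace ℝ (Fin m × Fin r)

/-- The gain as a matrix. -/
def Gain.mat {m r : ℕ} (K : Gain m r) : Matrix (Fin m) (Fin r) ℝ := Matrix.of fun i j => K (i, j)

namespace LQR

variable {n m r : ℕ} (P : LQR n m r)

/-- The closed-loop matrix `A - B K C`. -/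
def closedLoop (K : Gain m r) : Matrix (Fin n) (Fin n) ℝ := P.A - P.B * K.mat * P.C

/-- The stabilising gains: all eigenvalues of `A - B K C` have negative real part. -/
def stab : Set (Gain m r) :=
  {K | ∀ z ∈ spectrum ℂ ((P.closedLoop K).map Complex.ofReal), z.re < 0}

/-- `X ≻ 0` solves the Lyapunov equation of the closed loop. -/
def IsLyap (K : Gain m r) (X : Matrix (Fin n) (Fin n) ℝ) : Prop :=
  X.PosDef ∧
    (P.closedLoop K).transpose * X + X * P.closedLoop K
      + P.C.transpose * K.mat.transpose * P.R * K.mat * P.C + P.Q = 0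

open Classical in
/-- The solution `X` of the Lyapunov equation (it exists and is unique for a stabilising gain). -/
def lyap (K : Gain m r) : Matrix (Fin n) (Fin n) ℝ :=
  if h : ∃ X, P.IsLyap K X then h.choose else 0

/-- The cost `f(K) = Tr(X Σ)`; it is meaningful on `P.stab` only. -/
def cost (K : Gain m r) : ℝ := (P.lyap K * P.Sig).trace

/-- The Hessian of a function on the space of gains, as an operator. -/
def hess (φ : Gain m r → ℝ) (K : Gain m r) : Gain m r →L[ℝ] Gain m r := fderiv ℝ (gradient φ) K

/-- The component containing `K₁` of the sublevel set `{K ∈ 𝒮 : f(K) ≤ f(K₀)}`. -/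
def subComp (K₀ K₁ : Gain m r) : Set (Gain m r) :=
  connectedComponentIn {K | K ∈ P.stab ∧ P.cost K ≤ P.cost K₀} K₁

end LQR

/-! ## Nesterov's accelerated gradient method with the restarting rule -/

/-- The state of NAG: the current iterate `K`, the auxiliary point `y`, the number of restarts. -/
structure NagState (E : Type) where
  K : E
  y : E
  restarts : ℕ

open Classical in
/-- One pass through the loop of NAG for the objective `φ` with domain `D` (`φ = +∞` off `D`), started
at `K₁`, with smoothness parameter `L` and convexity parameter `σ`.  The new iterate is accepted if
its value is below `φ K₁`; otherwise NAG is restarted from the current iterate. -/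
def nagNext {E : Type} [NormedAddCommGroup E] [InnerProductSpace ℝ E] [CompleteSpace E]
    (D : Set E) (φ : E → ℝ) (K₁ : E) (L σ : ℝ) (s : NagState E) : NagState E :=
  let β : ℝ := (√(L / σ) - 1) / (√(L / σ) + 1)
  let y' : E := s.K - (1 / L) • gradient φ s.K
  let K' : E := (1 + β) • y' - β • s.y
  if K' ∈ D ∧ φ K' < φ K₁ then ⟨K', y', s.restarts⟩ else ⟨s.K, s.K, s.restarts + 1⟩

/-! ## The algorithm A-OLQR -/

/-- The inputs of A-OLQR other than the cost and the initial point. -/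
structure Params where
  ε : ℝ
  L₁ : ℝ
  L₂ : ℝ
  α : ℝ
  Δ : ℝ
  δ : ℝ

namespace Params

variable (q : Params)

/-- `Ξ = ⌈1 + Δ_f (12 L₂² / α³ + √10 L₂ / (α ε))⌉`. -/
def Xi : ℕ := ⌈1 + q.Δ * (12 * q.L₂ ^ 2 / q.α ^ 3 + √10 * q.L₂ / (q.α * q.ε))⌉₊

/-- Failure probability `δ''` granted to one call of NCD. -/
def δcall : ℝ := q.δ / (q.Xi : ℝ)

/-- Failure probability `δ'` granted to one eigenvector computation within NCD. -/
def δeig : ℝ := q.δcall / (1 + q.L₂ ^ 2 * q.Δ / q.α ^ 3)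

/-- Accuracy to which Semiconvex-NAG, called with accuracy `ε / 2`, smoothness `3 L₁` and
semiconvexity `γ = 3 α`, asks NAG to minimise. -/
def εnag : ℝ := q.ε / 2 * √(3 * q.α / (50 * (3 * q.L₁ + 2 * (3 * q.α))))

end Params

/-- The control states of A-OLQR with its subroutines. -/
inductive Config (E : Type) : Type
  /-- in the loop of NCD, at the iterate `K` -/
  | ncd (K : E)
  /-- NCD has returned `Khat` -/
  | outer (Khat : E)
  /-- in the loop of Semiconvex-NAG for `f_k` (called at `Khat`), at the iterate `K` -/
  | semi (Khat K : E)
  /-- in the loop of NAG for `f_{k,j}`, called at `Kc` by Semiconvex-NAG -/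
  | nag (Khat Kc : E) (s : NagState E)
  /-- A-OLQR has returned `K` -/
  | done (K : E)

namespace LQR

variable {n m r : ℕ} (P : LQR n m r) (q : Params) (eig : EigRoutine)

/-- `f_k(K) = f(K) + L₁ [‖K - Khat‖ - α / L₂]₊²`. -/
def costPen (Khat K : Gain m r) : ℝ :=
  P.cost K + q.L₁ * (max (‖K - Khat‖ - q.α / q.L₂) 0) ^ 2

/-- `f_{k,j}(K) = f_k(K) + 3 α ‖K - Kc‖²`. -/
def costReg (Khat Kc K : Gain m r) : ℝ :=
  P.costPen q Khat K + 3 * q.α * ‖K - Kc‖ ^ 2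

open Classical in
/-- One step of A-OLQR: the law of the next control state and of the number of elementary operations
spent.  An elementary operation is an evaluation of `f` (it also detects that a gain is not
stabilising), of `∇f`, of a Hessian-vector product, an affine combination or an inner product of two
vectors, or one operation of the eigenvector routine. -/
def step : Config (Gain m r) → PMF (Config (Gain m r) × ℕ)
  | .ncd K =>
      -- 2 operations for the curvature along v, 3 more for the move
      (eig.law q.L₁ (q.α / 2) q.δeig (hess P.cost K)).bind fun p =>
        let v := p.1
        let curv : ℝ := inner ℝ (hess P.cost K v) v
        if curv ≤ -q.α / 2 then
          let sgn : ℝ := if 0 ≤ (inner ℝ v (gradient P.cost K) : ℝ) then 1 else -1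
          PMF.pure (.ncd (K - (2 * |curv| / q.L₂ * sgn) • v), p.2 + 5)
        else PMF.pure (.outer K, p.2 + 2)
  | .outer Khat =>
      -- gradient and its norm
      if ‖gradient P.cost Khat‖ < q.ε then PMF.pure (.done Khat, 2)
      else PMF.pure (.semi Khat Khat, 2)
  | .semi Khat K =>
      -- gradient of f_k (4 operations), its norm; value of f_k at the starting point of NAG (3)
      if ‖gradient (P.costPen q Khat) K‖ < q.ε / 2 then PMF.pure (.ncd K, 5)
      else PMF.pure (.nag Khat K ⟨K, K, 0⟩, 8)
  | .nag Khat Kc s =>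
      -- gradient of f_{k,j} (6 operations), its norm; the two updates and the new value (5)
      if ‖gradient (P.costReg q Khat Kc) s.K‖ < q.εnag then PMF.pure (.semi Khat s.K, 7)
      else PMF.pure
        (.nag Khat Kc (nagNext P.stab (P.costReg q Khat Kc) Kc
          (3 * q.L₁ + 2 * (3 * q.α)) (3 * q.α) s), 14)
  | .done K => PMF.pure (.done K, 0)

/-- The law of the control state after `N` steps of A-OLQR from `K₁`, with the total number of
elementary operations. -/
def run (K₁ : Gain m r) : ℕ → PMF (Config (Gain m r) × ℕ)
  | 0 => PMF.pure (.ncd K₁, 0)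
  | N + 1 => (run K₁ N).bind fun c => (P.step q eig c.1).map fun d => (d.1, c.2 + d.2)

/-- `c` occurs in some execution of A-OLQR from `K₁`. -/
def Reachable (K₁ : Gain m r) (c : Config (Gain m r)) : Prop :=
  ∃ N t, (c, t) ∈ (P.run q eig K₁ N).support

/-- `f` is `L₁`-smooth on `S₀` and its Hessian is `L₂`-Lipschitz along the segments in `S₀`. -/
def SmoothOn (S₀ : Set (Gain m r)) (L₁ L₂ : ℝ) : Prop :=
  (∀ K ∈ S₀, ‖hess P.cost K‖ ≤ L₁) ∧
  ∀ K K' : Gain m r, segment ℝ K K' ⊆ S₀ →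
    ‖hess P.cost K - hess P.cost K'‖ ≤ L₂ * ‖K - K'‖

/-- The iterates are confined to `S₀`: the iterates of NCD lie in `S₀`, and for every call of NAG
(objective `f_{k,j}`) some convex `D` with `Khat ∈ D ⊆ S₀` contains a global minimiser of `f_{k,j}`
and the sublevel set of `f_{k,j}` at the starting point of the call. -/
def Confined (S₀ : Set (Gain m r)) (K₁ : Gain m r) : Prop :=
  (∀ K, P.Reachable q eig K₁ (.ncd K) → K ∈ S₀) ∧
  ∀ Khat Kc s, P.Reachable q eig K₁ (.nag Khat Kc s) →
    ∃ D : Set (Gain m r), Convex ℝ D ∧ D ⊆ S₀ ∧ Khat ∈ D ∧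
      (∃ Kmin ∈ D, ∀ K ∈ P.stab, P.costReg q Khat Kc Kmin ≤ P.costReg q Khat Kc K) ∧
      {K | K ∈ P.stab ∧ P.costReg q Khat Kc K ≤ P.costReg q Khat Kc Kc} ⊆ D

/-- Each call of NAG is restarted at most `S` times. -/
def RestartsAtMost (K₁ : Gain m r) (S : ℕ) : Prop :=
  ∀ Khat Kc s, P.Reachable q eig K₁ (.nag Khat Kc s) → s.restarts ≤ S

end LQR

end

/-!
**The eigenvector routine.** This is Lanczos' method with a random start. From a random vector `b` the
routine forms `H^i b` for `i ≤ k` and their inner products, and returns an approximate minimiser of the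
Rayleigh quotient on their span. To see that the span contains a good vector (`exists_krylov_vector`),
apply a polynomial in `H` to `b`: a Chebyshev polynomial `U_k` of the second kind, with the part of the
spectrum above `λ₁ + a / 2` mapped into `[-1, 1]`, where `(1 - z²) U_k(z)²` is at most `1`, while `U_k`
grows exponentially in `k √(a / L)` at the image of `λ₁`. So `k ~ √(L / a) log (d / δ)` terms are enough
as soon as `b` has a component of relative size `δ / d` along a smallest eigenvector, and this fails
with small probability because the coordinates of `b` are independent and uniform on a fine grid
(`card_small_inner_le`).

**The cost.** The Cayley transform maps a stable matrix to one whose powers tend to zero, which gives the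
unique solvability of the Lyapunov equation and the positivity of the solution. By Cramer's rule `f` is a
smooth function on the open set `𝒮`, and its sublevel sets are closed: the Lyapunov solutions along a
converging sequence of gains are bounded, and a limit of them certifies that the limit gain is
stabilising (`LQR.isClosed_sublevel`). Hence a segment on which the derivatives of the cost keep it below
its bound cannot leave `𝒮` (`segment_mem_of_prolongation`), so the descent estimates of smooth
optimisation apply although `𝒮` is neither convex nor all of the space.

**The decrease of the cost.** Let `U = ε² / α = α³ / L₂²`. A move of NCD decreases `f` by `U / 12`
(`LQR.IsExecution.cost_move_le`). When NCD stops, `∇²f ≥ -α` at `Khat`, so that the Hessian is at least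
`-3 α` within `2 α / L₂` of `Khat`; further away the penalty compensates for it, so `f_k` is
`3 α`-semiconvex and `f_{k,j}` is `3 α`-strongly convex with `(3 L₁ + 6 α)`-Lipschitz gradient on the
convex set `D` (`isWellConditioned_proximal`). The potential
`φ(y) - φ* + (σ / 2) ‖K + √κ (K - y) - x*‖²` contracts by `1 - 1 / √κ` at each step of NAG
(`IsWellConditioned.nagPotential_step`) and is at most twice the initial gap after a restart, so a call
of NAG takes `O((S + 1) √κ log)` steps. Each call of NAG after which the loop of Semiconvex-NAG goes on
decreases `f_k` by `U / 58`, and if the loop ends at a point where the gradient of `f` is not small, the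
cost has dropped by `U / 24` below `f(Khat)` (`LQR.IsExecution.semi_succeeds`).

**Conclusion.** Since `f` can decrease by at most `Δ`, there are `O(Δ / U)` eigenvector computations and
calls of NAG. `LQR.IsExecution.ncd_succeeds_of_level` is a recursion over the value of the cost that
proves at once the bounds on the failure probability and on the number of operations; the identity
`(Δ / U) √(L₁ / α) = Δ L₁^{1/2} L₂^{1/4} / ε^{7/4}` turns the latter into the stated form.
-/

/-! ### Growth of the Chebyshev polynomials of the second kind -/

open Polynomial in
/-- On `[-1, 1]` the weighted square `(1 - z²) U_k(z)²` is at most `1`. -/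
theorem chebyshevU_weighted_le_one (k : ℕ) {z : ℝ} (h₁ : -1 ≤ z) (h₂ : z ≤ 1) :
    (1 - z ^ 2) * ((Polynomial.Chebyshev.U ℝ k).eval z) ^ 2 ≤ 1 := by
  have h := Polynomial.Chebyshev.U_real_cos (n := k) (θ := Real.arccos z)
  rw [Real.cos_arccos h₁ h₂] at h
  have hs : 1 - z ^ 2 = Real.sin (Real.arccos z) ^ 2 := by
    have := Real.sin_sq_add_cos_sq (Real.arccos z)
    rw [Real.cos_arccos h₁ h₂] at this
    linarith
  rw [hs, ← mul_pow, mul_comm, h]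
  exact (Real.sin_sq_le_one _)

open Polynomial in
/-- Outside `[-1, 1]` the polynomial `U_k` grows exponentially in `k √h`; the factor `h` on the left
is what makes the degree free of `log (1 / h)`. -/
theorem chebyshevU_growth (k : ℕ) {h R : ℝ} (hh : 0 < h) (hh' : h ≤ 1 / 4) (hR : 1 ≤ R)
    (hk : 2 * Real.log (4 * R) ≤ (k + 1) * √h) :
    R ^ 2 ≤ h * ((Polynomial.Chebyshev.U ℝ k).eval (1 + h)) ^ 2 := by
  set s := √(2 * h + h ^ 2) with hs
  have hs0 : 0 < s := Real.sqrt_pos.2 (by positivity)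
  have hs2 : s ^ 2 = 2 * h + h ^ 2 := Real.sq_sqrt (by positivity)
  set w := √h with hw
  have hw0 : 0 < w := Real.sqrt_pos.2 hh
  have hw2 : w ^ 2 = h := Real.sq_sqrt hh.le
  have hw1 : w ≤ 1 / 2 := by nlinarith
  have hsw : w ≤ s := by
    apply Real.sqrt_le_sqrt; nlinarith
  have hsw' : 2 * s ≤ 4 * w := by
    nlinarith
  set ρ := 1 + h + s with hρ
  set ρ' := 1 + h - s with hρ'
  have hprod : ρ * ρ' = 1 := by rw [hρ, hρ']; nlinarith
  have hρ1 : 1 < ρ := by linarith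
  have hρ'0 : 0 < ρ' := by
    by_contra hc
    nlinarith
  have hρ'1 : ρ' ≤ 1 := by
    by_contra hc
    nlinarith
  have hind : ∀ j : ℕ, 2 * s * (Polynomial.Chebyshev.U ℝ j).eval (1 + h) =
        ρ ^ (j + 1) - ρ' ^ (j + 1) ∧
      2 * s * (Polynomial.Chebyshev.U ℝ (j + 1)).eval (1 + h) = ρ ^ (j + 2) - ρ' ^ (j + 2) := by
    intro j
    induction j with
    | zero => simp [Polynomial.Chebyshev.U_one, hρ, hρ']; constructor <;> ring
    | succ j ih =>
      refine ⟨by exact_mod_cast ih.2, ?_⟩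
      have e := Polynomial.Chebyshev.U_add_two ℝ (j : ℤ)
      have e' : ((j + 1 : ℕ) : ℤ) + 1 = (j : ℤ) + 2 := by push_cast; ring
      rw [e', e]
      simp only [eval_sub, eval_mul, eval_X, eval_ofNat]
      have e1 : 2 * (1 + h) = ρ + ρ' := by rw [hρ, hρ']; ring
      calc _ = 2 * (1 + h) * (2 * s * (Polynomial.Chebyshev.U ℝ (j + 1)).eval (1 + h)) -
            2 * s * (Polynomial.Chebyshev.U ℝ j).eval (1 + h) := by ring
        _ = (ρ + ρ') * (ρ ^ (j + 2) - ρ' ^ (j + 2)) - (ρ * ρ') * (ρ ^ (j + 1) - ρ' ^ (j + 1)) := by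
            rw [ih.1, ih.2, e1, hprod]; ring
        _ = _ := by ring
  have hU := (hind k).1
  have hgrow : 4 * R ≤ ρ ^ (k + 1) := by
    have h1 : Real.exp (w / 2) ≤ ρ := by
      have := Real.exp_bound' (x := w / 2) (by positivity) (by linarith) (n := 2) (by norm_num)
      norm_num [Finset.sum_range_succ] at this
      nlinarith
    calc 4 * R = Real.exp (Real.log (4 * R)) := (Real.exp_log (by linarith)).symm
      _ ≤ Real.exp ((k + 1 : ℕ) * (w / 2)) := by
          apply Real.exp_le_exp.2; push_cast; linarith
      _ = Real.exp (w / 2) ^ (k + 1) := by rw [Real.exp_nat_mul]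
      _ ≤ _ := by gcongr
  have hsmall : ρ' ^ (k + 1) ≤ 1 := pow_le_one₀ hρ'0.le hρ'1
  have h3 : 3 * R ≤ 3 * (w * (Polynomial.Chebyshev.U ℝ k).eval (1 + h)) := by
    have hs3 : 2 * s ≤ 3 * w + 0 * w := by
      have : (2 * s) ^ 2 ≤ (3 * w) ^ 2 := by rw [mul_pow, mul_pow, hs2, hw2]; nlinarith
      have := abs_le_of_sq_le_sq' this (by positivity)
      linarith [this.2]
    have hUpos : 0 ≤ (Polynomial.Chebyshev.U ℝ k).eval (1 + h) := by
      by_contra hc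
      push Not at hc
      have : 2 * s * (Polynomial.Chebyshev.U ℝ k).eval (1 + h) < 0 :=
        mul_neg_of_pos_of_neg (by positivity) hc
      linarith
    nlinarith
  have : R ^ 2 ≤ (w * (Polynomial.Chebyshev.U ℝ k).eval (1 + h)) ^ 2 := by
    gcongr; linarith
  rwa [mul_pow, hw2] at this

/-! ### Krylov spaces contain approximate eigenvectors -/

open Polynomial in
/-- If the starting vector `b` has a component along an eigenvector `e` of the smallest eigenvalue
`l` that is not too small, then the Krylov space of order `k` contains a nonzero vector whose Rayleigh
quotient is at most `l + η`. -/
theorem exists_krylov_vector {E : Type*} [NormedAddCommGroup E] [InnerProductSpace ℝ E]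
    [FiniteDimensional ℝ E] (H : E →L[ℝ] E) (hsym : ∀ x y, inner ℝ (H x) y = inner ℝ x (H y))
    {L η R l : ℝ} (hH : ‖H‖ ≤ L) (hη : 0 < η) (hηL : η ≤ L / 2) (hR : 1 ≤ R)
    {e : E} (he : ‖e‖ = 1) (hle : H e = l • e)
    (hl : ∀ w, l * ‖w‖ ^ 2 ≤ inner ℝ (H w) w) (b : E) (hb0 : inner ℝ b e ≠ (0 : ℝ))
    (hb : ‖b‖ ≤ R * |inner ℝ b e|)
    (k : ℕ) (hk : 2 * Real.log (4 * R) ≤ (k + 1) * √(η / (2 * L))) :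
    ∃ c : ℕ → ℝ, (∑ i ∈ Finset.range (k + 1), c i • (H ^ i) b) ≠ 0 ∧
      inner ℝ (H (∑ i ∈ Finset.range (k + 1), c i • (H ^ i) b))
        (∑ i ∈ Finset.range (k + 1), c i • (H ^ i) b) ≤
      (l + η) * ‖∑ i ∈ Finset.range (k + 1), c i • (H ^ i) b‖ ^ 2 := by
  have hL : 0 < L := by linarith
  set q : ℝ[X] := (Polynomial.Chebyshev.U ℝ k).comp
    (C (1 + (l + η) / (2 * L)) - C (1 / (2 * L)) * X) with hq
  have hdeg : q.natDegree < k + 1 := by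
    have h1 : (Polynomial.Chebyshev.U ℝ (k : ℤ)).natDegree ≤ k := by
      have := Polynomial.Chebyshev.natDegree_U_natCast ℝ k
      exact this.le
    have h2 : (C (1 + (l + η) / (2 * L)) - C (1 / (2 * L)) * X : ℝ[X]).natDegree ≤ 1 := by
      compute_degree
    have := Polynomial.natDegree_comp_le (p := Polynomial.Chebyshev.U ℝ (k : ℤ))
      (q := (C (1 + (l + η) / (2 * L)) - C (1 / (2 * L)) * X : ℝ[X]))
    rw [← hq] at this
    nlinarith
  have hqe : ∀ x, q.eval x = (Polynomial.Chebyshev.U ℝ k).eval (1 - (x - l - η) / (2 * L)) := by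
    intro x
    rw [hq, eval_comp]
    congr 1
    simp
    field_simp
    ring
  refine ⟨fun i => q.coeff i, ?_⟩
  set v := ∑ i ∈ Finset.range (k + 1), q.coeff i • (H ^ i) b with hv
  set T : E →ₗ[ℝ] E := H.toLinearMap with hT
  have hTs : T.IsSymmetric := fun x y => hsym x y
  set d := Module.finrank ℝ E with hd
  set u := hTs.eigenvectorBasis (n := d) rfl with hu
  set lam := hTs.eigenvalues (n := d) rfl with hlam
  have hHu : ∀ i, H (u i) = lam i • u i := fun i => hTs.apply_eigenvectorBasis rfl i
  have hpow : ∀ (m : ℕ) (f : E) (μ : ℝ), H f = μ • f → inner ℝ ((H ^ m) b) f = μ ^ m * inner ℝ b f := by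
    intro m f μ hf
    induction m with
    | zero => simp
    | succ m ih =>
      rw [pow_succ', mul_apply_eq_comp, hsym, hf, inner_smul_right, ih]
      ring
  have hvin : ∀ (f : E) (μ : ℝ), H f = μ • f → inner ℝ v f = q.eval μ * inner ℝ b f := by
    intro f μ hf
    rw [hv, sum_inner, Polynomial.eval_eq_sum_range' hdeg, Finset.sum_mul]
    refine Finset.sum_congr rfl fun i _ => ?_
    rw [inner_smul_left, hpow i f μ hf]
    simp
    ring
  have hh4 : η / (2 * L) ≤ 1 / 4 := by
    rw [div_le_div_iff₀ (by positivity) (by norm_num)]; linarith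
  have hgrow := chebyshevU_growth k (h := η / (2 * L)) (by positivity) hh4 hR hk
  have hql : q.eval l = (Polynomial.Chebyshev.U ℝ k).eval (1 + η / (2 * L)) := by
    rw [hqe]; congr 1; ring
  rw [← hql] at hgrow
  have hqlne : q.eval l ≠ 0 := by
    intro h0
    rw [h0] at hgrow
    nlinarith
  have hve : inner ℝ v e = q.eval l * inner ℝ b e := hvin e l hle
  have hvne : v ≠ 0 := by
    intro h0
    rw [h0, inner_zero_left] at hve
    exact (mul_ne_zero hqlne hb0) hve.symm
  refine ⟨hvne, ?_⟩
  -- expansion in the eigenbasis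
  have hlamle : ∀ i, lam i ≤ L := by
    intro i
    have h1 : ‖H (u i)‖ ≤ L * ‖u i‖ := H.le_of_opNorm_le hH _
    rw [hHu, norm_smul, u.norm_eq_one i, mul_one, mul_one] at h1
    exact (le_abs_self _).trans h1
  have hlamge : ∀ i, l ≤ lam i := by
    intro i
    have := hl (u i)
    rw [hHu, inner_smul_left, real_inner_self_eq_norm_sq, u.norm_eq_one i] at this
    simpa using this
  have hlL : -L ≤ l := by
    have h1 : ‖H e‖ ≤ L * ‖e‖ := H.le_of_opNorm_le hH _
    rw [hle, norm_smul, he, mul_one, mul_one] at h1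
    exact (abs_le.1 h1).1
  have hnorm : ∀ x : E, ∑ i, (inner ℝ x (u i)) ^ 2 = ‖x‖ ^ 2 := by
    intro x
    have := u.sum_sq_norm_inner_right x
    rw [← this]
    refine Finset.sum_congr rfl fun i _ => ?_
    rw [real_inner_comm, Real.norm_eq_abs, sq_abs]
  have hHv : inner ℝ (H v) v = ∑ i, lam i * (inner ℝ v (u i)) ^ 2 := by
    have := u.sum_inner_mul_inner (H v) v
    rw [← this]
    refine Finset.sum_congr rfl fun i _ => ?_
    rw [hsym, hHu, inner_smul_right, real_inner_comm v (u i)]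
    ring
  have hterm : ∀ i, (lam i - l - η) * (inner ℝ v (u i)) ^ 2 ≤
      2 * L * (inner ℝ b (u i)) ^ 2 - (η * (q.eval l) ^ 2 ) * (if lam i = l then (inner ℝ b (u i)) ^ 2 else 0) := by
    intro i
    rw [hvin _ _ (hHu i), mul_pow]
    by_cases hi : lam i = l
    · rw [if_pos hi, hi]
      nlinarith [mul_nonneg hL.le (sq_nonneg (inner ℝ b (u i)))]
    · rw [if_neg hi, mul_zero, sub_zero, ← mul_assoc]
      refine mul_le_mul_of_nonneg_right ?_ (sq_nonneg _)
      by_cases hlt : lam i - l - η ≤ 0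
      · have : (lam i - l - η) * q.eval (lam i) ^ 2 ≤ 0 :=
          mul_nonpos_of_nonpos_of_nonneg hlt (sq_nonneg _)
        linarith
      · push Not at hlt
        set z := 1 - (lam i - l - η) / (2 * L) with hz
        have hz1 : z ≤ 1 := by
          have : 0 ≤ (lam i - l - η) / (2 * L) := by positivity
          linarith
        have hz0 : 0 ≤ z := by
          have : (lam i - l - η) / (2 * L) ≤ 1 := by
            rw [div_le_one (by positivity)]; linarith [hlamle i]
          linarith
        have e1 : lam i - l - η = 2 * L * (1 - z) := by rw [hz]; field_simp; ring
        have e2 := chebyshevU_weighted_le_one k (by linarith) hz1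
        rw [hqe, ← hz, e1, mul_assoc]
        have : (1 - z) * (Polynomial.Chebyshev.U ℝ k).eval z ^ 2 ≤ 1 := by
          refine le_trans (mul_le_mul_of_nonneg_right ?_ (sq_nonneg _)) e2
          nlinarith
        nlinarith
  -- the component of `b` in the eigenspace of `l`
  have hcomp : (inner ℝ b e) ^ 2 ≤ ∑ i, (if lam i = l then (inner ℝ b (u i)) ^ 2 else 0) := by
    have h1 : inner ℝ b e = ∑ i, (if lam i = l then inner ℝ b (u i) else 0) * inner ℝ (u i) e := by
      rw [← u.sum_inner_mul_inner b e]
      refine Finset.sum_congr rfl fun i _ => ?_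
      by_cases hi : lam i = l
      · rw [if_pos hi]
      · rw [if_neg hi, zero_mul]
        have h2 : inner ℝ (H (u i)) e = inner ℝ (u i) (H e) := hsym _ _
        rw [hHu, hle, inner_smul_left, inner_smul_right] at h2
        rcases mul_eq_mul_right_iff.1 h2 with h | h
        · exact absurd h hi
        · rw [h, mul_zero]
    rw [h1]
    refine (Finset.sum_mul_sq_le_sq_mul_sq _ _ _).trans ?_
    have h2 : ∑ i, (inner ℝ (u i) e) ^ 2 = 1 := by
      have := hnorm e
      rw [he] at this
      simpa [real_inner_comm] using this
    rw [h2, mul_one]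
    refine le_of_eq (Finset.sum_congr rfl fun i _ => ?_)
    split_ifs <;> simp
  have hsum : inner ℝ (H v) v - (l + η) * ‖v‖ ^ 2 ≤
      2 * L * ‖b‖ ^ 2 - η * (q.eval l) ^ 2 * (inner ℝ b e) ^ 2 := by
    calc inner ℝ (H v) v - (l + η) * ‖v‖ ^ 2
        = ∑ i, (lam i - l - η) * (inner ℝ v (u i)) ^ 2 := by
          rw [hHv, ← hnorm v, Finset.mul_sum, ← Finset.sum_sub_distrib]
          refine Finset.sum_congr rfl fun i _ => ?_
          ring
      _ ≤ ∑ i, (2 * L * (inner ℝ b (u i)) ^ 2 - (η * (q.eval l) ^ 2 ) *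
            (if lam i = l then (inner ℝ b (u i)) ^ 2 else 0)) := Finset.sum_le_sum fun i _ => hterm i
      _ = 2 * L * ‖b‖ ^ 2 - η * (q.eval l) ^ 2 *
            ∑ i, (if lam i = l then (inner ℝ b (u i)) ^ 2 else 0) := by
          rw [Finset.sum_sub_distrib, ← Finset.mul_sum, ← Finset.mul_sum, hnorm]
      _ ≤ _ := by
          have : 0 ≤ η * (q.eval l) ^ 2 := by positivity
          nlinarith
  have hfin : 2 * L * ‖b‖ ^ 2 ≤ η * (q.eval l) ^ 2 * (inner ℝ b e) ^ 2 := by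
    have h1 : ‖b‖ ^ 2 ≤ R ^ 2 * (inner ℝ b e) ^ 2 := by
      calc ‖b‖ ^ 2 ≤ (R * |inner ℝ b e|) ^ 2 := by gcongr
        _ = _ := by rw [mul_pow, sq_abs]
    have h2 : 2 * L * R ^ 2 ≤ η * (q.eval l) ^ 2 := by
      have : 2 * L * R ^ 2 ≤ 2 * L * (η / (2 * L) * (q.eval l) ^ 2) := by gcongr
      refine this.trans (le_of_eq ?_)
      field_simp
    nlinarith [sq_nonneg (inner ℝ b e : ℝ)]
  linarith

/-! ### The Krylov program -/

/-- Store `H^{i+1} b` in register `i + 1` for `s ≤ i < s + n`, then run `k`. -/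
def VProg.powers (k : VProg) : (s n : ℕ) → VProg
  | _, 0 => k
  | s, n + 1 => .hvp (s + 1) s (VProg.powers k (s + 1) n)

/-- Compute the moments `⟪b, H^l b⟫` for `l < n`, as inner products of the registers `l / 2` and
`(l + 1) / 2`, and pass them on to `k`. -/
def VProg.moments (k : (ℕ → ℝ) → VProg) : (n : ℕ) → (ℕ → ℝ) → VProg
  | 0, μ => k μ
  | n + 1, μ => .dot (n / 2) ((n + 1) / 2) fun x => VProg.moments k n (Function.update μ n x)

/-- Add `c i` times register `i` to register `d`, for `i < n`, and return register `d`. -/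
def VProg.combine (d : ℕ) (c : ℕ → ℝ) : (n : ℕ) → VProg
  | 0 => .ret d
  | n + 1 => .lin d 1 d (c n) n (VProg.combine d c n)

/-- The squared norm of `∑_{i ≤ k} c i • H^i b`, in terms of the moments `μ`. -/
noncomputable def krylovDen (k : ℕ) (μ c : ℕ → ℝ) : ℝ :=
  ∑ i ∈ Finset.range (k + 1), ∑ j ∈ Finset.range (k + 1), c i * c j * μ (i + j)

/-- The quadratic form of `H` at `∑_{i ≤ k} c i • H^i b`, in terms of the moments `μ`. -/
noncomputable def krylovNum (k : ℕ) (μ c : ℕ → ℝ) : ℝ :=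
  ∑ i ∈ Finset.range (k + 1), ∑ j ∈ Finset.range (k + 1), c i * c j * μ (i + j + 1)

open Classical in
/-- Coefficients of a unit vector of the Krylov space that minimises the Rayleigh quotient up to `η`. -/
noncomputable def krylovCoeff (k : ℕ) (η : ℝ) (μ : ℕ → ℝ) : ℕ → ℝ :=
  if h : ∃ c, krylovDen k μ c = 1 ∧ ∀ c', krylovDen k μ c' = 1 → krylovNum k μ c ≤ krylovNum k μ c' + η
  then h.choose else 0

/-- The part of the Krylov program after the choice of the random starting vector. -/
noncomputable def krylovBody (k : ℕ) (η : ℝ) : VProg :=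
  VProg.powers (VProg.moments (fun μ => VProg.combine (k + 2) (krylovCoeff k η μ) (k + 1))
    (2 * k + 2) 0) 0 (k + 1)

/-- The order of the Krylov space used in dimension `d`. -/
noncomputable def krylovOrder (d : ℕ) (L a δ : ℝ) : ℕ := ⌈2 * Real.log (4 * (6 * d / δ)) / √(a / 2 / (2 * L))⌉₊

/-- Minimisation of the Rayleigh quotient over a Krylov space with a random starting vector whose
coordinates are uniform on `{1, …, N + 1}` with `N = ⌈1 / δ⌉`. -/
noncomputable def krylovRoutine : EigRoutine := fun d L a δ =>
  .rand 0 ⌈1 / δ⌉₊ (fun u => (u : ℝ) + 1) (krylovBody (krylovOrder d L a δ) (a / 2))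

section

variable {ι : Type} [Fintype ι] (H : EuclideanSpace ℝ ι →L[ℝ] EuclideanSpace ℝ ι)

theorem VProg.eval_powers (k : VProg) (b : EuclideanSpace ℝ ι) (n s : ℕ)
    (ρ : ℕ → EuclideanSpace ℝ ι) (t : ℕ) (hρ : ∀ i, ρ i = if i ≤ s then (H ^ i) b else 0) :
    VProg.eval H (VProg.powers k s n) ρ t =
      VProg.eval H k (fun i => if i ≤ s + n then (H ^ i) b else 0) (t + n) := by
  induction n generalizing s ρ t with
  | zero =>
    have : ρ = fun i => if i ≤ s then (H ^ i) b else 0 := funext hρ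
    simp [VProg.powers, this]
  | succ n ih =>
    rw [VProg.powers, VProg.eval, ih (s + 1)]
    · congr 1
      · funext i; congr 2; omega
      · ring
    · intro i
      by_cases hi : i = s + 1
      · subst hi
        simp [hρ, pow_succ']
      · rw [Function.update_of_ne hi, hρ]
        by_cases h : i ≤ s
        · rw [if_pos h, if_pos (by omega)]
        · rw [if_neg h, if_neg (by omega)]

theorem VProg.eval_moments (k : (ℕ → ℝ) → VProg) (ρ : ℕ → EuclideanSpace ℝ ι) (n : ℕ) (μ : ℕ → ℝ)
    (t : ℕ) :
    VProg.eval H (VProg.moments k n μ) ρ t = VProg.eval H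
      (k fun l => if l < n then inner ℝ (ρ (l / 2)) (ρ ((l + 1) / 2)) else μ l) ρ (t + n) := by
  induction n generalizing μ t with
  | zero => simp [VProg.moments]
  | succ n ih =>
    rw [VProg.moments, VProg.eval, ih]
    congr 1
    · congr 1
      funext l
      by_cases h : l = n
      · subst h; simp
      · rw [Function.update_of_ne h]
        by_cases h' : l < n
        · rw [if_pos h', if_pos (by omega)]
        · rw [if_neg h', if_neg (by omega)]
    · ring

theorem VProg.eval_combine (d : ℕ) (c : ℕ → ℝ) (n : ℕ) (hn : n ≤ d) (ρ : ℕ → EuclideanSpace ℝ ι)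
    (t : ℕ) :
    VProg.eval H (VProg.combine d c n) ρ t =
      PMF.pure (ρ d + ∑ i ∈ Finset.range n, c i • ρ i, t + n) := by
  induction n generalizing ρ t with
  | zero => simp [VProg.combine, VProg.eval]
  | succ n ih =>
    rw [VProg.combine, VProg.eval, ih (by omega)]
    congr 2
    · rw [Function.update_self, Finset.sum_range_succ, one_smul, add_assoc, add_comm (c n • ρ n)]
      congr 2
      refine Finset.sum_congr rfl fun i hi => ?_
      rw [Function.update_of_ne]
      have := Finset.mem_range.1 hi
      omega
    · ring

variable {H}

theorem inner_pow_pow (hsym : ∀ x y, inner ℝ (H x) y = inner ℝ x (H y)) (b : EuclideanSpace ℝ ι) (i j : ℕ) :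
    inner ℝ ((H ^ i) b) ((H ^ j) b) = inner ℝ b ((H ^ (i + j)) b) := by
  induction i generalizing j with
  | zero => simp
  | succ i ih =>
    rw [pow_succ', mul_apply_eq_comp, hsym, ← mul_apply_eq_comp H, ← pow_succ', ih]
    congr 3; ring

/-- The moments computed by the Krylov program. -/
theorem inner_pow_half (hsym : ∀ x y, inner ℝ (H x) y = inner ℝ x (H y)) (b : EuclideanSpace ℝ ι)
    (l : ℕ) : inner ℝ ((H ^ (l / 2)) b) ((H ^ ((l + 1) / 2)) b) = inner ℝ b ((H ^ l) b) := by
  rw [inner_pow_pow hsym]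
  congr 3; omega

theorem krylovDen_eq (hsym : ∀ x y, inner ℝ (H x) y = inner ℝ x (H y)) (b : EuclideanSpace ℝ ι)
    (k : ℕ) (μ c : ℕ → ℝ) (hμ : ∀ l < 2 * k + 2, μ l = inner ℝ b ((H ^ l) b)) :
    krylovDen k μ c = ‖∑ i ∈ Finset.range (k + 1), c i • (H ^ i) b‖ ^ 2 := by
  rw [← real_inner_self_eq_norm_sq, sum_inner, krylovDen]
  refine Finset.sum_congr rfl fun i hi => ?_
  rw [inner_sum]
  refine Finset.sum_congr rfl fun j hj => ?_
  have := Finset.mem_range.1 hi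
  have := Finset.mem_range.1 hj
  rw [hμ _ (by omega), inner_smul_left, inner_smul_right, inner_pow_pow hsym]
  simp only [conj_trivial]
  ring

theorem krylovNum_eq (hsym : ∀ x y, inner ℝ (H x) y = inner ℝ x (H y)) (b : EuclideanSpace ℝ ι)
    (k : ℕ) (μ c : ℕ → ℝ) (hμ : ∀ l < 2 * k + 2, μ l = inner ℝ b ((H ^ l) b)) :
    krylovNum k μ c = inner ℝ (H (∑ i ∈ Finset.range (k + 1), c i • (H ^ i) b))
      (∑ i ∈ Finset.range (k + 1), c i • (H ^ i) b) := by
  rw [map_sum, sum_inner, krylovNum]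
  refine Finset.sum_congr rfl fun i hi => ?_
  rw [inner_sum]
  refine Finset.sum_congr rfl fun j hj => ?_
  have := Finset.mem_range.1 hi
  have := Finset.mem_range.1 hj
  rw [hμ _ (by omega), map_smul, inner_smul_left, inner_smul_right, ← mul_apply_eq_comp H, ← pow_succ',
    inner_pow_pow hsym]
  simp only [conj_trivial]
  rw [show i + 1 + j = i + j + 1 by ring]
  ring

theorem krylovCoeff_spec (hsym : ∀ x y, inner ℝ (H x) y = inner ℝ x (H y)) {b : EuclideanSpace ℝ ι}
    (hb : b ≠ 0) (k : ℕ) {η : ℝ} (hη : 0 < η) (μ : ℕ → ℝ)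
    (hμ : ∀ l < 2 * k + 2, μ l = inner ℝ b ((H ^ l) b)) :
    krylovDen k μ (krylovCoeff k η μ) = 1 ∧
      ∀ c', krylovDen k μ c' = 1 → krylovNum k μ (krylovCoeff k η μ) ≤ krylovNum k μ c' + η := by
  have h : ∃ c, krylovDen k μ c = 1 ∧
      ∀ c', krylovDen k μ c' = 1 → krylovNum k μ c ≤ krylovNum k μ c' + η := by
    set A : Set ℝ := krylovNum k μ '' {c | krylovDen k μ c = 1} with hA
    have hne : A.Nonempty := by
      refine ⟨_, fun i => if i = 0 then ‖b‖⁻¹ else 0, ?_, rfl⟩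
      have hb' : ‖b‖ ≠ 0 := norm_ne_zero_iff.2 hb
      rw [Set.mem_ofPred_eq, krylovDen_eq hsym b k μ _ hμ]
      simp [ite_smul, norm_smul, hb']
    have hbd : BddBelow A := by
      refine ⟨-‖H‖, ?_⟩
      rintro _ ⟨c, hc, rfl⟩
      rw [Set.mem_ofPred_eq, krylovDen_eq hsym b k μ _ hμ] at hc
      rw [krylovNum_eq hsym b k μ _ hμ]
      set v := ∑ i ∈ Finset.range (k + 1), c i • (H ^ i) b
      have h1 : |inner ℝ (H v) v| ≤ ‖H v‖ * ‖v‖ := abs_real_inner_le_norm _ _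
      have h2 : ‖H v‖ * ‖v‖ ≤ ‖H‖ * ‖v‖ * ‖v‖ := by gcongr; exact H.le_opNorm v
      have h3 : ‖H‖ * ‖v‖ * ‖v‖ = ‖H‖ := by rw [mul_assoc, ← sq, hc, mul_one]
      have := (abs_le.1 h1).1
      linarith
    obtain ⟨_, ⟨c, hc, rfl⟩, hlt⟩ := Real.lt_sInf_add_pos hne hη
    refine ⟨c, hc, fun c' hc' => ?_⟩
    have := csInf_le hbd ⟨c', hc', rfl⟩
    linarith
  rw [krylovCoeff, dif_pos h]
  exact h.choose_spec

/-- The program returns, deterministically once `b` is drawn, a unit vector that beats every vector of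
the Krylov space up to `η`. -/
theorem eval_krylovBody (hsym : ∀ x y, inner ℝ (H x) y = inner ℝ x (H y)) {b : EuclideanSpace ℝ ι}
    (hb : b ≠ 0) (k : ℕ) {η : ℝ} (hη : 0 < η) :
    ∃ v : EuclideanSpace ℝ ι,
      VProg.eval H (krylovBody k η) (Function.update (fun _ => 0) 0 b) 1 =
        PMF.pure (v, 4 * k + 5) ∧ ‖v‖ = 1 ∧
      ∀ c : ℕ → ℝ, (∑ i ∈ Finset.range (k + 1), c i • (H ^ i) b) ≠ 0 →
        ∀ s : ℝ, inner ℝ (H (∑ i ∈ Finset.range (k + 1), c i • (H ^ i) b))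
          (∑ i ∈ Finset.range (k + 1), c i • (H ^ i) b) ≤
            s * ‖∑ i ∈ Finset.range (k + 1), c i • (H ^ i) b‖ ^ 2 →
        inner ℝ (H v) v ≤ s + η := by
  rw [krylovBody, VProg.eval_powers H _ b _ _ _ _ (by
    intro i
    by_cases hi : i = 0
    · subst hi; simp
    · simp [hi]), VProg.eval_moments, VProg.eval_combine H _ _ _ (by omega)]
  set μ : ℕ → ℝ := fun l => if l < 2 * k + 2 then
    inner ℝ (if l / 2 ≤ 0 + (k + 1) then (H ^ (l / 2)) b else 0)
      (if (l + 1) / 2 ≤ 0 + (k + 1) then (H ^ ((l + 1) / 2)) b else 0) else (0 : ℕ → ℝ) l with hμd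
  have hμ : ∀ l < 2 * k + 2, μ l = inner ℝ b ((H ^ l) b) := by
    intro l hl
    rw [hμd]
    simp only
    rw [if_pos hl, if_pos (by omega), if_pos (by omega), inner_pow_half hsym]
  obtain ⟨h1, h2⟩ := krylovCoeff_spec hsym hb k hη μ hμ
  refine ⟨∑ i ∈ Finset.range (k + 1), krylovCoeff k η μ i • (H ^ i) b, ?_, ?_, ?_⟩
  · congr 2
    · rw [if_neg (by omega), zero_add]
      refine Finset.sum_congr rfl fun i hi => ?_
      have := Finset.mem_range.1 hi
      rw [if_pos (by omega)]
    · ring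
  · rw [krylovDen_eq hsym b k μ _ hμ] at h1
    have := norm_nonneg (∑ i ∈ Finset.range (k + 1), krylovCoeff k η μ i • (H ^ i) b)
    nlinarith
  · intro c hc s hs
    set w := ∑ i ∈ Finset.range (k + 1), c i • (H ^ i) b with hw
    have hw0 : 0 < ‖w‖ := norm_pos_iff.2 hc
    have hscale : ∑ i ∈ Finset.range (k + 1), (‖w‖⁻¹ * c i) • (H ^ i) b = ‖w‖⁻¹ • w := by
      rw [hw, Finset.smul_sum]
      exact Finset.sum_congr rfl fun i _ => by rw [mul_smul]
    have h3 := h2 (fun i => ‖w‖⁻¹ * c i) (by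
      rw [krylovDen_eq hsym b k μ _ hμ, hscale, norm_smul, norm_inv, norm_norm,
        inv_mul_cancel₀ hw0.ne', one_pow])
    rw [krylovNum_eq hsym b k μ _ hμ, krylovNum_eq hsym b k μ _ hμ, hscale, map_smul, inner_smul_left,
      inner_smul_right] at h3
    simp only [conj_trivial] at h3
    refine h3.trans ?_
    have : ‖w‖⁻¹ * (‖w‖⁻¹ * inner ℝ (H w) w) ≤ ‖w‖⁻¹ * (‖w‖⁻¹ * (s * ‖w‖ ^ 2)) := by gcongr
    have e : ‖w‖⁻¹ * (‖w‖⁻¹ * (s * ‖w‖ ^ 2)) = s := by field_simp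
    linarith

theorem exists_smallest_eigenvector [Nonempty ι]
    (hsym : ∀ x y, inner ℝ (H x) y = inner ℝ x (H y)) :
    ∃ (l : ℝ) (e : EuclideanSpace ℝ ι), ‖e‖ = 1 ∧ H e = l • e ∧
      ∀ w, l * ‖w‖ ^ 2 ≤ inner ℝ (H w) w := by
  set T : EuclideanSpace ℝ ι →ₗ[ℝ] EuclideanSpace ℝ ι := H.toLinearMap with hT
  have hTs : T.IsSymmetric := fun x y => hsym x y
  set d := Module.finrank ℝ (EuclideanSpace ℝ ι) with hd
  have hd0 : 0 < d := by rw [hd, finrank_euclideanSpace]; exact Fintype.card_pos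
  set u := hTs.eigenvectorBasis (n := d) rfl with hu
  set lam := hTs.eigenvalues (n := d) rfl with hlam
  have hHu : ∀ i, H (u i) = lam i • u i := fun i => hTs.apply_eigenvectorBasis rfl i
  have : Nonempty (Fin d) := ⟨⟨0, hd0⟩⟩
  obtain ⟨i₀, hi₀⟩ := Finite.exists_min lam
  refine ⟨lam i₀, u i₀, u.norm_eq_one i₀, hHu i₀, fun w => ?_⟩
  rw [← u.sum_sq_norm_inner_right w, ← u.sum_inner_mul_inner (H w) w, Finset.mul_sum]
  refine Finset.sum_le_sum fun i _ => ?_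
  rw [hsym, hHu, inner_smul_right, Real.norm_eq_abs, sq_abs, real_inner_comm w (u i)]
  nlinarith [hi₀ i, sq_nonneg (inner ℝ w (u i) : ℝ)]

open Classical in
/-- Anti-concentration: for a unit vector `e` and a vector `b` with independent coordinates, uniform on
`{1, …, N + 1}`, the product `⟪b, e⟫` is below `1 / (2 √d)` in absolute value with probability at most `1 / (N + 1)`. -/
theorem card_small_inner_le [Nonempty ι] (e : EuclideanSpace ℝ ι) (he : ‖e‖ = 1) (N : ℕ) :
    (Finset.univ.filter fun u : ι → Fin (N + 1) =>
      |inner ℝ (WithLp.toLp 2 (fun i => ((u i : ℕ) : ℝ) + 1) : EuclideanSpace ℝ ι) e| <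
        1 / (2 * √(Fintype.card ι))).card * (N + 1) ≤ Fintype.card (ι → Fin (N + 1)) := by
  have hd0 : (0 : ℝ) < Fintype.card ι := by exact_mod_cast Fintype.card_pos
  obtain ⟨i₀, hi₀⟩ : ∃ i, 1 / √(Fintype.card ι) ≤ |e i| := by
    by_contra hc
    push Not at hc
    have h1 : ∑ i, (e i) ^ 2 < ∑ _i : ι, (1 / √(Fintype.card ι)) ^ 2 := by
      refine Finset.sum_lt_sum_of_nonempty Finset.univ_nonempty fun i _ => ?_
      rw [← sq_abs (e i)]
      have := hc i
      gcongr
    have h2 := EuclideanSpace.real_norm_sq_eq e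
    rw [he] at h2
    rw [div_pow, Real.sq_sqrt hd0.le, Finset.sum_const, Finset.card_univ, nsmul_eq_mul] at h1
    rw [← h2] at h1
    field_simp at h1
    norm_num at h1
  set B := Finset.univ.filter fun u : ι → Fin (N + 1) =>
      |inner ℝ (WithLp.toLp 2 (fun i => ((u i : ℕ) : ℝ) + 1) : EuclideanSpace ℝ ι) e| <
        1 / (2 * √(Fintype.card ι)) with hB
  have hcard : B.card * (N + 1) = (B ×ˢ (Finset.univ : Finset (Fin (N + 1)))).card := by
    rw [Finset.card_product, Finset.card_univ, Fintype.card_fin]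
  rw [hcard, ← Finset.card_univ]
  refine Finset.card_le_card_of_injOn (fun p => Function.update p.1 i₀ p.2)
    (fun _ _ => Finset.mem_coe.2 (Finset.mem_univ _)) ?_
  rintro ⟨u, v⟩ hu ⟨u', v'⟩ hu' heq
  simp only [Finset.coe_product, Set.mem_prod, Finset.mem_coe, hB, Finset.mem_filter] at hu hu' heq
  have hv : v = v' := by
    have := congrFun heq i₀
    simpa using this
  have hoff : ∀ i, i ≠ i₀ → u i = u' i := by
    intro i hi
    have := congrFun heq i
    simpa [hi] using this
  have hin : ∀ w : ι → Fin (N + 1),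
      inner ℝ (WithLp.toLp 2 (fun i => ((w i : ℕ) : ℝ) + 1) : EuclideanSpace ℝ ι) e =
        ∑ i, (((w i : ℕ) : ℝ) + 1) * e i := by
    intro w
    rw [PiLp.inner_apply]
    refine Finset.sum_congr rfl fun i _ => ?_
    simp [mul_comm]
  have hdiff : (((u i₀ : ℕ) : ℝ) - ((u' i₀ : ℕ) : ℝ)) * e i₀ =
      (∑ i, (((u i : ℕ) : ℝ) + 1) * e i) - ∑ i, (((u' i : ℕ) : ℝ) + 1) * e i := by
    rw [← Finset.sum_sub_distrib, Finset.sum_eq_single i₀]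
    · ring
    · intro i _ hi
      rw [hoff i hi]; ring
    · simp
  have hu1 := hu.1.2
  have hu1' := hu'.1.2
  rw [hin] at hu1 hu1'
  have hlt : |(((u i₀ : ℕ) : ℝ) - ((u' i₀ : ℕ) : ℝ)) * e i₀| < 1 / √(Fintype.card ι) := by
    rw [hdiff]
    refine (abs_sub _ _).trans_lt ?_
    have : 1 / √(Fintype.card ι : ℝ) = 1 / (2 * √(Fintype.card ι)) + 1 / (2 * √(Fintype.card ι)) := by
      field_simp; norm_num
    rw [this]
    exact add_lt_add hu1 hu1'
  have heq0 : u i₀ = u' i₀ := by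
    by_contra hne
    have h1 : (1 : ℝ) ≤ |((u i₀ : ℕ) : ℝ) - ((u' i₀ : ℕ) : ℝ)| := by
      have : (1 : ℤ) ≤ |((u i₀ : ℕ) : ℤ) - ((u' i₀ : ℕ) : ℤ)| := by
        apply Int.one_le_abs
        intro h
        apply hne
        apply Fin.ext
        omega
      exact_mod_cast this
    rw [abs_mul] at hlt
    have := mul_le_mul h1 hi₀ (by positivity) (abs_nonneg _)
    linarith
  have huu : u = u' := by
    funext i
    by_cases hi : i = i₀
    · rw [hi, heq0]
    · exact hoff i hi
  rw [huu, hv]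

end

/-! ### Correctness and cost of the Krylov program -/

/-- The order of the Krylov space is large enough for `exists_krylov_vector`. -/
theorem le_krylovOrder (d : ℕ) {L a δ : ℝ} (hL : 0 < L) (ha : 0 < a) :
    2 * Real.log (4 * (6 * d / δ)) ≤ ((krylovOrder d L a δ : ℝ) + 1) * √(a / 2 / (2 * L)) := by
  have hs : 0 < √(a / 2 / (2 * L)) := Real.sqrt_pos.2 (by positivity)
  have := Nat.le_ceil (2 * Real.log (4 * (6 * d / δ)) / √(a / 2 / (2 * L)))
  rw [div_le_iff₀ hs] at this
  rw [krylovOrder]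
  nlinarith

theorem krylovOrder_cost {d : ℕ} (hd : 0 < d) {L a δ : ℝ} (ha : 0 < a) (haL : a ≤ L)
    (hδ : 0 < δ) (hδ1 : δ < 1) :
    ((4 * krylovOrder d L a δ + 5 : ℕ) : ℝ) ≤ 73 * √(L / a) * (1 + Real.log (d / δ)) := by
  have hL : 0 < L := ha.trans_le haL
  have hd1 : (1 : ℝ) ≤ d := by exact_mod_cast hd
  have hdδ : 1 ≤ d / δ := by rw [le_div_iff₀ hδ]; linarith
  have hlog : 0 ≤ Real.log (d / δ) := Real.log_nonneg hdδ
  have hs1 : 1 ≤ √(L / a) := by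
    rw [Real.one_le_sqrt, le_div_iff₀ ha]; linarith
  have hsqrt : √(a / 2 / (2 * L)) = (2 * √(L / a))⁻¹ := by
    rw [← Real.sqrt_sq (show (0 : ℝ) ≤ 2 by norm_num), ← Real.sqrt_mul (by norm_num), ← Real.sqrt_inv]
    congr 1
    field_simp
    norm_num
  have hl24 : Real.log (4 * (6 * d / δ)) ≤ 4 + Real.log (d / δ) := by
    have e : 4 * (6 * d / δ) = 24 * (d / δ) := by ring
    rw [e, Real.log_mul (by norm_num) (by positivity)]
    have : Real.log 24 ≤ 4 := by
      have h1 : Real.log 24 ≤ Real.log (32 : ℝ) := Real.log_le_log (by norm_num) (by norm_num)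
      have h2 : Real.log (32 : ℝ) = 5 * Real.log 2 := by
        rw [show (32 : ℝ) = 2 ^ 5 by norm_num, Real.log_pow]; norm_num
      have := Real.log_two_lt_d9
      linarith
    linarith
  have hl24' : 0 ≤ Real.log (4 * (6 * d / δ)) := by
    apply Real.log_nonneg
    have e : 4 * (6 * d / δ) = 24 * (d / δ) := by ring
    rw [e]; linarith
  have hk : (krylovOrder d L a δ : ℝ) ≤ 4 * √(L / a) * Real.log (4 * (6 * d / δ)) + 1 := by
    rw [krylovOrder, hsqrt, div_inv_eq_mul]
    refine (Nat.ceil_lt_add_one (by positivity)).le.trans (le_of_eq ?_)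
    ring
  push_cast
  have h1 : √(L / a) * Real.log (4 * (6 * d / δ)) ≤ √(L / a) * (4 * (1 + Real.log (d / δ))) := by
    gcongr; linarith
  have h2 : 1 ≤ √(L / a) * (1 + Real.log (d / δ)) := by nlinarith
  nlinarith

theorem krylovRoutine_isApproxSmallestEig : IsApproxSmallestEig 73 krylovRoutine := by
  intro ι _ _ H L a δ hsym hHL ha haL hδ hδ1
  classical
  have hL : 0 < L := ha.trans_le haL
  set d := Fintype.card ι with hd
  have hd0 : 0 < d := Fintype.card_pos
  have hd1 : (1 : ℝ) ≤ d := by exact_mod_cast hd0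
  set N := ⌈1 / δ⌉₊ with hN
  set k := krylovOrder d L a δ with hk
  set b : (ι → Fin (N + 1)) → EuclideanSpace ℝ ι :=
    fun u => WithLp.toLp 2 fun i => ((u i : ℕ) : ℝ) + 1 with hb
  have hb0 : ∀ u, b u ≠ 0 := by
    intro u h0
    obtain ⟨i⟩ := ‹Nonempty ι›
    have h1 : b u i = 0 := by rw [h0]; rfl
    have h2 : b u i = ((u i : ℕ) : ℝ) + 1 := rfl
    have : (0 : ℝ) ≤ ((u i : ℕ) : ℝ) := Nat.cast_nonneg _
    linarith
  choose v hv using fun u => eval_krylovBody hsym (hb0 u) k (half_pos ha)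
  have hlaw : krylovRoutine.law L a δ H =
      (PMF.uniformOfFintype (ι → Fin (N + 1))).map fun u => (v u, 4 * k + 5) := by
    rw [EigRoutine.law, krylovRoutine, VProg.eval, ← PMF.bind_pure_comp]
    congr 1
    funext u
    exact (hv u).1
  rw [hlaw]
  refine ⟨?_, ?_⟩
  · intro p hp
    rw [PMF.mem_support_map_iff] at hp
    obtain ⟨u, _, rfl⟩ := hp
    exact ⟨(hv u).2.1, krylovOrder_cost hd0 ha haL hδ hδ1⟩
  · obtain ⟨l, e, he, hle, hl⟩ := exists_smallest_eigenvector hsym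
    set B := Finset.univ.filter fun u : ι → Fin (N + 1) =>
      |inner ℝ (b u) e| < 1 / (2 * √d) with hB
    have hBcard : B.card * (N + 1) ≤ Fintype.card (ι → Fin (N + 1)) := card_small_inner_le e he N
    have hsd : 0 < √(d : ℝ) := Real.sqrt_pos.2 (by linarith)
    have hNle : ((N : ℝ) + 1) ≤ 3 / δ := by
      have h1 := (Nat.ceil_lt_add_one (show 0 ≤ 1 / δ by positivity)).le
      have h2 : 3 / δ = 1 / δ + 2 * (1 / δ) := by ring
      have h3 : 1 ≤ 1 / δ := by rw [le_div_iff₀ hδ]; linarith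
      rw [← hN] at h1
      linarith
    have hbn : ∀ u, ‖b u‖ ≤ √d * (3 / δ) := by
      intro u
      have h1 : ‖b u‖ ^ 2 ≤ (√d * (3 / δ)) ^ 2 := by
        rw [EuclideanSpace.real_norm_sq_eq, mul_pow, Real.sq_sqrt (by linarith)]
        calc ∑ i, (b u i) ^ 2 ≤ ∑ _i : ι, (3 / δ) ^ 2 := by
              refine Finset.sum_le_sum fun i _ => ?_
              have h2 : b u i = ((u i : ℕ) : ℝ) + 1 := rfl
              have h3 : ((u i : ℕ) : ℝ) ≤ N := by exact_mod_cast Nat.lt_succ_iff.1 (u i).2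
              rw [h2]
              gcongr
              linarith
          _ = _ := by rw [Finset.sum_const, Finset.card_univ, nsmul_eq_mul]
      exact le_of_sq_le_sq h1 (by positivity)
    have hgood : ∀ u, u ∉ B → ∀ w, ‖w‖ = 1 → inner ℝ (H (v u)) (v u) ≤ inner ℝ (H w) w + a := by
      intro u hu w hw
      have hu' : 1 / (2 * √d) ≤ |inner ℝ (b u) e| := by
        by_contra hc
        exact hu (Finset.mem_filter.2 ⟨Finset.mem_univ _, not_le.1 hc⟩)
      have hin0 : (inner ℝ (b u) e : ℝ) ≠ 0 := by
        intro h0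
        rw [h0, abs_zero] at hu'
        have : 0 < 1 / (2 * √(d : ℝ)) := by positivity
        linarith
      have hR : ‖b u‖ ≤ 6 * d / δ * |inner ℝ (b u) e| := by
        refine (hbn u).trans ?_
        have : √(d : ℝ) * (3 / δ) = 6 * d / δ * (1 / (2 * √d)) := by
          have hdd : (d : ℝ) = √d * √d := (Real.mul_self_sqrt (by linarith)).symm
          field_simp
          rw [Real.sq_sqrt (by linarith)]
          ring
        rw [this]
        gcongr
      have hR1 : 1 ≤ 6 * d / δ := by rw [le_div_iff₀ hδ]; nlinarith
      obtain ⟨c, hc0, hc⟩ := exists_krylov_vector H hsym hHL (half_pos ha) (by linarith) hR1 he hle hl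
        (b u) hin0 hR k (le_krylovOrder d hL ha)
      have h1 := (hv u).2.2 c hc0 _ hc
      have h2 := hl w
      rw [hw] at h2
      linarith
    rw [PMF.toOuterMeasure_map_apply]
    refine le_trans ?_ (MeasureTheory.measure_mono
      (show ((Bᶜ : Finset _) : Set (ι → Fin (N + 1))) ⊆ _ from fun u hu => by
        have hu' : u ∉ B := by simpa using hu
        exact hgood u hu'))
    have hpos : (0 : ℝ) < Fintype.card (ι → Fin (N + 1)) := by exact_mod_cast Fintype.card_pos
    rw [PMF.toOuterMeasure_uniformOfFintype_apply]
    have hcB : Fintype.card ((Bᶜ : Finset _) : Set (ι → Fin (N + 1))) = Bᶜ.card := by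
      rw [← Set.toFinset_card, Finset.toFinset_coe]
    rw [hcB, ← ENNReal.ofReal_natCast, ← ENNReal.ofReal_natCast, ← ENNReal.ofReal_div_of_pos hpos]
    apply ENNReal.ofReal_le_ofReal
    rw [le_div_iff₀ hpos, Finset.card_compl, Nat.cast_sub (Finset.card_le_univ _)]
    have h1 : (B.card : ℝ) * (N + 1) ≤ Fintype.card (ι → Fin (N + 1)) := by exact_mod_cast hBcard
    have h2 : 1 / δ ≤ (N : ℝ) + 1 := (Nat.le_ceil _).trans (by rw [← hN]; linarith)
    have h3 : 1 ≤ δ * ((N : ℝ) + 1) := by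
      rw [div_le_iff₀ hδ] at h2; linarith
    have h4 : (B.card : ℝ) ≤ δ * Fintype.card (ι → Fin (N + 1)) := by
      have : (0 : ℝ) ≤ B.card := Nat.cast_nonneg _
      nlinarith
    linarith

/-! ### Stable matrices and the Lyapunov equation -/

section Lyapunov

open Matrix Filter Topology

/-- A matrix is stable if all its complex eigenvalues have negative real part. -/
def Matrix.IsStable {n : ℕ} (A : Matrix (Fin n) (Fin n) ℝ) : Prop :=
  ∀ z ∈ spectrum ℂ (A.map Complex.ofReal), z.re < 0

/-- The Lyapunov operator of `A`. -/
def lyapOp {n : ℕ} (A : Matrix (Fin n) (Fin n) ℝ) :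
    Matrix (Fin n) (Fin n) ℝ →ₗ[ℝ] Matrix (Fin n) (Fin n) ℝ where
  toFun X := Aᵀ * X + X * A
  map_add' X Y := by rw [mul_add, add_mul]; abel
  map_smul' c X := by simp [smul_add]

variable {n : ℕ} {A : Matrix (Fin n) (Fin n) ℝ}

theorem lyapOp_apply (A X : Matrix (Fin n) (Fin n) ℝ) : lyapOp A X = Aᵀ * X + X * A := rfl

/-- The Cayley transform `(1 + A) (1 - A)⁻¹`. -/
noncomputable def cayley (A : Matrix (Fin n) (Fin n) ℝ) : Matrix (Fin n) (Fin n) ℝ :=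
  (1 + A) * (1 - A)⁻¹

theorem transpose_eq_of_isHermitian {ι : Type*} {X : Matrix ι ι ℝ} (h : X.IsHermitian) : Xᵀ = X := by
  rw [← Matrix.conjTranspose_eq_transpose_of_trivial]
  exact h

theorem map_ofReal_det (A : Matrix (Fin n) (Fin n) ℝ) :
    (A.map Complex.ofReal).det = (A.det : ℂ) :=
  (RingHom.map_det Complex.ofRealHom A).symm

theorem isUnit_map_ofReal_iff (A : Matrix (Fin n) (Fin n) ℝ) :
    IsUnit (A.map Complex.ofReal) ↔ IsUnit A := by
  rw [Matrix.isUnit_iff_isUnit_det, Matrix.isUnit_iff_isUnit_det, map_ofReal_det, isUnit_iff_ne_zero,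
    isUnit_iff_ne_zero, Complex.ofReal_ne_zero]

theorem Matrix.IsStable.isUnit_one_sub (hA : A.IsStable) : IsUnit (1 - A) := by
  rw [← isUnit_map_ofReal_iff]
  by_contra h
  have h1 : (1 : ℂ) ∈ spectrum ℂ (A.map Complex.ofReal) := by
    rw [spectrum.mem_iff, map_one]
    convert h using 2
    ext i j
    simp [Matrix.one_apply, apply_ite Complex.ofReal]
  have := hA 1 h1
  norm_num at this

/-- The Cayley transform maps the open left half-plane into the open unit disc. -/
theorem Matrix.IsStable.norm_lt_one_of_mem_spectrum_cayley (hA : A.IsStable) {μ : ℂ}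
    (hμ : μ ∈ spectrum ℂ ((cayley A).map Complex.ofReal)) : ‖μ‖ < 1 := by
  have hu := hA.isUnit_one_sub
  set Ac := A.map Complex.ofReal with hAc
  set Mc := (cayley A).map Complex.ofReal with hMc
  have hsub : (1 - A).map Complex.ofReal = 1 - Ac := by
    ext i j; simp [hAc, Matrix.one_apply, apply_ite Complex.ofReal]
  have hadd : (1 + A).map Complex.ofReal = 1 + Ac := by
    ext i j; simp [hAc, Matrix.one_apply, apply_ite Complex.ofReal]
  have hMA : Mc * (1 - Ac) = 1 + Ac := by
    have h1 : cayley A * (1 - A) = 1 + A := by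
      rw [cayley, mul_assoc, Matrix.nonsing_inv_mul _ ((Matrix.isUnit_iff_isUnit_det _).1 hu), mul_one]
    rw [← hsub, ← hadd, ← h1]
    exact (Matrix.map_mul (f := Complex.ofRealHom)).symm
  have huc : IsUnit (1 - Ac) := by rw [← hsub, isUnit_map_ofReal_iff]; exact hu
  rw [spectrum.mem_iff] at hμ
  have hnu : ¬ IsUnit ((algebraMap ℂ (Matrix (Fin n) (Fin n) ℂ) μ - Mc) * (1 - Ac)) := by
    intro h
    obtain ⟨u, hu'⟩ := huc
    rw [← hu', Units.isUnit_mul_units] at h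
    exact hμ h
  have hexp : (algebraMap ℂ (Matrix (Fin n) (Fin n) ℂ) μ - Mc) * (1 - Ac) =
      algebraMap ℂ _ (μ - 1) - (μ + 1) • Ac := by
    rw [sub_mul, hMA, Algebra.algebraMap_eq_smul_one, Algebra.algebraMap_eq_smul_one, smul_mul_assoc,
      one_mul, smul_sub, sub_smul, add_smul, one_smul, one_smul]
    abel
  rw [hexp] at hnu
  by_cases h1 : μ + 1 = 0
  · exfalso
    apply hnu
    have h2 : μ = -1 := by linear_combination h1
    rw [h1, zero_smul, sub_zero, h2]
    exact (IsUnit.mk0 (-1 - 1 : ℂ) (by norm_num)).map (algebraMap ℂ (Matrix (Fin n) (Fin n) ℂ))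
  · have hz : (μ - 1) / (μ + 1) ∈ spectrum ℂ Ac := by
      rw [spectrum.mem_iff]
      intro h
      apply hnu
      have : algebraMap ℂ (Matrix (Fin n) (Fin n) ℂ) (μ - 1) - (μ + 1) • Ac =
          (Units.mk0 (μ + 1) h1) • (algebraMap ℂ _ ((μ - 1) / (μ + 1)) - Ac) := by
        rw [Units.smul_mk0, smul_sub, Algebra.algebraMap_eq_smul_one, Algebra.algebraMap_eq_smul_one,
          smul_smul, mul_div_cancel₀ _ h1]
      rw [this]
      exact h.smul _
    have hre := hA _ hz
    have hnorm : ((μ - 1) / (μ + 1)).re = (μ.re ^ 2 + μ.im ^ 2 - 1) / Complex.normSq (μ + 1) := by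
      rw [Complex.div_re]
      simp
      ring
    rw [hnorm] at hre
    have hpos : 0 < Complex.normSq (μ + 1) := Complex.normSq_pos.2 h1
    rw [div_neg_iff] at hre
    have hlt : μ.re ^ 2 + μ.im ^ 2 - 1 < 0 := by
      rcases hre with h | h
      · linarith [h.2]
      · exact h.1
    have hsq : ‖μ‖ ^ 2 < 1 := by
      rw [← Complex.normSq_eq_norm_sq, Complex.normSq_apply]; nlinarith
    nlinarith [norm_nonneg μ]

/-- If the spectrum of an element of a Banach algebra lies in the open unit disc, its powers tend
to zero. -/
theorem tendsto_pow_zero_of_spectrum {B : Type*} [NormedRing B] [NormedAlgebra ℂ B] [CompleteSpace B]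
    [Nontrivial B] {a : B} (ha : ∀ z ∈ spectrum ℂ a, ‖z‖ < 1) :
    Tendsto (fun k : ℕ => a ^ k) atTop (𝓝 0) := by
  have hr : spectralRadius ℂ a < ((1 : NNReal) : ENNReal) :=
    spectrum.spectralRadius_lt_of_forall_lt a fun z hz => by
      have := ha z hz
      exact_mod_cast this
  obtain ⟨r, hr1, hr2⟩ := exists_between hr
  have hr2' : r < 1 := by simpa using hr2
  lift r to NNReal using (hr2'.trans ENNReal.one_lt_top).ne
  have hg := (spectrum.pow_nnnorm_pow_one_div_tendsto_nhds_spectralRadius a).eventually_lt_const hr1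
  have hr3 : (r : ℝ) < 1 := by exact_mod_cast hr2'
  rw [tendsto_zero_iff_norm_tendsto_zero]
  refine squeeze_zero' (Eventually.of_forall fun _ => norm_nonneg _) ?_
    (tendsto_pow_atTop_nhds_zero_of_lt_one r.2 hr3)
  filter_upwards [hg, eventually_gt_atTop 0] with k hk hk0
  have hk' : (k : ℝ) ≠ 0 := by exact_mod_cast hk0.ne'
  have h1 : (‖a ^ k‖₊ : ENNReal) ≤ (r : ENNReal) ^ (k : ℝ) := by
    calc (‖a ^ k‖₊ : ENNReal) = ((‖a ^ k‖₊ : ENNReal) ^ (1 / k : ℝ)) ^ (k : ℝ) := by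
          rw [← ENNReal.rpow_mul, one_div, inv_mul_cancel₀ hk', ENNReal.rpow_one]
      _ ≤ _ := ENNReal.rpow_le_rpow hk.le (Nat.cast_nonneg _)
  rw [ENNReal.rpow_natCast] at h1
  exact_mod_cast h1

open scoped Matrix.Norms.Operator in
theorem Matrix.IsStable.tendsto_cayley_pow (hA : A.IsStable) :
    Tendsto (fun k : ℕ => cayley A ^ k) atTop (𝓝 0) := by
  rcases Nat.eq_zero_or_pos n with rfl | hn
  · have : ∀ k : ℕ, cayley A ^ k = 0 := fun k => Subsingleton.elim _ _
    simp only [this]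
    exact tendsto_const_nhds
  have : Nonempty (Fin n) := ⟨⟨0, hn⟩⟩
  have h := tendsto_pow_zero_of_spectrum (a := (cayley A).map Complex.ofReal)
    fun z hz => hA.norm_lt_one_of_mem_spectrum_cayley hz
  have hpow : ∀ k : ℕ, ((cayley A).map Complex.ofReal) ^ k = (cayley A ^ k).map Complex.ofReal :=
    fun k => (Matrix.map_pow (cayley A) Complex.ofRealHom k).symm
  simp only [hpow] at h
  refine tendsto_pi_nhds.2 fun i => tendsto_pi_nhds.2 fun j => ?_
  have hc : Continuous fun G : Matrix (Fin n) (Fin n) ℂ => (G i j).re :=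
    Complex.continuous_re.comp (continuous_id.matrix_elem i j)
  have := (hc.tendsto 0).comp h
  simpa [Function.comp_def] using this

theorem cayley_conj (hA : A.IsStable) (X : Matrix (Fin n) (Fin n) ℝ) :
    (cayley A)ᵀ * X * cayley A = X + (2 : ℝ) • (((1 - A)⁻¹)ᵀ * lyapOp A X * (1 - A)⁻¹) := by
  have hd : IsUnit (1 - A).det := (Matrix.isUnit_iff_isUnit_det _).1 hA.isUnit_one_sub
  set N := (1 - A)⁻¹ with hN
  have h1 : (1 - A) * N = 1 := Matrix.mul_nonsing_inv _ hd
  have h2 : Nᵀ * (1 - A)ᵀ = 1 := by rw [← Matrix.transpose_mul, h1, Matrix.transpose_one]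
  have h3 : (1 + A)ᵀ * X * (1 + A) = (1 - A)ᵀ * X * (1 - A) + (2 : ℝ) • lyapOp A X := by
    rw [lyapOp_apply, two_smul]
    simp only [Matrix.transpose_add, Matrix.transpose_sub, Matrix.transpose_one]
    noncomm_ring
  calc (cayley A)ᵀ * X * cayley A = Nᵀ * ((1 + A)ᵀ * X * (1 + A)) * N := by
        rw [cayley, Matrix.transpose_mul]; simp only [mul_assoc, ← hN]
    _ = (Nᵀ * (1 - A)ᵀ) * X * ((1 - A) * N) + (2 : ℝ) • (Nᵀ * lyapOp A X * N) := by
        rw [h3, mul_add, add_mul, mul_smul_comm, smul_mul_assoc]; simp only [mul_assoc]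
    _ = _ := by rw [h1, h2, one_mul, mul_one]

theorem tendsto_conj_pow (hA : A.IsStable) (X : Matrix (Fin n) (Fin n) ℝ) :
    Tendsto (fun k : ℕ => (cayley A ^ k)ᵀ * X * cayley A ^ k) atTop (𝓝 0) := by
  have h := hA.tendsto_cayley_pow
  have hc : Continuous fun M : Matrix (Fin n) (Fin n) ℝ => Mᵀ * X * M := by fun_prop
  have := (hc.tendsto 0).comp h
  simpa [Function.comp_def] using this

/-- The Lyapunov operator of a stable matrix is injective. -/
theorem Matrix.IsStable.lyapOp_injective (hA : A.IsStable) : Function.Injective (lyapOp A) := by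
  rw [← LinearMap.ker_eq_bot, LinearMap.ker_eq_bot']
  intro X hX
  have h1 : (cayley A)ᵀ * X * cayley A = X := by
    rw [cayley_conj hA, hX]; simp
  have h2 : ∀ k : ℕ, (cayley A ^ k)ᵀ * X * cayley A ^ k = X := by
    intro k
    induction k with
    | zero => simp
    | succ k ih =>
      rw [pow_succ, Matrix.transpose_mul]
      calc (cayley A)ᵀ * (cayley A ^ k)ᵀ * X * (cayley A ^ k * cayley A)
          = (cayley A)ᵀ * ((cayley A ^ k)ᵀ * X * cayley A ^ k) * cayley A := by
            simp only [mul_assoc]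
        _ = X := by rw [ih, h1]
  have h3 := tendsto_conj_pow hA X
  simp only [h2] at h3
  exact tendsto_nhds_unique tendsto_const_nhds h3

/-- For a stable matrix the Lyapunov equation with a positive definite right-hand side has a positive
definite solution: the value `xᵀ X x` decreases along the powers of the Cayley transform, which tend to
zero. -/
theorem Matrix.IsStable.exists_posDef (hA : A.IsStable) {W : Matrix (Fin n) (Fin n) ℝ}
    (hW : W.PosDef) : ∃ X : Matrix (Fin n) (Fin n) ℝ, X.PosDef ∧ lyapOp A X = -W := by
  obtain ⟨X, hX⟩ := (LinearMap.injective_iff_surjective.1 hA.lyapOp_injective) (-W)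
  refine ⟨X, ?_, hX⟩
  have hWs : Wᵀ = W := transpose_eq_of_isHermitian hW.isHermitian
  have hXs : Xᵀ = X := by
    apply hA.lyapOp_injective
    rw [hX]
    have := congrArg Matrix.transpose hX
    rw [lyapOp_apply, Matrix.transpose_add, Matrix.transpose_mul, Matrix.transpose_mul,
      Matrix.transpose_transpose, Matrix.transpose_neg, hWs, add_comm] at this
    exact this
  have hd : IsUnit (1 - A).det := (Matrix.isUnit_iff_isUnit_det _).1 hA.isUnit_one_sub
  set N := (1 - A)⁻¹ with hN
  set M := cayley A with hM
  have hquad : ∀ x : Fin n → ℝ, (M *ᵥ x) ⬝ᵥ (X *ᵥ (M *ᵥ x)) =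
      x ⬝ᵥ (X *ᵥ x) - 2 * ((N *ᵥ x) ⬝ᵥ (W *ᵥ (N *ᵥ x))) := by
    intro x
    have h1 := congrArg (fun Y => x ⬝ᵥ (Y *ᵥ x)) (cayley_conj hA X)
    simp only [hX, ← hN, ← hM] at h1
    have e : ∀ (G Y : Matrix (Fin n) (Fin n) ℝ), x ⬝ᵥ ((Gᵀ * Y * G) *ᵥ x) =
        (G *ᵥ x) ⬝ᵥ (Y *ᵥ (G *ᵥ x)) := by
      intro G Y
      rw [← Matrix.mulVec_mulVec, ← Matrix.mulVec_mulVec, Matrix.dotProduct_mulVec,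
        Matrix.vecMul_transpose]
    rw [e, Matrix.add_mulVec, dotProduct_add, Matrix.smul_mulVec, dotProduct_smul, e,
      Matrix.neg_mulVec, dotProduct_neg] at h1
    rw [h1, smul_eq_mul]; ring
  have hWnn : ∀ y : Fin n → ℝ, 0 ≤ y ⬝ᵥ (W *ᵥ y) := fun y => by
    simpa using hW.posSemidef.dotProduct_mulVec_nonneg y
  have hanti : ∀ (x : Fin n → ℝ) (k : ℕ),
      ((M ^ k) *ᵥ x) ⬝ᵥ (X *ᵥ ((M ^ k) *ᵥ x)) ≤ x ⬝ᵥ (X *ᵥ x) := by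
    intro x k
    induction k with
    | zero => simp
    | succ k ih =>
      rw [pow_succ', ← Matrix.mulVec_mulVec, hquad]
      linarith [hWnn (N *ᵥ ((M ^ k) *ᵥ x))]
  have hlim : ∀ x : Fin n → ℝ, 0 ≤ x ⬝ᵥ (X *ᵥ x) := by
    intro x
    have hc : Continuous fun G : Matrix (Fin n) (Fin n) ℝ => (G *ᵥ x) ⬝ᵥ (X *ᵥ (G *ᵥ x)) := by
      fun_prop
    have h1 := (hc.tendsto 0).comp hA.tendsto_cayley_pow
    have h2 := le_of_tendsto h1 (Eventually.of_forall fun k => hanti x k)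
    simpa using h2
  refine Matrix.PosDef.of_dotProduct_mulVec_pos (by simpa [Matrix.IsHermitian] using hXs) ?_
  intro x hx
  have hNx : N *ᵥ x ≠ 0 := by
    intro h0
    apply hx
    have : (1 - A) *ᵥ (N *ᵥ x) = x := by
      rw [Matrix.mulVec_mulVec, Matrix.mul_nonsing_inv _ hd, Matrix.one_mulVec]
    rw [← this, h0, Matrix.mulVec_zero]
  have h1 := hW.dotProduct_mulVec_pos hNx
  have h2 := hlim (M *ᵥ x)
  rw [hquad] at h2
  simp only [star_trivial] at h1 ⊢
  linarith

/-- Lyapunov's theorem: a positive definite solution of the Lyapunov equation forces stability. -/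
theorem Matrix.IsStable.of_posDef {X W : Matrix (Fin n) (Fin n) ℝ} (hX : X.PosDef)
    (hW : W.PosDef) (hXW : lyapOp A X = -W) : A.IsStable := by
  intro z hz
  rw [← Matrix.spectrum_toLin', ← Module.End.hasEigenvalue_iff_mem_spectrum] at hz
  obtain ⟨v, hv⟩ := hz.exists_hasEigenvector
  have hv1 : (A.map Complex.ofReal) *ᵥ v = z • v := by
    simpa using hv.apply_eq_smul
  set a : Fin n → ℝ := fun i => (v i).re with ha
  set b : Fin n → ℝ := fun i => (v i).im with hb
  have hAa : A *ᵥ a = z.re • a - z.im • b := by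
    ext i
    have := congrArg Complex.re (congrFun hv1 i)
    simpa [Matrix.mulVec, dotProduct, ha, hb] using this
  have hAb : A *ᵥ b = z.im • a + z.re • b := by
    ext i
    have := congrArg Complex.im (congrFun hv1 i)
    simp [Matrix.mulVec, dotProduct] at this
    simp [Matrix.mulVec, dotProduct, ha, hb, this]
    ring
  have hXs : Xᵀ = X := transpose_eq_of_isHermitian hX.isHermitian
  have hquad : ∀ x : Fin n → ℝ, 2 * (x ⬝ᵥ (X *ᵥ (A *ᵥ x))) = -(x ⬝ᵥ (W *ᵥ x)) := by
    intro x
    have h1 := congrArg (fun Y => x ⬝ᵥ (Y *ᵥ x)) hXW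
    simp only [lyapOp_apply, Matrix.add_mulVec, dotProduct_add, Matrix.neg_mulVec, dotProduct_neg,
      ← Matrix.mulVec_mulVec] at h1
    have h2 : x ⬝ᵥ (Aᵀ *ᵥ (X *ᵥ x)) = x ⬝ᵥ (X *ᵥ (A *ᵥ x)) := by
      rw [Matrix.dotProduct_mulVec, Matrix.vecMul_transpose, Matrix.dotProduct_mulVec,
        ← Matrix.mulVec_transpose, hXs, dotProduct_comm] 
    linarith
  have hsymX : ∀ x y : Fin n → ℝ, x ⬝ᵥ (X *ᵥ y) = y ⬝ᵥ (X *ᵥ x) := by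
    intro x y
    rw [Matrix.dotProduct_mulVec, ← Matrix.mulVec_transpose, hXs, dotProduct_comm]
  have hsum : 2 * z.re * (a ⬝ᵥ (X *ᵥ a) + b ⬝ᵥ (X *ᵥ b)) =
      -(a ⬝ᵥ (W *ᵥ a) + b ⬝ᵥ (W *ᵥ b)) := by
    have h1 := hquad a
    have h2 := hquad b
    rw [hAa, Matrix.mulVec_sub, Matrix.mulVec_smul, Matrix.mulVec_smul, dotProduct_sub,
      dotProduct_smul, dotProduct_smul] at h1
    rw [hAb, Matrix.mulVec_add, Matrix.mulVec_smul, Matrix.mulVec_smul, dotProduct_add,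
      dotProduct_smul, dotProduct_smul, hsymX b a] at h2
    simp only [smul_eq_mul] at h1 h2
    linarith
  have hnn : ∀ {Y : Matrix (Fin n) (Fin n) ℝ}, Y.PosDef → ∀ y : Fin n → ℝ, 0 ≤ y ⬝ᵥ (Y *ᵥ y) :=
    fun hY y => by simpa using hY.posSemidef.dotProduct_mulVec_nonneg y
  have hab : a ≠ 0 ∨ b ≠ 0 := by
    by_contra hc
    push Not at hc
    apply hv.2
    ext i
    apply Complex.ext
    · exact congrFun hc.1 i
    · exact congrFun hc.2 i
  have hpos : ∀ {Y : Matrix (Fin n) (Fin n) ℝ}, Y.PosDef →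
      0 < a ⬝ᵥ (Y *ᵥ a) + b ⬝ᵥ (Y *ᵥ b) := by
    intro Y hY
    rcases hab with h | h
    · have := hY.dotProduct_mulVec_pos h
      simp only [star_trivial] at this
      linarith [hnn hY b]
    · have := hY.dotProduct_mulVec_pos h
      simp only [star_trivial] at this
      linarith [hnn hY a]
  have h1 := hpos hX
  have h2 := hpos hW
  by_contra hc
  push Not at hc
  nlinarith

/-- A positive semidefinite solution of the Lyapunov equation with a positive definite right-hand side
is positive definite. -/
theorem posDef_of_posSemidef_lyapOp {X W : Matrix (Fin n) (Fin n) ℝ} (hX : X.PosSemidef)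
    (hW : W.PosDef) (hXW : lyapOp A X = -W) : X.PosDef := by
  refine Matrix.PosDef.of_dotProduct_mulVec_pos hX.isHermitian fun x hx => ?_
  have h0 := hX.dotProduct_mulVec_nonneg x
  refine lt_of_le_of_ne h0 fun h => ?_
  have hXx : X *ᵥ x = 0 := (hX.dotProduct_mulVec_zero_iff x).1 h.symm
  have hXs : Xᵀ = X := transpose_eq_of_isHermitian hX.isHermitian
  have h1 := congrArg (fun Y => x ⬝ᵥ (Y *ᵥ x)) hXW
  simp only [lyapOp_apply, Matrix.add_mulVec, dotProduct_add, Matrix.neg_mulVec, dotProduct_neg,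
    ← Matrix.mulVec_mulVec, hXx, Matrix.mulVec_zero, dotProduct_zero] at h1
  rw [Matrix.dotProduct_mulVec, ← Matrix.mulVec_transpose, hXs, hXx, zero_dotProduct] at h1
  have h2 := hW.dotProduct_mulVec_pos hx
  simp only [star_trivial] at h2
  linarith

end Lyapunov

/-! ### Regularity of the LQR cost -/

section Regularity

open Matrix Filter Topology

/-- Matrices whose entries depend continuously on a parameter and that are symmetric near `x₀` and
positive definite at `x₀` are positive definite near `x₀`. -/
theorem eventually_posDef {T : Type*} [TopologicalSpace T] {n : ℕ} {M : T → Matrix (Fin n) (Fin n) ℝ}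
    {x₀ : T} (hM : ∀ i j, ContinuousAt (fun x => M x i j) x₀) (hs : ∀ᶠ x in 𝓝 x₀, (M x)ᵀ = M x)
    (h₀ : (M x₀).PosDef) : ∀ᶠ x in 𝓝 x₀, (M x).PosDef := by
  have hK : IsCompact (Metric.sphere (0 : Fin n → ℝ) 1) := isCompact_sphere _ _
  have hev : ∀ᶠ x in 𝓝 x₀, ∀ y ∈ Metric.sphere (0 : Fin n → ℝ) 1, 0 < y ⬝ᵥ (M x *ᵥ y) := by
    refine hK.eventually_forall_of_forall_eventually fun y hy => ?_
    have hc : ContinuousAt (fun p : T × (Fin n → ℝ) => p.2 ⬝ᵥ (M p.1 *ᵥ p.2)) (x₀, y) := by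
      simp only [dotProduct, mulVec]
      refine tendsto_finsetSum _ fun i _ => ?_
      have h1 : ∀ i, ContinuousAt (fun p : T × (Fin n → ℝ) => p.2 i) (x₀, y) := fun i =>
        ((continuous_apply i).comp continuous_snd).continuousAt
      refine (h1 i).mul (tendsto_finsetSum _ fun j _ => ?_)
      exact ((hM i j).comp_of_eq continuousAt_fst rfl).mul (h1 j)
    have hne : y ≠ 0 := by
      rintro rfl
      simp at hy
    have hpos : 0 < y ⬝ᵥ (M x₀ *ᵥ y) := by
      simpa using h₀.dotProduct_mulVec_pos hne
    exact hc.eventually_const_lt hpos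
  filter_upwards [hev, hs] with x hx hsx
  refine Matrix.PosDef.of_dotProduct_mulVec_pos (by simpa [Matrix.IsHermitian] using hsx) fun y hy => ?_
  have hy0 : 0 < ‖y‖ := norm_pos_iff.2 hy
  have h1 := hx (‖y‖⁻¹ • y) (by simp [norm_smul, hy0.ne'])
  rw [Matrix.mulVec_smul, dotProduct_smul, smul_dotProduct, smul_eq_mul, smul_eq_mul] at h1
  rw [star_trivial]
  by_contra hc
  push Not at hc
  have : ‖y‖⁻¹ * (‖y‖⁻¹ * y ⬝ᵥ (M x *ᵥ y)) ≤ 0 := by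
    apply mul_nonpos_of_nonneg_of_nonpos (by positivity)
    exact mul_nonpos_of_nonneg_of_nonpos (by positivity) hc
  linarith

open scoped MatrixOrder in
theorem trace_mul_nonneg_of_posSemidef {n : ℕ} {X Y : Matrix (Fin n) (Fin n) ℝ} (hX : X.PosSemidef)
    (hY : Y.PosSemidef) : 0 ≤ (X * Y).trace := by
  obtain ⟨G, rfl⟩ := CStarAlgebra.nonneg_iff_eq_star_mul_self.mp hY.nonneg
  rw [star_eq_conjTranspose, ← mul_assoc, Matrix.trace_mul_comm, ← mul_assoc]
  exact (hX.mul_mul_conjTranspose_same G).trace_nonneg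

theorem exists_trace_le {n : ℕ} {Y : Matrix (Fin n) (Fin n) ℝ} (hY : Y.PosDef) :
    ∃ s : ℝ, 0 < s ∧ ∀ X : Matrix (Fin n) (Fin n) ℝ, X.PosSemidef → s * X.trace ≤ (X * Y).trace := by
  have h := eventually_posDef (M := fun t : ℝ => Y - t • (1 : Matrix (Fin n) (Fin n) ℝ)) (x₀ := 0)
    (fun i j => by
      simp only [Matrix.sub_apply, Matrix.smul_apply, smul_eq_mul]
      fun_prop)
    (Eventually.of_forall fun t => by
      simp [transpose_eq_of_isHermitian hY.isHermitian]) (by simpa using hY)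
  obtain ⟨s, hs, hs0⟩ := ((h.filter_mono nhdsWithin_le_nhds).and
    (self_mem_nhdsWithin (s := Set.Ioi (0 : ℝ)))).exists
  refine ⟨s, hs0, fun X hX => ?_⟩
  have := trace_mul_nonneg_of_posSemidef hX hs.posSemidef
  rw [mul_sub, Matrix.trace_sub, mul_smul_comm, Matrix.trace_smul, mul_one, smul_eq_mul] at this
  linarith

theorem abs_apply_le_trace {n : ℕ} {X : Matrix (Fin n) (Fin n) ℝ} (hX : X.PosSemidef) (i j : Fin n) :
    |X i j| ≤ X.trace := by
  have hXs : Xᵀ = X := transpose_eq_of_isHermitian hX.isHermitian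
  have hd : ∀ i, X i i ≤ X.trace := fun i =>
    Finset.single_le_sum (f := fun i => X i i) (fun i _ => hX.diag_nonneg) (Finset.mem_univ i)
  have hq : ∀ s : ℝ, 0 ≤ X i i + s * X i j + s * X j i + s * s * X j j := by
    intro s
    have h := hX.dotProduct_mulVec_nonneg (Pi.single i 1 + s • Pi.single j 1)
    rw [star_trivial, Matrix.mulVec_add, Matrix.mulVec_smul, add_dotProduct, smul_dotProduct,
      dotProduct_add, dotProduct_add, dotProduct_smul, dotProduct_smul] at h
    simp at h
    linarith
  have hji : X j i = X i j := congrFun (congrFun hXs i) j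
  have h1 := hq 1
  have h2 := hq (-1)
  rw [hji] at h1 h2
  rw [abs_le]
  constructor <;> linarith [hd i, hd j]

/-- The matrix of the Lyapunov operator of `A`, acting on the entries of a matrix. -/
def lyapMat {n : ℕ} (A : Matrix (Fin n) (Fin n) ℝ) : Matrix (Fin n × Fin n) (Fin n × Fin n) ℝ :=
  Matrix.of fun p q => (if q.2 = p.2 then A q.1 p.1 else 0) + (if q.1 = p.1 then A q.2 p.2 else 0)

theorem lyapMat_mulVec {n : ℕ} (A X : Matrix (Fin n) (Fin n) ℝ) (p : Fin n × Fin n) :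
    (lyapMat A *ᵥ fun q => X q.1 q.2) p = lyapOp A X p.1 p.2 := by
  simp only [lyapMat, mulVec, dotProduct, lyapOp_apply, Matrix.add_apply, mul_apply, transpose_apply, of_apply,
    add_mul, Finset.sum_add_distrib, Fintype.sum_prod_type, ite_mul, zero_mul]
  congr 1
  · simp
  · rw [Finset.sum_comm]
    simp [mul_comm]

theorem contDiffAt_det {E ι : Type*} [NormedAddCommGroup E] [NormedSpace ℝ E] [Fintype ι] [DecidableEq ι]
    {M : E → Matrix ι ι ℝ} {x : E} {k : WithTop ℕ∞} (hM : ∀ i j, ContDiffAt ℝ k (fun x => M x i j) x) :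
    ContDiffAt ℝ k (fun x => (M x).det) x := by
  simp only [Matrix.det_apply]
  refine ContDiffAt.sum fun s _ => ContDiffAt.const_smul _ ?_
  exact contDiffAt_prod fun i _ => hM _ _

theorem contDiffAt_inv_apply {E ι : Type*} [NormedAddCommGroup E] [NormedSpace ℝ E] [Fintype ι]
    [DecidableEq ι] {M : E → Matrix ι ι ℝ} {x : E} {k : WithTop ℕ∞}
    (hM : ∀ i j, ContDiffAt ℝ k (fun x => M x i j) x) (h0 : (M x).det ≠ 0) (i j : ι) :
    ContDiffAt ℝ k (fun x => (M x)⁻¹ i j) x := by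
  simp only [Matrix.inv_def, Matrix.smul_apply, Ring.inverse_eq_inv', smul_eq_mul, Matrix.adjugate_apply]
  refine ((contDiffAt_det hM).inv h0).mul (contDiffAt_det fun a b => ?_)
  simp only [Matrix.updateRow_apply]
  by_cases h : a = j
  · simp only [h, if_true]; exact contDiffAt_const
  · simp only [h, if_false]; exact hM a b

namespace LQR

variable {n m r : ℕ} (P : LQR n m r)

/-- The constant term `Cᵀ Kᵀ R K C + Q` of the Lyapunov equation. -/
def weight (K : Gain m r) : Matrix (Fin n) (Fin n) ℝ :=
  P.C.transpose * K.mat.transpose * P.R * K.mat * P.C + P.Q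

variable {P}

theorem weight_posDef (hQ : P.Q.PosDef) (hR : P.R.PosDef) (K : Gain m r) : (P.weight K).PosDef := by
  have h := hR.posSemidef.conjTranspose_mul_mul_same (K.mat * P.C)
  have e : P.weight K = (K.mat * P.C)ᴴ * P.R * (K.mat * P.C) + P.Q := by
    rw [weight, conjTranspose_eq_transpose_of_trivial, transpose_mul]
    simp only [Matrix.mul_assoc]
  rw [e]
  exact hQ.posSemidef_add h

theorem isLyap_iff {K : Gain m r} {X : Matrix (Fin n) (Fin n) ℝ} :
    P.IsLyap K X ↔ X.PosDef ∧ lyapOp (P.closedLoop K) X = -P.weight K := by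
  rw [IsLyap, lyapOp_apply, weight, eq_neg_iff_add_eq_zero, ← add_assoc]

theorem isLyap_lyap (hQ : P.Q.PosDef) (hR : P.R.PosDef) {K : Gain m r} (hK : K ∈ P.stab) :
    P.IsLyap K (P.lyap K) := by
  have h : ∃ X, P.IsLyap K X := by
    obtain ⟨X, h1, h2⟩ := Matrix.IsStable.exists_posDef (A := P.closedLoop K) hK (weight_posDef hQ hR K)
    exact ⟨X, isLyap_iff.2 ⟨h1, h2⟩⟩
  rw [lyap, dif_pos h]
  exact h.choose_spec

theorem mem_stab_of_isLyap (hQ : P.Q.PosDef) (hR : P.R.PosDef) {K : Gain m r}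
    {X : Matrix (Fin n) (Fin n) ℝ} (h : P.IsLyap K X) : K ∈ P.stab :=
  Matrix.IsStable.of_posDef (isLyap_iff.1 h).1 (weight_posDef hQ hR K) (isLyap_iff.1 h).2

variable (P) in
/-- The solution of the Lyapunov equation by matrix inversion. -/
noncomputable def lyapFormula (K : Gain m r) : Matrix (Fin n) (Fin n) ℝ :=
  Matrix.of fun i j => ((lyapMat (P.closedLoop K))⁻¹ *ᵥ fun q => -P.weight K q.1 q.2) (i, j)

theorem lyapMat_det_ne_zero {K : Gain m r} (hK : K ∈ P.stab) :
    (lyapMat (P.closedLoop K)).det ≠ 0 := by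
  rw [← isUnit_iff_ne_zero, ← Matrix.isUnit_iff_isUnit_det, ← Matrix.mulVec_injective_iff_isUnit]
  intro x y hxy
  have hinj := Matrix.IsStable.lyapOp_injective (A := P.closedLoop K) hK
  have e : ∀ z : Fin n × Fin n → ℝ, z = fun q => (Matrix.of fun i j => z (i, j)) q.1 q.2 :=
    fun z => rfl
  have : (Matrix.of fun i j => x (i, j)) = Matrix.of fun i j => y (i, j) := by
    apply hinj
    ext i j
    rw [← lyapMat_mulVec _ _ (i, j), ← lyapMat_mulVec _ _ (i, j), ← e, ← e]
    exact congrFun hxy (i, j)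
  funext p
  exact congrFun (congrFun this p.1) p.2

theorem lyapOp_lyapFormula {K : Gain m r} (hK : (lyapMat (P.closedLoop K)).det ≠ 0) :
    lyapOp (P.closedLoop K) (P.lyapFormula K) = -P.weight K := by
  ext i j
  rw [← lyapMat_mulVec _ _ (i, j)]
  change (lyapMat (P.closedLoop K) *ᵥ
    ((lyapMat (P.closedLoop K))⁻¹ *ᵥ fun q => -P.weight K q.1 q.2)) (i, j) = _
  rw [Matrix.mulVec_mulVec, Matrix.mul_nonsing_inv _ (isUnit_iff_ne_zero.2 hK), Matrix.one_mulVec]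
  rfl

theorem eq_lyapFormula {K : Gain m r} (hK : (lyapMat (P.closedLoop K)).det ≠ 0)
    {X : Matrix (Fin n) (Fin n) ℝ} (hX : lyapOp (P.closedLoop K) X = -P.weight K) :
    X = P.lyapFormula K := by
  ext i j
  have h1 : (fun q : Fin n × Fin n => -P.weight K q.1 q.2) =
      lyapMat (P.closedLoop K) *ᵥ fun q => X q.1 q.2 := by
    funext q
    rw [lyapMat_mulVec, hX]; rfl
  rw [lyapFormula, of_apply, h1, Matrix.mulVec_mulVec,
    Matrix.nonsing_inv_mul _ (isUnit_iff_ne_zero.2 hK), Matrix.one_mulVec]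

theorem lyap_eq_lyapFormula (hQ : P.Q.PosDef) (hR : P.R.PosDef) {K : Gain m r} (hK : K ∈ P.stab) :
    P.lyap K = P.lyapFormula K :=
  eq_lyapFormula (lyapMat_det_ne_zero hK) (isLyap_iff.1 (isLyap_lyap hQ hR hK)).2

theorem contDiff_closedLoop (i j : Fin n) {k : WithTop ℕ∞} :
    ContDiff ℝ k fun K : Gain m r => P.closedLoop K i j := by
  simp only [closedLoop, Matrix.sub_apply, mul_apply, Gain.mat, of_apply]
  fun_prop

theorem contDiff_weight (i j : Fin n) {k : WithTop ℕ∞} :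
    ContDiff ℝ k fun K : Gain m r => P.weight K i j := by
  simp only [weight, Matrix.add_apply, mul_apply, Gain.mat, of_apply, transpose_apply]
  fun_prop

theorem contDiff_lyapMat (p q : Fin n × Fin n) {k : WithTop ℕ∞} :
    ContDiff ℝ k fun K : Gain m r => lyapMat (P.closedLoop K) p q := by
  simp only [lyapMat, of_apply]
  refine ContDiff.add ?_ ?_
  · split_ifs
    · exact contDiff_closedLoop _ _
    · exact contDiff_const
  · split_ifs
    · exact contDiff_closedLoop _ _
    · exact contDiff_const

theorem contDiffAt_lyapFormula {K : Gain m r} (hK : K ∈ P.stab) (i j : Fin n) {k : WithTop ℕ∞} :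
    ContDiffAt ℝ k (fun K : Gain m r => P.lyapFormula K i j) K := by
  simp only [lyapFormula, of_apply, mulVec, dotProduct]
  refine ContDiffAt.sum fun q _ => ContDiffAt.mul ?_ (contDiff_weight _ _).contDiffAt.neg
  exact contDiffAt_inv_apply (fun p q => (contDiff_lyapMat p q).contDiffAt) (lyapMat_det_ne_zero hK) _ _

theorem isOpen_stab (hQ : P.Q.PosDef) (hR : P.R.PosDef) : IsOpen P.stab := by
  rw [isOpen_iff_mem_nhds]
  intro K hK
  have hdet : ∀ᶠ K' in 𝓝 K, (lyapMat (P.closedLoop K')).det ≠ 0 := by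
    have hc : ContinuousAt (fun K' => (lyapMat (P.closedLoop K')).det) K :=
      (contDiffAt_det (k := 0) fun p q => (contDiff_lyapMat p q).contDiffAt).continuousAt
    exact hc.eventually_ne (lyapMat_det_ne_zero hK)
  have hsymm : ∀ᶠ K' in 𝓝 K, (P.lyapFormula K')ᵀ = P.lyapFormula K' := by
    filter_upwards [hdet] with K' hK'
    refine eq_lyapFormula hK' ?_
    have h := congrArg Matrix.transpose (lyapOp_lyapFormula hK')
    rw [lyapOp_apply, Matrix.transpose_add, Matrix.transpose_mul, Matrix.transpose_mul,
      Matrix.transpose_transpose, Matrix.transpose_neg,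
      transpose_eq_of_isHermitian (weight_posDef hQ hR K').isHermitian, add_comm] at h
    exact h
  have hpos := eventually_posDef (M := P.lyapFormula)
    (fun i j => (contDiffAt_lyapFormula (k := 0) hK i j).continuousAt) hsymm (by
      rw [← lyap_eq_lyapFormula hQ hR hK]
      exact (isLyap_lyap hQ hR hK).1)
  filter_upwards [hpos, hdet] with K' h1 h2
  exact mem_stab_of_isLyap hQ hR (isLyap_iff.2 ⟨h1, lyapOp_lyapFormula h2⟩)

/-- The cost is smooth on the set of the stabilising gains. -/
theorem contDiffAt_cost (hQ : P.Q.PosDef) (hR : P.R.PosDef) {K : Gain m r} (hK : K ∈ P.stab)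
    {k : WithTop ℕ∞} : ContDiffAt ℝ k P.cost K := by
  have h : ContDiffAt ℝ k (fun K' => (P.lyapFormula K' * P.Sig).trace) K := by
    simp only [trace, diag_apply, mul_apply]
    exact ContDiffAt.sum fun i _ => ContDiffAt.sum fun j _ =>
      (contDiffAt_lyapFormula hK i j).mul contDiffAt_const
  refine h.congr_of_eventuallyEq ?_
  filter_upwards [(isOpen_stab hQ hR).mem_nhds hK] with K' hK'
  rw [cost, lyap_eq_lyapFormula hQ hR hK']

/-- The sublevel sets of the cost are closed: the cost blows up at the boundary of the set of the
stabilising gains. -/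
theorem isClosed_sublevel (hQ : P.Q.PosDef) (hR : P.R.PosDef) (hS : P.Sig.PosDef) (c : ℝ) :
    IsClosed {K | K ∈ P.stab ∧ P.cost K ≤ c} := by
  apply IsSeqClosed.isClosed
  intro u K hu hK
  obtain ⟨s, hs0, hs⟩ := exists_trace_le hS
  have hL : ∀ k, P.IsLyap (u k) (P.lyap (u k)) := fun k => isLyap_lyap hQ hR (hu k).1
  have hb : ∀ k, P.lyap (u k) ∈ Set.pi Set.univ fun _ : Fin n => Set.pi Set.univ fun _ : Fin n =>
      Set.Icc (-(c / s)) (c / s) := by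
    intro k i _ j _
    have hpsd := (hL k).1.posSemidef
    have h1 := abs_apply_le_trace hpsd i j
    have h2 := hs _ hpsd
    have h3 : (P.lyap (u k) * P.Sig).trace ≤ c := (hu k).2
    have h4 : (P.lyap (u k)).trace ≤ c / s := by
      rw [le_div_iff₀ hs0]; linarith
    exact abs_le.1 (h1.trans h4)
  have hcomp : IsCompact (Set.pi Set.univ fun _ : Fin n => Set.pi Set.univ fun _ : Fin n =>
      Set.Icc (-(c / s)) (c / s)) :=
    isCompact_univ_pi fun _ => isCompact_univ_pi fun _ => isCompact_Icc
  obtain ⟨X, -, φ, hφ, hX⟩ := hcomp.tendsto_subseq hb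
  have hKφ : Tendsto (fun k => u (φ k)) atTop (𝓝 K) := hK.comp hφ.tendsto_atTop
  have hXij : ∀ i j, Tendsto (fun k => P.lyap (u (φ k)) i j) atTop (𝓝 (X i j)) := fun i j =>
    (tendsto_pi_nhds.1 (tendsto_pi_nhds.1 hX i)) j
  set X' : Matrix (Fin n) (Fin n) ℝ := Matrix.of X with hX'
  have hpsd : X'.PosSemidef := by
    refine Matrix.PosSemidef.of_dotProduct_mulVec_nonneg ?_ fun x => ?_
    · ext i j
      have h1 := hXij i j
      have h2 := hXij j i
      have h3 : ∀ k, P.lyap (u (φ k)) j i = P.lyap (u (φ k)) i j := fun k =>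
        congrFun (congrFun (transpose_eq_of_isHermitian (hL (φ k)).1.isHermitian) i) j
      simp only [h3] at h2
      exact tendsto_nhds_unique h2 h1
    · have h1 : Tendsto (fun k => x ⬝ᵥ (P.lyap (u (φ k)) *ᵥ x)) atTop (𝓝 (x ⬝ᵥ (X' *ᵥ x))) := by
        simp only [dotProduct, mulVec]
        exact tendsto_finsetSum _ fun i _ => (tendsto_finsetSum _ fun j _ =>
          (hXij i j).mul_const _).const_mul _
      rw [star_trivial]
      refine ge_of_tendsto h1 (Eventually.of_forall fun k => ?_)
      simpa using (hL (φ k)).1.posSemidef.dotProduct_mulVec_nonneg x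
  have hcl : ∀ i j, Tendsto (fun k => P.closedLoop (u (φ k)) i j) atTop (𝓝 (P.closedLoop K i j)) :=
    fun i j => ((contDiff_closedLoop (k := 0) i j).continuous.tendsto K).comp hKφ
  have hlyap : lyapOp (P.closedLoop K) X' = -P.weight K := by
    ext i j
    have h1 : Tendsto (fun k => lyapOp (P.closedLoop (u (φ k))) (P.lyap (u (φ k))) i j) atTop
        (𝓝 (lyapOp (P.closedLoop K) X' i j)) := by
      simp only [lyapOp_apply, Matrix.add_apply, mul_apply, transpose_apply]
      exact (tendsto_finsetSum _ fun a _ => (hcl a i).mul (hXij a j)).add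
        (tendsto_finsetSum _ fun a _ => (hXij i a).mul (hcl a j))
    have h2 : Tendsto (fun k => -P.weight (u (φ k)) i j) atTop (𝓝 (-P.weight K i j)) :=
      (((contDiff_weight (k := 0) i j).continuous.tendsto K).comp hKφ).neg
    have h3 : ∀ k, lyapOp (P.closedLoop (u (φ k))) (P.lyap (u (φ k))) i j =
        -P.weight (u (φ k)) i j := fun k => by
      rw [(isLyap_iff.1 (hL (φ k))).2]; rfl
    simp only [h3] at h1
    exact tendsto_nhds_unique h1 h2
  have hKs : K ∈ P.stab := mem_stab_of_isLyap hQ hR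
    (isLyap_iff.2 ⟨posDef_of_posSemidef_lyapOp hpsd (weight_posDef hQ hR K) hlyap, hlyap⟩)
  refine ⟨hKs, ?_⟩
  have hcont : ContinuousAt P.cost K := (contDiffAt_cost (k := 0) hQ hR hKs).continuousAt
  exact le_of_tendsto (hcont.tendsto.comp hK) (Eventually.of_forall fun k => (hu k).2)

end LQR

end Regularity

/-! ### Calculus along segments -/

section Segments

open Filter Topology Set

/-- Comparison of increments from comparison of derivatives. -/
theorem sub_le_sub_of_hasDerivAt_le {g p g' p' : ℝ → ℝ} {T : ℝ} (hT : 0 ≤ T)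
    (hg : ∀ t ∈ Icc 0 T, HasDerivAt g (g' t) t) (hp : ∀ t ∈ Icc 0 T, HasDerivAt p (p' t) t)
    (h : ∀ t ∈ Icc 0 T, g' t ≤ p' t) : g T - g 0 ≤ p T - p 0 := by
  have hanti : AntitoneOn (fun t => g t - p t) (Icc 0 T) := by
    refine antitoneOn_of_deriv_nonpos (convex_Icc _ _) ?_ ?_ ?_
    · exact fun t ht => ((hg t ht).sub (hp t ht)).continuousAt.continuousWithinAt
    · intro t ht
      rw [interior_Icc] at ht
      have := Ioo_subset_Icc_self ht
      exact ((hg t this).sub (hp t this)).differentiableAt.differentiableWithinAt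
    · intro t ht
      rw [interior_Icc] at ht
      have := Ioo_subset_Icc_self ht
      rw [HasDerivAt.deriv (f := fun t => g t - p t) ((hg t this).sub (hp t this))]
      linarith [h t this]
  have := hanti (left_mem_Icc.2 hT) (right_mem_Icc.2 hT) hT
  simp only at this
  linarith

variable {E : Type*} [NormedAddCommGroup E] [InnerProductSpace ℝ E]

/-- A segment that starts in a closed set stays in it, if its part already known to lie in the set
can always be prolonged. -/
theorem segment_mem_of_prolongation {C : Set E} (hC : IsClosed C) {x u : E} {T : ℝ}
    (hx : x ∈ C) (hstart : ∀ᶠ s in 𝓝[>] (0 : ℝ), x + s • u ∈ C)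
    (hstep : ∀ t, 0 < t → t < T → (∀ s ∈ Icc 0 t, x + s • u ∈ C) →
      ∀ᶠ s in 𝓝[>] t, x + s • u ∈ C) :
    ∀ t ∈ Icc 0 T, x + t • u ∈ C := by
  set A : Set ℝ := {t | ∀ s ∈ Icc 0 t, x + s • u ∈ C} with hA
  have hcont : Continuous fun t : ℝ => x + t • u := by fun_prop
  have hsub : Icc 0 T ⊆ A := by
    refine IsClosed.Icc_subset_of_forall_exists_gt ?_ ?_ ?_
    · refine IsSeqClosed.isClosed ?_
      intro τ t hτ ht
      have ht0 : t ∈ Icc 0 T := isClosed_Icc.mem_of_tendsto ht (Eventually.of_forall fun k => (hτ k).2)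
      refine ⟨fun s hs => ?_, ht0⟩
      rcases hs.2.lt_or_eq with hlt | rfl
      · obtain ⟨k, hk⟩ := (ht.eventually_const_lt hlt).exists
        exact (hτ k).1 s ⟨hs.1, hk.le⟩
      · exact hC.mem_of_tendsto ((hcont.tendsto s).comp ht)
          (Eventually.of_forall fun k => (hτ k).1 _ (right_mem_Icc.2 (hτ k).2.1))
    · intro s hs
      have : s = 0 := le_antisymm hs.2 hs.1
      simpa [this] using hx
    · intro t ht y hy
      have hev : ∀ᶠ s in 𝓝[>] t, x + s • u ∈ C := by
        rcases ht.2.1.lt_or_eq with h | h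
        · exact hstep t h ht.2.2 ht.1
        · rw [← h]; exact hstart
      obtain ⟨b, hb, hb'⟩ := mem_nhdsGT_iff_exists_Ioc_subset.1 hev
      refine ⟨min b y, fun s hs => ?_, lt_min hb hy, min_le_right _ _⟩
      rcases le_or_gt s t with h | h
      · exact ht.1 s ⟨hs.1, h⟩
      · exact hb' ⟨h, hs.2.trans (min_le_left _ _)⟩
  exact fun t ht => hsub ht t (right_mem_Icc.2 ht.1)

theorem hasDerivAt_line (x u : E) (t : ℝ) : HasDerivAt (fun t : ℝ => x + t • u) u t := by
  simpa using ((hasDerivAt_id t).smul_const u).const_add x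

/-- A function that is twice continuously differentiable on an open set `Ω` and whose sublevel sets in
`Ω` are closed in the whole space. -/
structure IsBarrierCost (Ω : Set E) (f : E → ℝ) : Prop where
  isOpen : IsOpen Ω
  contDiffAt : ∀ x ∈ Ω, ContDiffAt ℝ 2 f x
  isClosed : ∀ c, IsClosed {x | x ∈ Ω ∧ f x ≤ c}

theorem IsBarrierCost.differentiableAt {Ω : Set E} {f : E → ℝ} (hf : IsBarrierCost Ω f) {x : E}
    (hx : x ∈ Ω) : DifferentiableAt ℝ f x :=
  (hf.contDiffAt x hx).differentiableAt (by norm_num)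

variable [CompleteSpace E]

theorem hasDerivAt_comp_line {F : E → ℝ} {x u : E} {t : ℝ} (hF : DifferentiableAt ℝ F (x + t • u)) :
    HasDerivAt (fun t : ℝ => F (x + t • u)) (inner ℝ (gradient F (x + t • u)) u) t := by
  have h := hF.hasGradientAt.hasFDerivAt.comp_hasDerivAt t (hasDerivAt_line x u t)
  rw [InnerProductSpace.toDual_apply_apply] at h
  exact h

theorem hasDerivAt_gradient_line {F : E → ℝ} {x u : E} {t : ℝ}
    (hF : DifferentiableAt ℝ (gradient F) (x + t • u)) :
    HasDerivAt (fun t : ℝ => inner ℝ (gradient F (x + t • u)) u)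
      (inner ℝ (fderiv ℝ (gradient F) (x + t • u) u) u) t := by
  have h := hF.hasFDerivAt.comp_hasDerivAt t (hasDerivAt_line x u t)
  simpa using h.inner ℝ (hasDerivAt_const t u)

theorem le_of_gradient_le_line {F : E → ℝ} {x u : E} {T c : ℝ} (hT : 0 ≤ T)
    (hF : ∀ t ∈ Icc 0 T, DifferentiableAt ℝ F (x + t • u))
    (h : ∀ t ∈ Icc 0 T, inner ℝ (gradient F (x + t • u) - gradient F x) u ≤ c * t) :
    F (x + T • u) ≤ F x + T * inner ℝ (gradient F x) u + c * T ^ 2 / 2 := by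
  have h1 := sub_le_sub_of_hasDerivAt_le (g := fun t => F (x + t • u))
    (p := fun t => t * inner ℝ (gradient F x) u + c * t ^ 2 / 2)
    (p' := fun t => inner ℝ (gradient F x) u + c * t) hT
    (fun t ht => hasDerivAt_comp_line (hF t ht)) (fun t _ => by
      have h1 := (hasDerivAt_id t).mul_const (inner ℝ (gradient F x) u)
      have h2 := (((hasDerivAt_id t).pow 2).const_mul c).div_const 2
      refine (h1.add h2).congr_deriv ?_
      simp; ring)
    (fun t ht => by
      have := h t ht
      rw [inner_sub_left] at this
      linarith)
  simp only [zero_smul, add_zero, zero_mul, ne_eq, OfNat.ofNat_ne_zero, not_false_eq_true, zero_pow,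
    mul_zero, zero_div, sub_zero] at h1
  linarith

theorem ge_of_gradient_ge_line {F : E → ℝ} {x u : E} {T c : ℝ} (hT : 0 ≤ T)
    (hF : ∀ t ∈ Icc 0 T, DifferentiableAt ℝ F (x + t • u))
    (h : ∀ t ∈ Icc 0 T, c * t ≤ inner ℝ (gradient F (x + t • u) - gradient F x) u) :
    F x + T * inner ℝ (gradient F x) u + c * T ^ 2 / 2 ≤ F (x + T • u) := by
  have h1 := sub_le_sub_of_hasDerivAt_le (p := fun t => F (x + t • u))
    (g := fun t => t * inner ℝ (gradient F x) u + c * t ^ 2 / 2)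
    (g' := fun t => inner ℝ (gradient F x) u + c * t) hT (fun t _ => by
      have h1 := (hasDerivAt_id t).mul_const (inner ℝ (gradient F x) u)
      have h2 := (((hasDerivAt_id t).pow 2).const_mul c).div_const 2
      refine (h1.add h2).congr_deriv ?_
      simp; ring)
    (fun t ht => hasDerivAt_comp_line (hF t ht))
    (fun t ht => by
      have := h t ht
      rw [inner_sub_left] at this
      linarith)
  simp only [zero_smul, add_zero, zero_mul, ne_eq, OfNat.ofNat_ne_zero, not_false_eq_true, zero_pow,
    mul_zero, zero_div, sub_zero] at h1
  linarith

namespace IsBarrierCost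

variable {Ω : Set E} {f : E → ℝ}

theorem gradient_eq : gradient f = fun x => (InnerProductSpace.toDual ℝ E).symm (fderiv ℝ f x) := rfl

theorem differentiableAt_gradient (hf : IsBarrierCost Ω f) {x : E} (hx : x ∈ Ω) :
    DifferentiableAt ℝ (gradient f) x := by
  have h1 : ContDiffAt ℝ 1 (fderiv ℝ f) x := (hf.contDiffAt x hx).fderiv_right (by norm_num)
  have h2 : DifferentiableAt ℝ (fderiv ℝ f) x := h1.differentiableAt (by norm_num)
  exact ((InnerProductSpace.toDual ℝ E).symm.toContinuousLinearEquiv.differentiableAt).comp x h2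

/-- The Hessian operator is symmetric. -/
theorem hess_symm (hf : IsBarrierCost Ω f) {x : E} (hx : x ∈ Ω) (u v : E) :
    inner ℝ (fderiv ℝ (gradient f) x u) v = inner ℝ u (fderiv ℝ (gradient f) x v) := by
  have h1 : ContDiffAt ℝ 1 (fderiv ℝ f) x := (hf.contDiffAt x hx).fderiv_right (by norm_num)
  have h2 : DifferentiableAt ℝ (fderiv ℝ f) x := h1.differentiableAt (by norm_num)
  have hd : ∀ w, fderiv ℝ (gradient f) x w =
      (InnerProductSpace.toDual ℝ E).symm (fderiv ℝ (fderiv ℝ f) x w) := by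
    intro w
    have := ((InnerProductSpace.toDual ℝ E).symm.toContinuousLinearEquiv.hasFDerivAt).comp x
      h2.hasFDerivAt
    rw [gradient_eq]
    exact congrArg (fun g => g w) this.fderiv
  have hs : IsSymmSndFDerivAt ℝ f x := (hf.contDiffAt x hx).isSymmSndFDerivAt (by simp)
  rw [hd, hd, InnerProductSpace.toDual_symm_apply, real_inner_comm,
    InnerProductSpace.toDual_symm_apply]
  exact hs.eq _ _

end IsBarrierCost

end Segments

/-! ### Negative curvature steps -/

section NegativeCurvature

open Filter Topology Set

variable {E : Type*} [NormedAddCommGroup E] [InnerProductSpace ℝ E]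

theorem segment_subset_connectedComponentIn {C : Set E} {x₁ x u : E} {t : ℝ} (ht : 0 ≤ t)
    (hx : x ∈ connectedComponentIn C x₁) (h : ∀ s ∈ Icc 0 t, x + s • u ∈ C) :
    segment ℝ x (x + t • u) ⊆ connectedComponentIn C x₁ := by
  rw [connectedComponentIn_eq hx]
  refine (convex_segment _ _).isPreconnected.subset_connectedComponentIn (left_mem_segment _ _ _) ?_
  rw [segment_eq_image']
  rintro _ ⟨θ, hθ, rfl⟩
  have := h (θ * t) ⟨mul_nonneg hθ.1 ht, mul_le_of_le_one_left ht hθ.2⟩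
  simpa [smul_smul] using this

variable [CompleteSpace E]

theorem IsBarrierCost.eventually_lt_of_descent {Ω : Set E} {f : E → ℝ} (hf : IsBarrierCost Ω f)
    {x u : E} (hx : x ∈ Ω) (h1 : inner ℝ (gradient f x) u ≤ 0)
    (h2 : inner ℝ (fderiv ℝ (gradient f) x u) u < 0) :
    ∀ᶠ s in 𝓝[>] (0 : ℝ), x + s • u ∈ Ω ∧ f (x + s • u) < f x := by
  have hcont : Continuous fun t : ℝ => x + t • u := by fun_prop
  have hΩ : ∀ᶠ s in 𝓝 (0 : ℝ), x + s • u ∈ Ω :=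
    hcont.continuousAt.eventually_mem (hf.isOpen.mem_nhds (by simpa using hx))
  have hder : HasDerivAt (fun t : ℝ => inner ℝ (gradient f (x + t • u)) u)
      (inner ℝ (fderiv ℝ (gradient f) x u) u) 0 := by
    have := hasDerivAt_gradient_line (F := f) (x := x) (u := u) (t := 0)
      (by simpa using hf.differentiableAt_gradient hx)
    simpa using this
  have hneg : ∀ᶠ s in 𝓝[>] (0 : ℝ), inner ℝ (gradient f (x + s • u)) u < 0 := by
    have h3 := (hasDerivAt_iff_tendsto_slope.1 hder).eventually_lt_const h2
    have h4 := h3.filter_mono (nhdsWithin_mono (0 : ℝ) (fun s (hs : 0 < s) => ne_of_gt hs))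
    filter_upwards [h4, self_mem_nhdsWithin] with s hs hs0
    rw [slope_def_field] at hs
    simp only [zero_smul, add_zero, sub_zero] at hs
    rw [div_neg_iff] at hs
    have hs0' : (0 : ℝ) < s := hs0
    rcases hs with h | h
    · linarith [h.2]
    · linarith [h.1]
  obtain ⟨b, hb, hb'⟩ := mem_nhdsGT_iff_exists_Ioc_subset.1
    ((hΩ.filter_mono nhdsWithin_le_nhds).and hneg)
  have hb0 : (0 : ℝ) < b := hb
  refine mem_nhdsGT_iff_exists_Ioc_subset.2 ⟨b, hb, fun s hs => ?_⟩
  have hmem : ∀ t ∈ Icc 0 s, x + t • u ∈ Ω := by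
    intro t ht
    rcases ht.1.lt_or_eq with h | h
    · exact (hb' ⟨h, ht.2.trans hs.2⟩).1
    · simpa [← h] using hx
  refine ⟨hmem s ⟨hs.1.le, le_rfl⟩, ?_⟩
  have hanti : StrictAntiOn (fun t : ℝ => f (x + t • u)) (Icc 0 s) := by
    refine strictAntiOn_of_deriv_neg (convex_Icc _ _) ?_ ?_
    · exact fun t ht =>
        (hasDerivAt_comp_line (hf.differentiableAt (hmem t ht))).continuousAt.continuousWithinAt
    · intro t ht
      rw [interior_Icc] at ht
      rw [(hasDerivAt_comp_line (hf.differentiableAt (hmem t (Ioo_subset_Icc_self ht)))).deriv]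
      exact (hb' ⟨ht.1, ht.2.le.trans hs.2⟩).2
  have := hanti (left_mem_Icc.2 hs.1.le) (right_mem_Icc.2 hs.1.le) hs.1
  simpa using this

/-- A step along a direction of negative curvature `-c` decreases the cost by `2 c³ / (3 L₂²)`.  That
the step stays in the component where the Hessian is Lipschitz is part of the argument: along the step
the cost stays below its initial value, so the step cannot leave the sublevel set. -/
theorem IsBarrierCost.negative_curvature_step {Ω : Set E} {f : E → ℝ} (hf : IsBarrierCost Ω f)
    {c₀ L₂ : ℝ} {x₁ : E} (hL₂ : 0 < L₂)
    (hLip : ∀ K K' : E, segment ℝ K K' ⊆ connectedComponentIn {x | x ∈ Ω ∧ f x ≤ c₀} x₁ →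
      ‖fderiv ℝ (gradient f) K - fderiv ℝ (gradient f) K'‖ ≤ L₂ * ‖K - K'‖)
    {x w : E} (hx : x ∈ connectedComponentIn {x | x ∈ Ω ∧ f x ≤ c₀} x₁) (hw : ‖w‖ = 1)
    (hgrad : inner ℝ (gradient f x) w ≤ 0) {c : ℝ} (hc : 0 < c)
    (hcurv : inner ℝ (fderiv ℝ (gradient f) x w) w = -c) :
    f (x + (2 * c / L₂) • w) ≤ f x - 2 * c ^ 3 / (3 * L₂ ^ 2) := by
  set C := {x | x ∈ Ω ∧ f x ≤ c₀} with hC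
  have hxC : x ∈ C := connectedComponentIn_subset _ _ hx
  -- third-order upper bound along a segment that stays in the sublevel set
  have hcubic : ∀ t, 0 ≤ t → (∀ s ∈ Icc 0 t, x + s • w ∈ C) →
      f (x + t • w) ≤ f x - c * t ^ 2 / 2 + L₂ * t ^ 3 / 6 := by
    intro t ht h
    have hhess : ∀ s ∈ Icc 0 t,
        inner ℝ (fderiv ℝ (gradient f) (x + s • w) w) w ≤ -c + L₂ * s := by
      intro s hs
      have hseg := segment_subset_connectedComponentIn hs.1 hx
        (fun τ hτ => h τ ⟨hτ.1, hτ.2.trans hs.2⟩)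
      have h1 := hLip _ _ hseg
      have h2 : ‖x - (x + s • w)‖ = s := by
        simp [norm_smul, hw, abs_of_nonneg hs.1]
      rw [h2] at h1
      have h3 : |inner ℝ ((fderiv ℝ (gradient f) x - fderiv ℝ (gradient f) (x + s • w)) w) w| ≤
          L₂ * s := by
        refine (abs_real_inner_le_norm _ _).trans ?_
        have := (fderiv ℝ (gradient f) x - fderiv ℝ (gradient f) (x + s • w)).le_opNorm w
        rw [hw, mul_one] at this ⊢
        linarith
      rw [sub_apply, inner_sub_left, hcurv] at h3
      linarith [(abs_le.1 h3).1]
    have hfirst : ∀ s ∈ Icc 0 t,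
        inner ℝ (gradient f (x + s • w)) w ≤ -c * s + L₂ * s ^ 2 / 2 := by
      intro s hs
      have h1 := sub_le_sub_of_hasDerivAt_le
        (g := fun τ => inner ℝ (gradient f (x + τ • w)) w)
        (p := fun τ => -c * τ + L₂ * τ ^ 2 / 2) (p' := fun τ => -c + L₂ * τ) hs.1
        (fun τ hτ => hasDerivAt_gradient_line
          (hf.differentiableAt_gradient (h τ ⟨hτ.1, hτ.2.trans hs.2⟩).1))
        (fun τ _ => by
          have h1 := (hasDerivAt_id τ).const_mul (-c)
          have h2 := (((hasDerivAt_id τ).pow 2).const_mul L₂).div_const 2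
          refine (h1.add h2).congr_deriv ?_
          simp; ring)
        (fun τ hτ => hhess τ ⟨hτ.1, hτ.2.trans hs.2⟩)
      simp only [zero_smul, add_zero, mul_zero, ne_eq, OfNat.ofNat_ne_zero, not_false_eq_true,
        zero_pow, zero_div, sub_zero] at h1
      linarith
    have h1 := sub_le_sub_of_hasDerivAt_le
      (g := fun τ => f (x + τ • w))
      (p := fun τ => -c * τ ^ 2 / 2 + L₂ * τ ^ 3 / 6) (p' := fun τ => -c * τ + L₂ * τ ^ 2 / 2) ht
      (fun τ hτ => hasDerivAt_comp_line (hf.differentiableAt (h τ hτ).1))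
      (fun τ _ => by
        have h1 := (((hasDerivAt_id τ).pow 2).const_mul (-c)).div_const 2
        have h2 := (((hasDerivAt_id τ).pow 3).const_mul L₂).div_const 6
        refine (h1.add h2).congr_deriv ?_
        simp; ring)
      hfirst
    simp only [zero_smul, add_zero, mul_zero, ne_eq, OfNat.ofNat_ne_zero, not_false_eq_true,
      zero_pow, zero_div, sub_zero] at h1
    linarith
  have hT : 0 < 2 * c / L₂ := by positivity
  have hcont : Continuous fun t : ℝ => x + t • w := by fun_prop
  have hmem := segment_mem_of_prolongation (hf.isClosed c₀) (x := x) (u := w) (T := 2 * c / L₂) hxC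
    ((hf.eventually_lt_of_descent hxC.1 hgrad (by rw [hcurv]; linarith)).mono
      fun s hs => ⟨hs.1, hs.2.le.trans hxC.2⟩)
    (fun t ht0 htT h => by
      have h1 := hcubic t ht0.le h
      have h2 : f (x + t • w) < c₀ := by
        have h3 : L₂ * t < 2 * c := by rw [lt_div_iff₀ hL₂] at htT; linarith
        have h4 : 0 < t ^ 2 * (3 * c - L₂ * t) := mul_pos (by positivity) (by linarith)
        have h5 := hxC.2
        nlinarith
      have h3 : x + t • w ∈ Ω := (h t ⟨ht0.le, le_rfl⟩).1
      have h4 : ∀ᶠ s in 𝓝 t, x + s • w ∈ Ω :=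
        hcont.continuousAt.eventually_mem (hf.isOpen.mem_nhds h3)
      have h5 : ∀ᶠ s in 𝓝 t, f (x + s • w) < c₀ :=
        (hasDerivAt_comp_line (hf.differentiableAt h3)).continuousAt.eventually_lt_const h2
      filter_upwards [h4.filter_mono nhdsWithin_le_nhds, h5.filter_mono nhdsWithin_le_nhds]
        with s a b using ⟨a, b.le⟩)
  have := hcubic _ hT.le hmem
  refine this.trans (le_of_eq ?_)
  field_simp
  ring

end NegativeCurvature

/-! ### The distance to a ball -/

section Penalty

open Filter Topology Set

variable {E : Type*} [NormedAddCommGroup E] [InnerProductSpace ℝ E]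

open Classical in
/-- The metric projection onto the closed ball of radius `r` about the origin. -/
noncomputable def ballProj (r : ℝ) (z : E) : E := if ‖z‖ ≤ r then z else (r / ‖z‖) • z

/-- The displacement `z - ballProj r z`, half the gradient of the squared distance to the ball. -/
noncomputable def ballGap (r : ℝ) (z : E) : E := z - ballProj r z

theorem ballGap_of_le {r : ℝ} {z : E} (h : ‖z‖ ≤ r) : ballGap r z = 0 := by
  rw [ballGap, ballProj, if_pos h, sub_self]

theorem norm_ballProj_le {r : ℝ} (hr : 0 ≤ r) (z : E) : ‖ballProj r z‖ ≤ r := by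
  rw [ballProj]
  split_ifs with h
  · exact h
  · push Not at h
    have : 0 < ‖z‖ := hr.trans_lt h
    rw [norm_smul, norm_div, norm_norm, Real.norm_of_nonneg hr, div_mul_cancel₀ _ this.ne']

theorem norm_ballGap {r : ℝ} (hr : 0 ≤ r) (z : E) : ‖ballGap r z‖ = max (‖z‖ - r) 0 := by
  by_cases h : ‖z‖ ≤ r
  · rw [ballGap_of_le h, norm_zero, max_eq_right (by linarith)]
  · rw [ballGap, ballProj, if_neg h]
    push Not at h
    have hz : 0 < ‖z‖ := hr.trans_lt h
    have e : z - (r / ‖z‖) • z = (1 - r / ‖z‖) • z := by rw [sub_smul, one_smul]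
    have h1 : r / ‖z‖ ≤ 1 := by rw [div_le_one hz]; exact h.le
    rw [e, norm_smul, Real.norm_of_nonneg (by linarith), max_eq_left (by linarith)]
    field_simp

/-- The variational inequality of the projection. -/
theorem inner_ballGap_le {r : ℝ} (hr : 0 ≤ r) (z p : E) (hp : ‖p‖ ≤ r) :
    inner ℝ (ballGap r z) (p - ballProj r z) ≤ 0 := by
  by_cases h : ‖z‖ ≤ r
  · rw [ballGap_of_le h, inner_zero_left]
  · have e : ballGap r z = (1 - r / ‖z‖) • z := by
      rw [ballGap, ballProj, if_neg h, sub_smul, one_smul]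
    rw [e, ballProj, if_neg h]
    push Not at h
    have hz : 0 < ‖z‖ := hr.trans_lt h
    have h1 : r / ‖z‖ ≤ 1 := by rw [div_le_one hz]; exact h.le
    rw [inner_smul_left, inner_sub_right, inner_smul_right, real_inner_self_eq_norm_sq]
    simp only [conj_trivial]
    apply mul_nonpos_of_nonneg_of_nonpos (by linarith)
    have h2 : inner ℝ z p ≤ ‖z‖ * ‖p‖ := real_inner_le_norm _ _
    have h3 : ‖z‖ * ‖p‖ ≤ ‖z‖ * r := by gcongr
    have h4 : r / ‖z‖ * ‖z‖ ^ 2 = ‖z‖ * r := by field_simp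
    linarith

/-- The displacement is firmly nonexpansive. -/
theorem norm_sq_ballGap_sub_le {r : ℝ} (hr : 0 ≤ r) (x y : E) :
    ‖ballGap r y - ballGap r x‖ ^ 2 ≤ inner ℝ (ballGap r y - ballGap r x) (y - x) := by
  have h1 := inner_ballGap_le hr y (ballProj r x) (norm_ballProj_le hr x)
  have h2 := inner_ballGap_le hr x (ballProj r y) (norm_ballProj_le hr y)
  have e : y - x = (ballGap r y - ballGap r x) + (ballProj r y - ballProj r x) := by
    simp only [ballGap]; abel
  rw [e]
  rw [inner_add_right, real_inner_self_eq_norm_sq, inner_sub_left _ _ (ballProj r y - ballProj r x)]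
  have e1 : inner ℝ (ballGap r y) (ballProj r y - ballProj r x) =
      -inner ℝ (ballGap r y) (ballProj r x - ballProj r y) := by
    rw [← inner_neg_right, neg_sub]
  rw [e1]
  linarith

theorem inner_ballGap_sub_nonneg {r : ℝ} (hr : 0 ≤ r) (x y : E) :
    0 ≤ inner ℝ (ballGap r y - ballGap r x) (y - x) :=
  (sq_nonneg _).trans (norm_sq_ballGap_sub_le hr x y)

theorem inner_ballGap_sub_le {r : ℝ} (hr : 0 ≤ r) (x y : E) :
    inner ℝ (ballGap r y - ballGap r x) (y - x) ≤ ‖y - x‖ ^ 2 := by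
  have h1 := norm_sq_ballGap_sub_le hr x y
  have h2 : inner ℝ (ballGap r y - ballGap r x) (y - x) ≤ ‖ballGap r y - ballGap r x‖ * ‖y - x‖ :=
    real_inner_le_norm _ _
  nlinarith [norm_nonneg (y - x), norm_nonneg (ballGap r y - ballGap r x),
    sq_nonneg (‖y - x‖ - ‖ballGap r y - ballGap r x‖)]

/-- Outside the ball of twice the radius the squared distance is strongly convex: there the projection
is half the projection onto the larger ball. -/
theorem half_norm_sq_le_inner_ballGap_sub {r : ℝ} (hr : 0 < r) {x y : E} (hx : 2 * r ≤ ‖x‖)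
    (hy : 2 * r ≤ ‖y‖) : ‖y - x‖ ^ 2 / 2 ≤ inner ℝ (ballGap r y - ballGap r x) (y - x) := by
  have key : ∀ z : E, 2 * r ≤ ‖z‖ → ballProj r z = (1 / 2 : ℝ) • ballProj (2 * r) z := by
    intro z hz
    rw [ballProj, if_neg (by linarith), ballProj]
    have hz0 : 0 < ‖z‖ := by linarith
    split_ifs with h
    · rw [le_antisymm h hz]
      congr 1
      field_simp
    · rw [smul_smul]
      congr 1
      field_simp
  have h1 := inner_ballGap_sub_nonneg (r := 2 * r) (by linarith) x y
  have e1 : ballGap (2 * r) y - ballGap (2 * r) x =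
      (y - x) - (ballProj (2 * r) y - ballProj (2 * r) x) := by
    simp only [ballGap]; abel
  have e2 : ballGap r y - ballGap r x =
      (y - x) - (1 / 2 : ℝ) • (ballProj (2 * r) y - ballProj (2 * r) x) := by
    simp only [ballGap]
    rw [key x hx, key y hy, smul_sub]; abel
  rw [e1, inner_sub_left, real_inner_self_eq_norm_sq] at h1
  rw [e2, inner_sub_left, real_inner_self_eq_norm_sq, inner_smul_left]
  simp only [conj_trivial]
  linarith

theorem norm_ballGap_le {r : ℝ} (hr : 0 ≤ r) (z p : E) (hp : ‖p‖ ≤ r) : ‖ballGap r z‖ ≤ ‖z - p‖ := by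
  rw [norm_ballGap hr]
  refine max_le ?_ (norm_nonneg _)
  have := norm_sub_norm_le z p
  linarith

/-- The gradient of the squared distance to a ball. -/
theorem hasGradientAt_sq_dist_ball [CompleteSpace E] {r : ℝ} (hr : 0 ≤ r) (x : E) :
    HasGradientAt (fun z : E => (max (‖z‖ - r) 0) ^ 2) ((2 : ℝ) • ballGap r x) x := by
  have hle : ∀ a b : E, ‖ballGap r b‖ ^ 2 ≤
      ‖ballGap r a‖ ^ 2 + 2 * inner ℝ (ballGap r a) (b - a) + ‖b - a‖ ^ 2 := by
    intro a b
    have h1 := norm_ballGap_le hr b (ballProj r a) (norm_ballProj_le hr a)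
    have e : b - ballProj r a = ballGap r a + (b - a) := by simp only [ballGap]; abel
    rw [e] at h1
    have h2 : ‖ballGap r a + (b - a)‖ ^ 2 = _ := norm_add_sq_real _ _
    rw [← h2]
    gcongr
  rw [hasGradientAt_iff_isLittleO]
  have hbound : ∀ y : E, ‖(max (‖y‖ - r) 0) ^ 2 - (max (‖x‖ - r) 0) ^ 2 -
      inner ℝ ((2 : ℝ) • ballGap r x) (y - x)‖ ≤ ‖y - x‖ ^ 2 := by
    intro y
    rw [← norm_ballGap hr, ← norm_ballGap hr, inner_smul_left, Real.norm_eq_abs, abs_le]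
    simp only [conj_trivial]
    have h1 := hle x y
    have h2 := hle y x
    have h3 := inner_ballGap_sub_nonneg hr x y
    rw [inner_sub_left] at h3
    have e : inner ℝ (ballGap r y) (x - y) = -inner ℝ (ballGap r y) (y - x) := by
      rw [← inner_neg_right, neg_sub]
    rw [e, norm_sub_rev] at h2
    constructor <;> linarith
  refine (Asymptotics.IsBigO.of_bound 1 (Eventually.of_forall fun y => ?_)).trans_isLittleO
    (g := fun y => ‖y - x‖ ^ 2) ?_
  · simpa using hbound y
  · have := Asymptotics.isLittleO_pow_sub_sub x (one_lt_two)
    exact this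

end Penalty

/-! ### The penalised and the regularised cost -/

section Penalised

open Filter Topology Set

variable {E : Type*} [NormedAddCommGroup E]

/-- The cost `f` plus `L` times the squared distance to the ball of radius `r` about `c`. -/
def penalized (f : E → ℝ) (L r : ℝ) (c x : E) : ℝ := f x + L * (max (‖x - c‖ - r) 0) ^ 2

/-- The function `F` plus a quadratic centred at `z`. -/
def proximal (F : E → ℝ) (γ : ℝ) (z x : E) : ℝ := F x + γ * ‖x - z‖ ^ 2

theorem le_penalized (f : E → ℝ) {L : ℝ} (hL : 0 ≤ L) (r : ℝ) (c x : E) : f x ≤ penalized f L r c x := by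
  have : 0 ≤ L * (max (‖x - c‖ - r) 0) ^ 2 := by positivity
  rw [penalized]; linarith

theorem penalized_self (f : E → ℝ) (L : ℝ) {r : ℝ} (hr : 0 ≤ r) (c : E) : penalized f L r c c = f c := by
  simp [penalized, hr]

theorem le_proximal (F : E → ℝ) {γ : ℝ} (hγ : 0 ≤ γ) (z x : E) : F x ≤ proximal F γ z x := by
  have : 0 ≤ γ * ‖x - z‖ ^ 2 := by positivity
  rw [proximal]; linarith

theorem proximal_self (F : E → ℝ) (γ : ℝ) (z : E) : proximal F γ z z = F z := by simp [proximal]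

variable [InnerProductSpace ℝ E] [CompleteSpace E]

theorem hasGradientAt_penalized {f : E → ℝ} {x : E} (hf : DifferentiableAt ℝ f x) (L : ℝ) {r : ℝ}
    (hr : 0 ≤ r) (c : E) :
    HasGradientAt (penalized f L r c) (gradient f x + (2 * L) • ballGap r (x - c)) x := by
  have h1 := (hasGradientAt_sq_dist_ball hr (x - c)).hasFDerivAt
  have h2 : HasFDerivAt (fun y : E => y - c) (ContinuousLinearMap.id ℝ E) x :=
    (hasFDerivAt_id x).sub_const c
  have h3 := (h1.comp x h2).const_mul L
  have h4 := hf.hasGradientAt.hasFDerivAt.add h3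
  rw [hasGradientAt_iff_hasFDerivAt]
  refine h4.congr_fderiv ?_
  ext v
  simp
  ring

theorem hasGradientAt_proximal {F : E → ℝ} {x : E} (hF : DifferentiableAt ℝ F x) (γ : ℝ) (z : E) :
    HasGradientAt (proximal F γ z) (gradient F x + (2 * γ) • (x - z)) x := by
  have h2 : HasFDerivAt (fun y : E => y - z) (ContinuousLinearMap.id ℝ E) x :=
    (hasFDerivAt_id x).sub_const z
  have h3 := (h2.norm_sq).const_mul γ
  have h4 := hF.hasGradientAt.hasFDerivAt.add h3
  rw [hasGradientAt_iff_hasFDerivAt]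
  refine h4.congr_fderiv ?_
  ext v
  simp
  ring

/-- The gradient of the penalised cost is `3 L`-Lipschitz along segments on which the Hessian of the cost
is bounded by `L`. -/
theorem inner_gradient_penalized_le {Ω : Set E} {f : E → ℝ} (hf : IsBarrierCost Ω f) {L r : ℝ}
    (hL : 0 ≤ L) (hr : 0 ≤ r) (c : E) {x u : E} {T : ℝ} (hΩ : ∀ t ∈ Icc 0 T, x + t • u ∈ Ω)
    (hH : ∀ t ∈ Icc 0 T, ‖fderiv ℝ (gradient f) (x + t • u)‖ ≤ L) {t : ℝ} (ht : t ∈ Icc 0 T) :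
    inner ℝ (gradient (penalized f L r c) (x + t • u) - gradient (penalized f L r c) x) u ≤
      3 * L * ‖u‖ ^ 2 * t := by
  have hxΩ : x ∈ Ω := by simpa using hΩ 0 ⟨le_rfl, ht.1.trans ht.2⟩
  rw [(hasGradientAt_penalized (hf.differentiableAt (hΩ t ht)) L hr c).gradient,
    (hasGradientAt_penalized (hf.differentiableAt hxΩ) L hr c).gradient]
  have h1 := sub_le_sub_of_hasDerivAt_le
    (g := fun τ => inner ℝ (gradient f (x + τ • u)) u)
    (p := fun τ => L * ‖u‖ ^ 2 * τ) (p' := fun τ => L * ‖u‖ ^ 2) ht.1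
    (fun τ hτ => hasDerivAt_gradient_line
      (hf.differentiableAt_gradient (hΩ τ ⟨hτ.1, hτ.2.trans ht.2⟩)))
    (fun τ _ => by simpa using (hasDerivAt_id τ).const_mul (L * ‖u‖ ^ 2))
    (fun τ hτ => by
      refine (real_inner_le_norm _ _).trans ?_
      have h2 := (fderiv ℝ (gradient f) (x + τ • u)).le_of_opNorm_le
        (hH τ ⟨hτ.1, hτ.2.trans ht.2⟩) u
      have h3 := mul_le_mul_of_nonneg_right h2 (norm_nonneg u)
      linarith [sq ‖u‖])
  simp only [zero_smul, add_zero, mul_zero, sub_zero] at h1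
  have h2 : t * inner ℝ (ballGap r (x + t • u - c) - ballGap r (x - c)) u ≤ t * (t * ‖u‖ ^ 2) := by
    have h3 := inner_ballGap_sub_le hr (x - c) (x + t • u - c)
    have e : x + t • u - c - (x - c) = t • u := by abel
    rw [e, inner_smul_right, norm_smul, mul_pow, Real.norm_eq_abs, sq_abs] at h3
    linarith
  have h2' : inner ℝ (ballGap r (x + t • u - c) - ballGap r (x - c)) u ≤ t * ‖u‖ ^ 2 := by
    rcases ht.1.lt_or_eq with h | h
    · exact le_of_mul_le_mul_left h2 h
    · simp [← h]
  have e : gradient f (x + t • u) + (2 * L) • ballGap r (x + t • u - c) -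
      (gradient f x + (2 * L) • ballGap r (x - c)) = (gradient f (x + t • u) - gradient f x) +
        (2 * L) • (ballGap r (x + t • u - c) - ballGap r (x - c)) := by
    rw [smul_sub]; abel
  rw [e, inner_add_left, inner_sub_left, inner_smul_left]
  simp only [conj_trivial]
  nlinarith

/-- If the Hessian of the cost at `c` is at least `-α`, then near `c` the cost is `3 α`-semiconvex because
its Hessian is Lipschitz; away from `c` the curvature of the penalty outweighs that of the cost.  Hence
the penalised cost is `3 α`-semiconvex. -/
theorem inner_gradient_penalized_ge {Ω D : Set E} {f : E → ℝ} (hf : IsBarrierCost Ω f) {L₁ L₂ α : ℝ}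
    (hL₁ : 0 ≤ L₁) (hL₂ : 0 < L₂) (hα : 0 < α) {c : E} (hDΩ : D ⊆ Ω)
    (hcD : c ∈ D) (hH : ∀ x ∈ D, ‖fderiv ℝ (gradient f) x‖ ≤ L₁)
    (hLip : ∀ x ∈ D, ∀ y ∈ D,
      ‖fderiv ℝ (gradient f) x - fderiv ℝ (gradient f) y‖ ≤ L₂ * ‖x - y‖)
    (hc : ∀ w, -α * ‖w‖ ^ 2 ≤ inner ℝ (fderiv ℝ (gradient f) c w) w)
    {x u : E} {T : ℝ} (hxD : ∀ t ∈ Icc 0 T, x + t • u ∈ D) {t : ℝ} (ht : t ∈ Icc 0 T) :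
    -(3 * α * ‖u‖ ^ 2) * t ≤
      inner ℝ (gradient (penalized f L₁ (α / L₂) c) (x + t • u) -
        gradient (penalized f L₁ (α / L₂) c) x) u := by
  set r := α / L₂ with hr
  have hr0 : 0 < r := by positivity
  have hline : Continuous fun t : ℝ => x + t • u := by fun_prop
  have hgrad : ∀ t ∈ Icc 0 T, gradient (penalized f L₁ r c) (x + t • u) =
      gradient f (x + t • u) + (2 * L₁) • ballGap r (x + t • u - c) := fun t ht =>
    (hasGradientAt_penalized (hf.differentiableAt (hDΩ (hxD t ht))) L₁ hr0.le c).gradient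
  set h : ℝ → ℝ := fun s => inner ℝ (gradient f (x + s • u)) u with hh
  set p : ℝ → ℝ := fun s => inner ℝ (ballGap r (x + s • u - c)) u with hp
  have hh' : ∀ s ∈ Icc 0 T, HasDerivAt h (inner ℝ (fderiv ℝ (gradient f) (x + s • u) u) u) s :=
    fun s hs => hasDerivAt_gradient_line (hf.differentiableAt_gradient (hDΩ (hxD s hs)))
  -- increments of the penalty part
  have hinc : ∀ s s' : ℝ, (s' - s) * (p s' - p s) =
      inner ℝ (ballGap r (x + s' • u - c) - ballGap r (x + s • u - c))
        (x + s' • u - c - (x + s • u - c)) := by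
    intro s s'
    have e : x + s' • u - c - (x + s • u - c) = (s' - s) • u := by rw [sub_smul]; abel
    rw [e, inner_smul_right, inner_sub_left]
  have hp0 : ∀ s s' : ℝ, s < s' → 0 ≤ p s' - p s := by
    intro s s' hs
    have h1 := inner_ballGap_sub_nonneg hr0.le (x + s • u - c) (x + s' • u - c)
    rw [← hinc] at h1
    exact nonneg_of_mul_nonneg_right h1 (by linarith)
  have hpc : Continuous p := by
    refine Continuous.inner ?_ continuous_const
    have hlip : LipschitzWith 1 (ballGap r : E → E) := by
      refine LipschitzWith.of_dist_le_mul fun a b => ?_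
      rw [NNReal.coe_one, one_mul, dist_eq_norm, dist_eq_norm]
      have h1 := norm_sq_ballGap_sub_le hr0.le b a
      have h2 := inner_ballGap_sub_le hr0.le b a
      exact le_of_sq_le_sq (h1.trans h2) (norm_nonneg _)
    exact hlip.continuous.comp (by fun_prop)
  set G : ℝ → ℝ := fun s => -(h s + 2 * L₁ * p s + 3 * α * ‖u‖ ^ 2 * s) with hG
  have hGc : ContinuousOn G (Icc 0 t) := by
    intro s hs
    have h1 := (hh' s ⟨hs.1, hs.2.trans ht.2⟩).continuousAt
    exact (((h1.add (continuousAt_const.mul hpc.continuousAt)).add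
      (continuousAt_const.mul continuousAt_id)).neg).continuousWithinAt
  have hmain : G t ≤ G 0 := by
    refine image_le_of_liminf_slope_right_le_deriv_boundary (B := fun _ => G 0) (B' := fun _ => 0) hGc
      le_rfl continuousOn_const (fun s _ => hasDerivWithinAt_const _ _ _) ?_ (right_mem_Icc.2 ht.1)
    intro s hs η hη
    have hsT : s ∈ Icc 0 T := ⟨hs.1, hs.2.le.trans ht.2⟩
    have hslope := (hasDerivAt_iff_tendsto_slope.1 (hh' s hsT)).mono_left
      (nhdsWithin_mono s (fun τ (hτ : s < τ) => ne_of_gt hτ))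
    set hs' := inner ℝ (fderiv ℝ (gradient f) (x + s • u) u) u with hhs'
    -- a lower bound `q` for the slope of the penalty part that compensates the curvature of `f`
    obtain ⟨q, hq, hq'⟩ : ∃ q : ℝ, 0 ≤ hs' + q + 3 * α * ‖u‖ ^ 2 ∧
        ∀ᶠ τ in 𝓝[>] s, q * (τ - s) ≤ 2 * L₁ * (p τ - p s) := by
      by_cases hcase : ‖x + s • u - c‖ ≤ 2 * r
      · refine ⟨0, ?_, ?_⟩
        · have h1 := hLip _ (hxD s hsT) c hcD
          have h2 : L₂ * ‖x + s • u - c‖ ≤ 2 * α := by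
            calc L₂ * ‖x + s • u - c‖ ≤ L₂ * (2 * r) := by gcongr
              _ = 2 * α := by rw [hr]; field_simp
          have h3 : |inner ℝ ((fderiv ℝ (gradient f) (x + s • u) - fderiv ℝ (gradient f) c) u) u| ≤
              2 * α * ‖u‖ ^ 2 := by
            refine (abs_real_inner_le_norm _ _).trans ?_
            have h4 := (fderiv ℝ (gradient f) (x + s • u) - fderiv ℝ (gradient f) c).le_of_opNorm_le
              (h1.trans h2) u
            nlinarith [norm_nonneg u]
          rw [sub_apply, inner_sub_left] at h3
          have h4 := (abs_le.1 h3).1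
          have h5 := hc u
          linarith
        · filter_upwards [self_mem_nhdsWithin] with τ hτ
          have := hp0 s τ hτ
          rw [zero_mul]
          positivity
      · push Not at hcase
        refine ⟨L₁ * ‖u‖ ^ 2, ?_, ?_⟩
        · have h1 : |hs'| ≤ L₁ * ‖u‖ ^ 2 := by
            refine (abs_real_inner_le_norm _ _).trans ?_
            have h4 := (fderiv ℝ (gradient f) (x + s • u)).le_of_opNorm_le (hH _ (hxD s hsT)) u
            nlinarith [norm_nonneg u]
          have h2 := (abs_le.1 h1).1
          have : 0 ≤ 3 * α * ‖u‖ ^ 2 := by positivity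
          linarith
        · have hcn : ContinuousAt (fun τ : ℝ => ‖x + τ • u - c‖) s := by fun_prop
          filter_upwards [(hcn.eventually_const_lt hcase).filter_mono nhdsWithin_le_nhds,
            self_mem_nhdsWithin] with τ hτ hτ'
          have hτs : 0 < τ - s := sub_pos.2 hτ'
          have h1 := half_norm_sq_le_inner_ballGap_sub hr0 hcase.le hτ.le
          rw [← hinc] at h1
          have e : x + τ • u - c - (x + s • u - c) = (τ - s) • u := by rw [sub_smul]; abel
          rw [e, norm_smul, mul_pow, Real.norm_eq_abs, sq_abs] at h1
          have h2 : (τ - s) * ‖u‖ ^ 2 / 2 ≤ p τ - p s := by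
            have : (τ - s) * ((τ - s) * ‖u‖ ^ 2 / 2) ≤ (τ - s) * (p τ - p s) := by linarith
            exact le_of_mul_le_mul_left this hτs
          nlinarith
    have hev := hslope.eventually_const_lt (show hs' - η < hs' by linarith)
    refine Eventually.frequently ?_
    filter_upwards [hev, hq', self_mem_nhdsWithin] with τ h1 h2 hτ
    have hτs : 0 < τ - s := sub_pos.2 hτ
    rw [slope_def_field, lt_div_iff₀ hτs] at h1
    rw [slope_def_field, div_lt_iff₀ hτs, hG]
    nlinarith
  have h0 : (0 : ℝ) ∈ Icc 0 T := ⟨le_rfl, ht.1.trans ht.2⟩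
  have hg0 := hgrad 0 h0
  rw [zero_smul, add_zero] at hg0
  rw [hgrad t ht, hg0]
  simp only [hG, hh, hp, zero_smul, add_zero, mul_zero] at hmain
  rw [inner_sub_left, inner_add_left, inner_add_left, inner_smul_left, inner_smul_left]
  simp only [conj_trivial]
  linarith

end Penalised

/-! ### Nesterov's accelerated gradient method -/

section Nag

open Filter Topology Set

variable {E : Type} [NormedAddCommGroup E] [InnerProductSpace ℝ E] [CompleteSpace E]

/-- The situation in which NAG is called at `Z`: on a convex set `D` that contains the sublevel set of
`φ` at `Z` and a minimiser `xs`, the function `φ` lies between quadratics of curvature `σ` and `L`. -/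
structure IsWellConditioned (Ω D : Set E) (φ : E → ℝ) (L σ : ℝ) (Z xs : E) : Prop where
  isOpen : IsOpen Ω
  differentiableAt : ∀ x ∈ Ω, DifferentiableAt ℝ φ x
  isClosed : IsClosed {x | x ∈ Ω ∧ φ x ≤ φ Z}
  sublevel_subset : {x | x ∈ Ω ∧ φ x ≤ φ Z} ⊆ D
  subset : D ⊆ Ω
  start_mem : Z ∈ Ω
  pos : 0 < σ
  le : σ ≤ L
  lower : ∀ x ∈ D, ∀ y ∈ D, φ x + inner ℝ (gradient φ x) (y - x) + σ / 2 * ‖y - x‖ ^ 2 ≤ φ y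
  upper : ∀ x ∈ D, ∀ y ∈ D, φ y ≤ φ x + inner ℝ (gradient φ x) (y - x) + L / 2 * ‖y - x‖ ^ 2
  min_mem : xs ∈ D
  min_le : ∀ x ∈ Ω, φ xs ≤ φ x

namespace IsWellConditioned

variable {Ω D : Set E} {φ : E → ℝ} {L σ : ℝ} {Z xs : E}

theorem gradient_min (h : IsWellConditioned Ω D φ L σ Z xs) : gradient φ xs = 0 := by
  have hmin : IsLocalMin φ xs := by
    filter_upwards [h.isOpen.mem_nhds (h.subset h.min_mem)] with x hx using h.min_le x hx
  rw [gradient, hmin.fderiv_eq_zero, map_zero]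

/-- A gradient step of length `1 / L` stays in the sublevel set and decreases `φ` by at least
`‖∇φ‖² / (2 L)`. -/
theorem gradient_step (h : IsWellConditioned Ω D φ L σ Z xs) {x : E} (hx : x ∈ Ω) (hxZ : φ x ≤ φ Z) :
    x - (1 / L) • gradient φ x ∈ Ω ∧
      φ (x - (1 / L) • gradient φ x) ≤ φ x - ‖gradient φ x‖ ^ 2 / (2 * L) := by
  have hL : 0 < L := h.pos.trans_le h.le
  set g := gradient φ x with hg
  by_cases hg0 : g = 0
  · simp [hg0, hx]
  have hgpos : 0 < ‖g‖ ^ 2 := by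
    have := norm_pos_iff.2 hg0
    positivity
  have hxC : x ∈ {x | x ∈ Ω ∧ φ x ≤ φ Z} := ⟨hx, hxZ⟩
  have hline : Continuous fun t : ℝ => x + t • (-g) := by fun_prop
  have hup : ∀ t : ℝ, x + t • (-g) ∈ D →
      φ (x + t • (-g)) ≤ φ x - t * ‖g‖ ^ 2 + L / 2 * (t ^ 2 * ‖g‖ ^ 2) := by
    intro t ht
    have h1 := h.upper x (h.sublevel_subset hxC) _ ht
    have e : x + t • (-g) - x = -(t • g) := by rw [smul_neg]; abel
    rw [e, inner_neg_right, inner_smul_right, norm_neg, norm_smul, mul_pow, Real.norm_eq_abs, sq_abs,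
      ← hg, real_inner_self_eq_norm_sq] at h1
    linarith
  have hmem := segment_mem_of_prolongation h.isClosed (x := x) (u := -g) (T := 1 / L) hxC ?_ ?_
  · have h1 := hmem (1 / L) ⟨by positivity, le_rfl⟩
    have h2 := hup _ (h.sublevel_subset h1)
    have e : x + (1 / L) • (-g) = x - (1 / L) • g := by rw [smul_neg, ← sub_eq_add_neg]
    rw [e] at h1 h2
    refine ⟨h1.1, h2.trans (le_of_eq ?_)⟩
    field_simp
    ring
  · have hder : HasDerivAt (fun t : ℝ => φ (x + t • (-g))) (inner ℝ g (-g)) 0 := by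
      have := hasDerivAt_comp_line (F := φ) (x := x) (u := -g) (t := 0)
        (by simpa using h.differentiableAt x hx)
      rw [zero_smul, add_zero] at this
      exact this
    have h1 : inner ℝ g (-g) < (0 : ℝ) := by
      rw [inner_neg_right, real_inner_self_eq_norm_sq]; linarith
    have h2 := (hasDerivAt_iff_tendsto_slope.1 hder).eventually_lt_const h1
    have h3 := h2.filter_mono (nhdsWithin_mono (0 : ℝ) (fun s (hs : 0 < s) => ne_of_gt hs))
    have h4 : ∀ᶠ s in 𝓝 (0 : ℝ), x + s • (-g) ∈ Ω :=
      hline.continuousAt.eventually_mem (h.isOpen.mem_nhds (by simpa using hx))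
    filter_upwards [h3, h4.filter_mono nhdsWithin_le_nhds, self_mem_nhdsWithin] with s a b hs
    have hs0 : (0 : ℝ) < s := hs
    refine ⟨b, ?_⟩
    rw [slope_def_field, div_lt_iff₀ (by linarith)] at a
    simp only [zero_smul, add_zero, zero_mul] at a
    linarith
  · intro t ht0 htT hmem
    have h1 := hmem t ⟨ht0.le, le_rfl⟩
    have h2 := hup t (h.sublevel_subset h1)
    have h3 : φ (x + t • (-g)) < φ Z := by
      have h4 : L * t < 1 := by rw [lt_div_iff₀ hL] at htT; linarith
      have h5 : 0 < t * ‖g‖ ^ 2 * (2 - L * t) := mul_pos (by positivity) (by linarith)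
      nlinarith
    have h4 : ∀ᶠ s in 𝓝 t, x + s • (-g) ∈ Ω :=
      hline.continuousAt.eventually_mem (h.isOpen.mem_nhds h1.1)
    have h5 : ∀ᶠ s in 𝓝 t, φ (x + s • (-g)) < φ Z :=
      (hasDerivAt_comp_line (h.differentiableAt _ h1.1)).continuousAt.eventually_lt_const h3
    filter_upwards [h4.filter_mono nhdsWithin_le_nhds, h5.filter_mono nhdsWithin_le_nhds]
      with s a b using ⟨a, b.le⟩

/-- The gradient at a point of the sublevel set is controlled by the distance to the minimiser. -/
theorem norm_gradient_sq_le (h : IsWellConditioned Ω D φ L σ Z xs) {x : E} (hx : x ∈ Ω)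
    (hxZ : φ x ≤ φ Z) : ‖gradient φ x‖ ^ 2 ≤ L ^ 2 * ‖x - xs‖ ^ 2 := by
  have hL : 0 < L := h.pos.trans_le h.le
  obtain ⟨h1, h2⟩ := h.gradient_step hx hxZ
  have h3 := h.min_le _ h1
  have h4 := h.upper xs h.min_mem x (h.sublevel_subset ⟨hx, hxZ⟩)
  rw [h.gradient_min, inner_zero_left] at h4
  have h5 : ‖gradient φ x‖ ^ 2 / (2 * L) ≤ L / 2 * ‖x - xs‖ ^ 2 := by linarith
  rw [div_le_iff₀ (by positivity)] at h5
  nlinarith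

theorem norm_sub_min_sq_le (h : IsWellConditioned Ω D φ L σ Z xs) {x : E} (hx : x ∈ D) :
    σ / 2 * ‖x - xs‖ ^ 2 ≤ φ x - φ xs := by
  have h4 := h.lower xs h.min_mem x hx
  rw [h.gradient_min, inner_zero_left] at h4
  linarith

end IsWellConditioned

/-- The Lyapunov function of NAG at a state `(K, y)`: the gap at `y` plus the squared distance of the
extrapolated point `K + √κ (K - y)` to the minimiser. -/
noncomputable def nagPotential (φ : E → ℝ) (L σ : ℝ) (xs K y : E) : ℝ :=
  φ y - φ xs + σ / 2 * ‖K + √(L / σ) • (K - y) - xs‖ ^ 2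

namespace IsWellConditioned

variable {Ω D : Set E} {φ : E → ℝ} {L σ : ℝ} {Z xs : E}

/-- One step of NAG contracts the Lyapunov function by the factor `1 - 1 / √κ`. -/
theorem nagPotential_step (h : IsWellConditioned Ω D φ L σ Z xs) {K y : E} (hK : K ∈ Ω)
    (hKZ : φ K ≤ φ Z) (hy : y ∈ D) :
    nagPotential φ L σ xs
        ((1 + (√(L / σ) - 1) / (√(L / σ) + 1)) • (K - (1 / L) • gradient φ K) -
          ((√(L / σ) - 1) / (√(L / σ) + 1)) • y)
        (K - (1 / L) • gradient φ K) ≤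
      (1 - 1 / √(L / σ)) * nagPotential φ L σ xs K y := by
  have hL : 0 < L := h.pos.trans_le h.le
  have hσ := h.pos
  set s := √(L / σ) with hs
  have hs1 : 1 ≤ s := by
    rw [hs, Real.one_le_sqrt, le_div_iff₀ hσ]; linarith [h.le]
  have hs0 : 0 < s := by linarith
  have hs2 : L = σ * s ^ 2 := by
    rw [hs, Real.sq_sqrt (by positivity)]; field_simp
  have hKD : K ∈ D := h.sublevel_subset ⟨hK, hKZ⟩
  obtain ⟨-, hdesc⟩ := h.gradient_step hK hKZ
  set g := gradient φ K with hg
  have hlow1 := h.lower K hKD xs h.min_mem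
  have hlow2 := h.lower K hKD y hy
  rw [← hg] at hlow1 hlow2
  set y' := K - (1 / L) • g with hy'
  set b := K - xs with hb
  set c := K - y with hc
  -- the extrapolated point after the step
  have hz' : ((1 + (s - 1) / (s + 1)) • y' - ((s - 1) / (s + 1)) • y) +
      s • (((1 + (s - 1) / (s + 1)) • y' - ((s - 1) / (s + 1)) • y) - y') - xs =
      (b + (s - 1) • c) - (s / L) • g := by
    have e1 : ((1 + (s - 1) / (s + 1)) • y' - ((s - 1) / (s + 1)) • y) =
        y' + ((s - 1) / (s + 1)) • (y' - y) := by
      rw [add_smul, one_smul, smul_sub _ y' y, add_sub_assoc]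
    have e2 : y' + ((s - 1) / (s + 1)) • (y' - y) +
        s • (y' + ((s - 1) / (s + 1)) • (y' - y) - y') = y' + (s - 1) • (y' - y) := by
      rw [add_sub_cancel_left, smul_smul, add_assoc, ← add_smul]
      congr 2
      field_simp
      ring
    rw [e1, e2, hy', hb, hc]
    have e3 : s / L = 1 / L + (s - 1) * (1 / L) := by field_simp; ring
    rw [e3, add_smul, mul_smul]
    simp only [smul_sub]
    abel
  have hz : K + s • (K - y) - xs = b + s • c := by rw [hb, hc]; abel
  rw [nagPotential, nagPotential, ← hs, hz', hz]
  have ebx : xs - K = -b := by rw [hb]; abel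
  have ecy : y - K = -c := by rw [hc]; abel
  rw [ebx, inner_neg_right, norm_neg] at hlow1
  rw [ecy, inner_neg_right, norm_neg] at hlow2
  have n1 : ‖b + (s - 1) • c - (s / L) • g‖ ^ 2 =
      ‖b‖ ^ 2 + 2 * (s - 1) * inner ℝ b c + (s - 1) ^ 2 * ‖c‖ ^ 2
        - 2 * (s / L) * (inner ℝ g b + (s - 1) * inner ℝ g c) + (s / L) ^ 2 * ‖g‖ ^ 2 := by
    rw [norm_sub_sq_real, norm_add_sq_real, inner_add_left, inner_smul_left, inner_smul_right,
      inner_smul_right, inner_smul_right, norm_smul, norm_smul, mul_pow, mul_pow, Real.norm_eq_abs,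
      Real.norm_eq_abs, sq_abs, sq_abs, real_inner_comm g b, real_inner_comm g c]
    simp only [conj_trivial]
    ring
  have n2 : ‖b + s • c‖ ^ 2 = ‖b‖ ^ 2 + 2 * s * inner ℝ b c + s ^ 2 * ‖c‖ ^ 2 := by
    rw [norm_add_sq_real, inner_smul_right, norm_smul, mul_pow, Real.norm_eq_abs, sq_abs]
    ring
  rw [n1, n2]
  set B := ‖b‖ ^ 2
  set C := ‖c‖ ^ 2
  set Γ := ‖g‖ ^ 2
  set bc : ℝ := inner ℝ b c
  set gb : ℝ := inner ℝ g b
  set gc : ℝ := inner ℝ g c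
  have hC0 : 0 ≤ C := sq_nonneg _
  have hq1 : σ / 2 * (s / L) ^ 2 * Γ = Γ / (2 * L) := by
    rw [hs2]; field_simp
  have hq2 : σ * (s / L) = 1 / s := by rw [hs2]; field_simp
  have hθ : 0 ≤ 1 - 1 / s := by
    rw [sub_nonneg, div_le_one hs0]; exact hs1
  have hsc : σ / 2 * ((s - 1) ^ 2 * C) ≤ σ / 2 * ((1 - 1 / s) * (s ^ 2 * C)) := by
    have : (1 - 1 / s) * (s ^ 2 * C) = s * (s - 1) * C := by field_simp
    rw [this]
    have : (s - 1) ^ 2 * C ≤ s * (s - 1) * C := by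
      apply mul_le_mul_of_nonneg_right _ hC0
      nlinarith
    have hσ2 : 0 ≤ σ / 2 := by positivity
    exact mul_le_mul_of_nonneg_left this hσ2
  have hmul1 : (1 / s) * (φ K + -gb + σ / 2 * B) ≤ (1 / s) * φ xs :=
    mul_le_mul_of_nonneg_left hlow1 (by positivity)
  have hmul2 : (1 - 1 / s) * (φ K + -gc) ≤ (1 - 1 / s) * φ y := by
    apply mul_le_mul_of_nonneg_left _ hθ
    have : 0 ≤ σ / 2 * C := by positivity
    linarith
  have hcross : (1 - 1 / s) * (2 * s * bc) = 2 * (s - 1) * bc := by field_simp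
  have hgcx : 1 / s * ((s - 1) * gc) = (1 - 1 / s) * gc := by field_simp
  have e4 : σ / 2 * (B + 2 * (s - 1) * bc + (s - 1) ^ 2 * C - 2 * (s / L) * (gb + (s - 1) * gc) +
      (s / L) ^ 2 * Γ) = σ / 2 * B + σ / 2 * (2 * (s - 1) * bc) + σ / 2 * ((s - 1) ^ 2 * C) -
        (σ * (s / L)) * (gb + (s - 1) * gc) + σ / 2 * (s / L) ^ 2 * Γ := by ring
  rw [e4, hq1, hq2]
  have e5 : (1 - 1 / s) * (φ y - φ xs + σ / 2 * (B + 2 * s * bc + s ^ 2 * C)) =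
      (1 - 1 / s) * φ y - (1 - 1 / s) * φ xs + (1 - 1 / s) * (σ / 2 * B) +
        σ / 2 * ((1 - 1 / s) * (2 * s * bc)) + σ / 2 * ((1 - 1 / s) * (s ^ 2 * C)) := by ring
  rw [e5, hcross]
  have e6 : 1 / s * (gb + (s - 1) * gc) = 1 / s * gb + (1 - 1 / s) * gc := by
    rw [mul_add, hgcx]
  rw [e6]
  linarith

/-- After a (re)start from `K` the Lyapunov function is at most twice the gap of `Z`. -/
theorem nagPotential_start (h : IsWellConditioned Ω D φ L σ Z xs) {K : E} (hK : K ∈ Ω)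
    (hKZ : φ K ≤ φ Z) : nagPotential φ L σ xs K K ≤ 2 * (φ Z - φ xs) := by
  have h1 := h.norm_sub_min_sq_le (h.sublevel_subset ⟨hK, hKZ⟩)
  rw [nagPotential, sub_self, smul_zero, add_zero]
  linarith

/-- The gradient at the current iterate is controlled by the Lyapunov function. -/
theorem norm_gradient_sq_le_potential (h : IsWellConditioned Ω D φ L σ Z xs) {K y : E} (hK : K ∈ Ω)
    (hKZ : φ K ≤ φ Z) (hy : y ∈ D) :
    ‖gradient φ K‖ ^ 2 ≤ 2 * L ^ 2 / σ * nagPotential φ L σ xs K y := by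
  have hL : 0 < L := h.pos.trans_le h.le
  have hσ := h.pos
  set s := √(L / σ) with hs
  have hs0 : 0 < s := Real.sqrt_pos.2 (by positivity)
  have h1 := h.norm_gradient_sq_le hK hKZ
  have h2 := h.norm_sub_min_sq_le hy
  set z := K + s • (K - y) with hz
  have hKx : (1 + s) • (K - xs) = (z - xs) + s • (y - xs) := by
    rw [hz, add_smul, one_smul]
    simp only [smul_sub]
    abel
  have h3 : (1 + s) * ‖K - xs‖ ≤ ‖z - xs‖ + s * ‖y - xs‖ := by
    have := norm_add_le (z - xs) (s • (y - xs))
    rw [← hKx, norm_smul, norm_smul, Real.norm_of_nonneg (by linarith), Real.norm_of_nonneg hs0.le]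
      at this
    exact this
  have h4 : ‖K - xs‖ ^ 2 ≤ ‖z - xs‖ ^ 2 + ‖y - xs‖ ^ 2 := by
    have ha := norm_nonneg (K - xs)
    have hb := norm_nonneg (z - xs)
    have hc := norm_nonneg (y - xs)
    have h5 : ((1 + s) * ‖K - xs‖) ^ 2 ≤ (‖z - xs‖ + s * ‖y - xs‖) ^ 2 := by gcongr
    have h6 : (‖z - xs‖ + s * ‖y - xs‖) ^ 2 ≤ (1 + s) * (‖z - xs‖ ^ 2 + s * ‖y - xs‖ ^ 2) := by
      nlinarith [mul_nonneg hs0.le (sq_nonneg (‖z - xs‖ - ‖y - xs‖))]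
    have h7 : (1 + s) * ‖K - xs‖ ^ 2 ≤ ‖z - xs‖ ^ 2 + s * ‖y - xs‖ ^ 2 := by
      have : (1 + s) * ((1 + s) * ‖K - xs‖ ^ 2) ≤ (1 + s) * (‖z - xs‖ ^ 2 + s * ‖y - xs‖ ^ 2) := by
        calc _ = ((1 + s) * ‖K - xs‖) ^ 2 := by ring
          _ ≤ _ := h5.trans h6
      exact le_of_mul_le_mul_left this (by linarith)
    by_contra hc'
    push Not at hc'
    nlinarith [sq_nonneg ‖z - xs‖, sq_nonneg ‖y - xs‖]
  have h5 : σ / 2 * ‖K - xs‖ ^ 2 ≤ nagPotential φ L σ xs K y := by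
    rw [nagPotential, ← hs, ← hz]
    have : σ / 2 * ‖K - xs‖ ^ 2 ≤ σ / 2 * (‖z - xs‖ ^ 2 + ‖y - xs‖ ^ 2) := by gcongr
    linarith
  calc ‖gradient φ K‖ ^ 2 ≤ L ^ 2 * ‖K - xs‖ ^ 2 := h1
    _ = 2 * L ^ 2 / σ * (σ / 2 * ‖K - xs‖ ^ 2) := by field_simp
    _ ≤ _ := by gcongr

end IsWellConditioned

end Nag

/-! ### The objective of NAG is well conditioned -/

section Objective

open Filter Topology Set

variable {E : Type} [NormedAddCommGroup E] [InnerProductSpace ℝ E] [CompleteSpace E]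
  {Ω D : Set E} {f : E → ℝ} {L₁ L₂ α : ℝ} {c Z xs : E}

theorem differentiableAt_penalized (hf : IsBarrierCost Ω f) (L : ℝ) {r : ℝ} (hr : 0 ≤ r) (c : E) {x : E}
    (hx : x ∈ Ω) : DifferentiableAt ℝ (penalized f L r c) x :=
  (hasGradientAt_penalized (hf.differentiableAt hx) L hr c).differentiableAt

theorem gradient_proximal_sub {F : E → ℝ} {x y : E} (hx : DifferentiableAt ℝ F x)
    (hy : DifferentiableAt ℝ F y) (γ : ℝ) (z : E) :
    gradient (proximal F γ z) y - gradient (proximal F γ z) x =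
      (gradient F y - gradient F x) + (2 * γ) • (y - x) := by
  rw [(hasGradientAt_proximal hx γ z).gradient, (hasGradientAt_proximal hy γ z).gradient]
  simp only [smul_sub]
  abel

theorem isWellConditioned_proximal (hf : IsBarrierCost Ω f) (hL₁ : 0 < L₁) (hL₂ : 0 < L₂) (hα : 0 < α)
    (hD : Convex ℝ D) (hDΩ : D ⊆ Ω) (hcD : c ∈ D) (hH : ∀ x ∈ D, ‖fderiv ℝ (gradient f) x‖ ≤ L₁)
    (hLip : ∀ x ∈ D, ∀ y ∈ D,
      ‖fderiv ℝ (gradient f) x - fderiv ℝ (gradient f) y‖ ≤ L₂ * ‖x - y‖)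
    (hc : ∀ w, -α * ‖w‖ ^ 2 ≤ inner ℝ (fderiv ℝ (gradient f) c w) w)
    (hZ : Z ∈ Ω) (hxs : xs ∈ D)
    (hmin : ∀ x ∈ Ω, proximal (penalized f L₁ (α / L₂) c) (3 * α) Z xs ≤
      proximal (penalized f L₁ (α / L₂) c) (3 * α) Z x)
    (hsub : {x | x ∈ Ω ∧ proximal (penalized f L₁ (α / L₂) c) (3 * α) Z x ≤
      proximal (penalized f L₁ (α / L₂) c) (3 * α) Z Z} ⊆ D) :
    IsWellConditioned Ω D (proximal (penalized f L₁ (α / L₂) c) (3 * α) Z)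
      (3 * L₁ + 2 * (3 * α)) (3 * α) Z xs := by
  set F := penalized f L₁ (α / L₂) c with hF
  set G := proximal F (3 * α) Z with hG
  have hr : 0 ≤ α / L₂ := by positivity
  have hFd : ∀ x ∈ Ω, DifferentiableAt ℝ F x := fun x hx => differentiableAt_penalized hf L₁ hr c hx
  have hGd : ∀ x ∈ Ω, DifferentiableAt ℝ G x := fun x hx =>
    (hasGradientAt_proximal (hFd x hx) (3 * α) Z).differentiableAt
  have hline : ∀ x ∈ D, ∀ y ∈ D, ∀ t ∈ Icc (0 : ℝ) 1, x + t • (y - x) ∈ D := fun x hx y hy t ht =>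
    hD.add_smul_sub_mem hx hy ht
  have hdiff : ∀ x ∈ D, ∀ y ∈ D, ∀ t ∈ Icc (0 : ℝ) 1,
      inner ℝ (gradient G (x + t • (y - x)) - gradient G x) (y - x) =
        inner ℝ (gradient F (x + t • (y - x)) - gradient F x) (y - x) +
          6 * α * ‖y - x‖ ^ 2 * t := by
    intro x hx y hy t ht
    rw [hG, gradient_proximal_sub (hFd x (hDΩ hx)) (hFd _ (hDΩ (hline x hx y hy t ht))),
      add_sub_cancel_left, inner_add_left, inner_smul_left, inner_smul_left,
      real_inner_self_eq_norm_sq]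
    simp only [conj_trivial]
    ring
  refine ⟨hf.isOpen, hGd, ?_, hsub, hDΩ, hZ, by positivity, by linarith, ?_, ?_, hxs, hmin⟩
  · refine IsSeqClosed.isClosed ?_
    intro u x hu hx
    have hxΩ : x ∈ Ω := by
      refine ((hf.isClosed (G Z)).isSeqClosed (fun k => ⟨(hu k).1, ?_⟩) hx).1
      exact (le_penalized f hL₁.le _ c _).trans ((le_proximal F (by positivity) Z _).trans (hu k).2)
    exact ⟨hxΩ, le_of_tendsto ((hGd x hxΩ).continuousAt.tendsto.comp hx)
      (Eventually.of_forall fun k => (hu k).2)⟩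
  · intro x hx y hy
    have h1 := ge_of_gradient_ge_line (F := G) (x := x) (u := y - x) (T := 1)
      (c := 3 * α * ‖y - x‖ ^ 2) zero_le_one
      (fun t ht => hGd _ (hDΩ (hline x hx y hy t ht)))
      (fun t ht => by
        rw [hdiff x hx y hy t ht]
        have := inner_gradient_penalized_ge hf hL₁.le hL₂ hα hDΩ hcD hH hLip hc (hline x hx y hy) ht
        rw [← hF] at this
        linarith)
    rw [one_smul, add_sub_cancel] at h1
    linarith
  · intro x hx y hy
    have h1 := le_of_gradient_le_line (F := G) (x := x) (u := y - x) (T := 1)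
      (c := (3 * L₁ + 2 * (3 * α)) * ‖y - x‖ ^ 2) zero_le_one
      (fun t ht => hGd _ (hDΩ (hline x hx y hy t ht)))
      (fun t ht => by
        rw [hdiff x hx y hy t ht]
        have := inner_gradient_penalized_le hf hL₁.le hr c
          (fun t ht => hDΩ (hline x hx y hy t ht)) (fun t ht => hH _ (hline x hx y hy t ht)) ht
        rw [← hF] at this
        linarith)
    rw [one_smul, add_sub_cancel] at h1
    linarith

end Objective

/-! ### Executions of A-OLQR -/

namespace LQR

open scoped ENNReal

variable {n m r : ℕ} (P : LQR n m r) (q : Params) (eig : EigRoutine)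

/-- The law of the control state and of the number of operations after `N` steps from the control
state `c`. -/
noncomputable def runFrom : ℕ → Config (Gain m r) → PMF (Config (Gain m r) × ℕ)
  | 0, c => PMF.pure (c, 0)
  | N + 1, c => (P.step q eig c).bind fun d => (runFrom N d.1).map fun e => (e.1, d.2 + e.2)

theorem runFrom_succ (N : ℕ) (c : Config (Gain m r)) :
    P.runFrom q eig (N + 1) c =
      (P.step q eig c).bind fun d => (P.runFrom q eig N d.1).map fun e => (e.1, d.2 + e.2) := rfl

theorem runFrom_succ' (N : ℕ) (c : Config (Gain m r)) :
    P.runFrom q eig (N + 1) c =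
      (P.runFrom q eig N c).bind fun x => (P.step q eig x.1).map fun d => (d.1, x.2 + d.2) := by
  induction N generalizing c with
  | zero => simp [runFrom, PMF.map, Function.comp_def]
  | succ N ih =>
    rw [runFrom_succ]
    conv_rhs => rw [runFrom_succ, PMF.bind_bind]
    simp only [ih]
    congr 1
    funext d
    rw [PMF.map_bind, PMF.bind_map]
    congr 1
    funext x
    rw [PMF.map_comp]
    simp [Function.comp_def, add_assoc]

theorem run_eq_runFrom (K₁ : Gain m r) (N : ℕ) :
    P.run q eig K₁ N = P.runFrom q eig N (.ncd K₁) := by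
  induction N with
  | zero => rfl
  | succ N ih => rw [runFrom_succ', run, ih]

variable {P q eig}

theorem reachable_start (K₁ : Gain m r) : P.Reachable q eig K₁ (.ncd K₁) :=
  ⟨0, 0, by simp [run]⟩

theorem Reachable.step {K₁ : Gain m r} {c : Config (Gain m r)} (h : P.Reachable q eig K₁ c)
    {d : Config (Gain m r) × ℕ} (hd : d ∈ (P.step q eig c).support) : P.Reachable q eig K₁ d.1 := by
  obtain ⟨N, t, hN⟩ := h
  refine ⟨N + 1, t + d.2, ?_⟩
  rw [run, PMF.mem_support_bind_iff]
  exact ⟨(c, t), hN, by rw [PMF.mem_support_map_iff]; exact ⟨d, hd, rfl⟩⟩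

theorem Reachable.step_pure {K₁ : Gain m r} {c c' : Config (Gain m r)} {t : ℕ}
    (h : P.Reachable q eig K₁ c) (hs : P.step q eig c = PMF.pure (c', t)) :
    P.Reachable q eig K₁ c' :=
  h.step (d := (c', t)) (by rw [hs]; simp)

variable (P q eig) in
/-- From `c`, after `τ` or more steps, A-OLQR has returned a point of `Y` with at most `τ` operations,
except with probability at most `calls` times the failure probability of one eigenvector
computation. -/
def Succeeds (Y : Set (Gain m r)) (c : Config (Gain m r)) (calls τ : ℝ) : Prop :=
  ∀ N : ℕ, τ ≤ N → ENNReal.ofReal (1 - calls * q.δeig) ≤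
    (P.runFrom q eig N c).toOuterMeasure {x | (∃ K ∈ Y, x.1 = .done K) ∧ (x.2 : ℝ) ≤ τ}

theorem Succeeds.mono {Y : Set (Gain m r)} {c : Config (Gain m r)} {calls calls' τ τ' : ℝ}
    (hδ : 0 ≤ q.δeig) (h : P.Succeeds q eig Y c calls τ) (hc : calls ≤ calls') (hτ : τ ≤ τ') :
    P.Succeeds q eig Y c calls' τ' := by
  intro N hN
  refine le_trans (ENNReal.ofReal_le_ofReal ?_) ((h N (hτ.trans hN)).trans
    (MeasureTheory.measure_mono fun x hx => ⟨hx.1, hx.2.trans hτ⟩))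
  have := mul_le_mul_of_nonneg_right hc hδ
  linarith

theorem runFrom_done (N : ℕ) (K : Gain m r) :
    P.runFrom q eig N (.done K) = PMF.pure (.done K, 0) := by
  induction N with
  | zero => rfl
  | succ N ih =>
    rw [runFrom_succ, LQR.step, PMF.pure_bind, ih, PMF.pure_map]
    rfl

theorem succeeds_done {Y : Set (Gain m r)} {K : Gain m r} (hK : K ∈ Y) :
    P.Succeeds q eig Y (.done K) 0 0 := by
  intro N _
  rw [runFrom_done, PMF.toOuterMeasure_pure_apply, if_pos ⟨⟨K, hK, rfl⟩, by simp⟩]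
  simp

/-- One step of the algorithm whose outcome is acceptable with probability at least
`1 - calls₁ * δeig`. -/
theorem Succeeds.of_step {Y : Set (Gain m r)} {c : Config (Gain m r)} {calls₁ calls t τ : ℝ}
    (hδ : 0 ≤ q.δeig) (hcalls : 0 ≤ calls) (hcalls₁ : 0 ≤ calls₁) (ht : 1 ≤ t) (hτ : 0 ≤ τ)
    (A : Set (Config (Gain m r) × ℕ))
    (hA : ENNReal.ofReal (1 - calls₁ * q.δeig) ≤ (P.step q eig c).toOuterMeasure A)
    (hsucc : ∀ d ∈ A, d ∈ (P.step q eig c).support → (d.2 : ℝ) ≤ t ∧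
      P.Succeeds q eig Y d.1 calls τ) :
    P.Succeeds q eig Y c (calls₁ + calls) (t + τ) := by
  intro N hN
  obtain ⟨N, rfl⟩ : ∃ M, N = M + 1 := by
    refine Nat.exists_eq_add_one.2 ?_
    have : (0 : ℝ) < N := by linarith
    exact_mod_cast this
  push_cast at hN
  rw [runFrom_succ, PMF.toOuterMeasure_bind_apply]
  have hterm : ∀ d, (P.step q eig c) d * A.indicator (fun _ => ENNReal.ofReal (1 - calls * q.δeig)) d ≤
      (P.step q eig c) d * ((P.runFrom q eig N d.1).map fun e => (e.1, d.2 + e.2)).toOuterMeasure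
        {x | (∃ K ∈ Y, x.1 = .done K) ∧ (x.2 : ℝ) ≤ t + τ} := by
    intro d
    by_cases hd : d ∈ (P.step q eig c).support
    · gcongr
      by_cases hdA : d ∈ A
      · rw [Set.indicator_of_mem hdA, PMF.toOuterMeasure_map_apply]
        obtain ⟨h1, h2⟩ := hsucc d hdA hd
        refine (h2 N (by linarith)).trans (MeasureTheory.measure_mono ?_)
        rintro x ⟨hx, hx'⟩
        refine ⟨hx, ?_⟩
        push_cast
        linarith
      · rw [Set.indicator_of_notMem hdA]
        exact zero_le
    · rw [(PMF.apply_eq_zero_iff _ _).2 hd, zero_mul, zero_mul]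
  refine le_trans ?_ (ENNReal.tsum_le_tsum hterm)
  have e : ∀ d, (P.step q eig c) d * A.indicator (fun _ => ENNReal.ofReal (1 - calls * q.δeig)) d =
      A.indicator (P.step q eig c) d * ENNReal.ofReal (1 - calls * q.δeig) := by
    intro d
    by_cases hdA : d ∈ A
    · rw [Set.indicator_of_mem hdA, Set.indicator_of_mem hdA]
    · rw [Set.indicator_of_notMem hdA, Set.indicator_of_notMem hdA, mul_zero, zero_mul]
  simp only [e]
  rw [ENNReal.tsum_mul_right, ← PMF.toOuterMeasure_apply]
  refine le_trans ?_ (mul_le_mul_left hA _)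
  by_cases hneg : 1 - calls * q.δeig ≤ 0
  · rw [ENNReal.ofReal_of_nonpos]
    · exact zero_le
    · have : 0 ≤ calls₁ * q.δeig := by positivity
      linarith
  · push Not at hneg
    by_cases hneg₁ : 1 - calls₁ * q.δeig ≤ 0
    · rw [ENNReal.ofReal_of_nonpos]
      · exact zero_le
      · have : 0 ≤ calls * q.δeig := by positivity
        linarith
    · push Not at hneg₁
      rw [← ENNReal.ofReal_mul hneg₁.le]
      apply ENNReal.ofReal_le_ofReal
      have : 0 ≤ (calls₁ * q.δeig) * (calls * q.δeig) := by positivity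
      nlinarith

theorem Succeeds.of_step_pure {Y : Set (Gain m r)} {c c' : Config (Gain m r)} {calls t τ : ℝ} {k : ℕ}
    (hδ : 0 ≤ q.δeig) (hcalls : 0 ≤ calls) (hτ : 0 ≤ τ) (ht : 1 ≤ t)
    (hs : P.step q eig c = PMF.pure (c', k)) (hk : (k : ℝ) ≤ t)
    (h : P.Succeeds q eig Y c' calls τ) : P.Succeeds q eig Y c calls (t + τ) := by
  have := Succeeds.of_step (Y := Y) (c := c) (calls₁ := 0) (t := t) hδ hcalls le_rfl ht hτ {(c', k)}
    (by rw [hs, PMF.toOuterMeasure_pure_apply, if_pos (Set.mem_singleton _)]; simp)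
    (by
      rintro d rfl _
      exact ⟨hk, h⟩)
  rwa [zero_add] at this

end LQR

/-! ### One call of NAG -/

namespace LQR

variable {n m r : ℕ}

/-- What the analysis of an execution of A-OLQR uses: the properties of the cost, the relations between
the parameters, the confinement of the iterates, and an eigenvector computation which, on the Hessians
met by NCD, takes at most `e - 5` operations and fails with probability at most `δeig`. -/
structure IsExecution (P : LQR n m r) (q : Params) (eig : EigRoutine) (K₀ K₁ : Gain m r) (S : ℕ)
    (e : ℝ) : Prop where
  barrier : IsBarrierCost P.stab P.cost
  ε_pos : 0 < q.ε
  L₁_pos : 0 < q.L₁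
  L₂_pos : 0 < q.L₂
  α_pos : 0 < q.α
  α_sq : q.α ^ 2 = q.L₂ * q.ε
  α_le : q.α ≤ q.L₁
  δeig_nonneg : 0 ≤ q.δeig
  smooth : P.SmoothOn (P.subComp K₀ K₁) q.L₁ q.L₂
  gap : ∀ K ∈ P.stab, P.cost K₁ - P.cost K ≤ q.Δ
  confined : P.Confined q eig (P.subComp K₀ K₁) K₁
  restarts : P.RestartsAtMost q eig K₁ S
  eig_support : ∀ K ∈ P.subComp K₀ K₁, ∀ p ∈ (eig.law q.L₁ (q.α / 2) q.δeig (hess P.cost K)).support,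
    ‖p.1‖ = 1 ∧ (p.2 : ℝ) + 5 ≤ e
  eig_prob : ∀ K ∈ P.subComp K₀ K₁, ENNReal.ofReal (1 - q.δeig) ≤
    (eig.law q.L₁ (q.α / 2) q.δeig (hess P.cost K)).toOuterMeasure
      {p | ∀ w, ‖w‖ = 1 → inner ℝ (hess P.cost K p.1) p.1 ≤ inner ℝ (hess P.cost K w) w + q.α / 2}

theorem subComp_subset (P : LQR n m r) (K₀ K₁ : Gain m r) : P.subComp K₀ K₁ ⊆ P.stab :=
  fun _ hK => (connectedComponentIn_subset _ _ hK).1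

variable {P : LQR n m r} {q : Params} {eig : EigRoutine} {K₀ K₁ : Gain m r} {S : ℕ} {e : ℝ}

namespace IsExecution

/-- The objective of every call of NAG is well conditioned, provided that the Hessian of the cost at
`Khat` is bounded below by `-α`. -/
theorem isWellConditioned (h : IsExecution P q eig K₀ K₁ S e) {Khat Kc : Gain m r} {s : NagState (Gain m r)}
    (hreach : P.Reachable q eig K₁ (.nag Khat Kc s)) (hKc : Kc ∈ P.stab)
    (hhess : ∀ w, -q.α * ‖w‖ ^ 2 ≤ inner ℝ (hess P.cost Khat w) w) :
    ∃ D xs, IsWellConditioned P.stab D (P.costReg q Khat Kc) (3 * q.L₁ + 2 * (3 * q.α)) (3 * q.α)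
      Kc xs := by
  obtain ⟨D, hD, hDS, hKD, ⟨xs, hxs, hmin⟩, hsub⟩ := h.confined.2 _ _ _ hreach
  exact ⟨D, xs, isWellConditioned_proximal h.barrier h.L₁_pos h.L₂_pos h.α_pos hD
    (hDS.trans (P.subComp_subset K₀ K₁)) hKD (fun x hx => h.smooth.1 x (hDS hx))
    (fun x hx y hy => h.smooth.2 x y ((hD.segment_subset hx hy).trans hDS)) hhess hKc hxs hmin hsub⟩

/-- NAG ends after at most `(S + 1) (I + 1)` passes through its loop if `I` consecutive steps without
a restart suffice to make the gradient small. -/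
theorem nag_succeeds (h : IsExecution P q eig K₀ K₁ S e) {I : ℕ}
    (hI : 2 * (3 * q.L₁ + 2 * (3 * q.α)) ^ 2 / (3 * q.α) *
      ((1 - 1 / √((3 * q.L₁ + 2 * (3 * q.α)) / (3 * q.α))) ^ I * (2 * q.Δ)) < q.εnag ^ 2)
    {Khat Kc : Gain m r} {Y : Set (Gain m r)} {calls τ : ℝ} (hcalls : 0 ≤ calls) (hτ : 0 ≤ τ)
    (hKc : Kc ∈ P.stab) (hF : P.costPen q Khat Kc ≤ P.cost K₁)
    (hhess : ∀ w, -q.α * ‖w‖ ^ 2 ≤ inner ℝ (hess P.cost Khat w) w)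
    (hreach : P.Reachable q eig K₁ (.nag Khat Kc ⟨Kc, Kc, 0⟩))
    (hexit : ∀ K ∈ P.stab, P.Reachable q eig K₁ (.semi Khat K) →
      P.costReg q Khat Kc K ≤ P.costReg q Khat Kc Kc → ‖gradient (P.costReg q Khat Kc) K‖ < q.εnag →
      P.Succeeds q eig Y (.semi Khat K) calls τ) :
    P.Succeeds q eig Y (.nag Khat Kc ⟨Kc, Kc, 0⟩) calls (14 * ((S + 1) * (I + 1)) + τ) := by
  obtain ⟨D, xs, hw⟩ := h.isWellConditioned hreach hKc hhess
  have hα := h.α_pos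
  have hL₁ := h.L₁_pos
  set φ := P.costReg q Khat Kc with hφ
  set L := 3 * q.L₁ + 2 * (3 * q.α) with hL
  set σ := 3 * q.α with hσ
  have hε : 0 ≤ q.εnag := by
    have := h.ε_pos
    unfold Params.εnag; positivity
  have hκ : 1 ≤ √(L / σ) := by
    rw [Real.one_le_sqrt, le_div_iff₀ hw.pos]; linarith [hw.le]
  have hrate : 0 ≤ 1 - 1 / √(L / σ) := by
    have : 1 / √(L / σ) ≤ 1 := by rw [div_le_one (by linarith)]; exact hκ
    linarith
  have hgap : 2 * (φ Kc - φ xs) ≤ 2 * q.Δ := by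
    have h1 : φ Kc = P.costPen q Khat Kc := proximal_self (P.costPen q Khat) _ _
    have h2 : P.cost xs ≤ φ xs :=
      (le_penalized P.cost h.L₁_pos.le (q.α / q.L₂) Khat xs).trans
        (le_proximal (P.costPen q Khat) (by positivity) Kc xs)
    have h3 := h.gap xs (hw.subset hw.min_mem)
    linarith
  have key : ∀ (k i : ℕ) (s : NagState (Gain m r)), P.Reachable q eig K₁ (.nag Khat Kc s) →
      s.K ∈ P.stab → φ s.K ≤ φ Kc → s.y ∈ D →
      nagPotential φ L σ xs s.K s.y ≤ (1 - 1 / √(L / σ)) ^ i * (2 * q.Δ) → i ≤ I →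
      S * (I + 1) + I ≤ k + s.restarts * (I + 1) + i →
      P.Succeeds q eig Y (.nag Khat Kc s) calls (14 * (k + 1) + τ) := by
    intro k
    induction k with
    | zero =>
      intro i s hs hK hKZ hy hV hi hk
      have hρ := h.restarts _ _ _ hs
      have hg := hw.norm_gradient_sq_le_potential hK hKZ hy
      have hLσ : 0 ≤ 2 * L ^ 2 / σ := by positivity
      have hiI : i = I := by
        have : s.restarts * (I + 1) ≤ S * (I + 1) := Nat.mul_le_mul_right _ hρ
        omega
      have hsmall : ‖gradient φ s.K‖ < q.εnag := by
        refine lt_of_pow_lt_pow_left₀ 2 hε (lt_of_le_of_lt (hg.trans ?_) hI)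
        rw [← hiI]
        exact mul_le_mul_of_nonneg_left hV hLσ
      have hstep : P.step q eig (.nag Khat Kc s) = PMF.pure (.semi Khat s.K, 7) := by
        simp only [LQR.step]
        rw [if_pos hsmall]
      exact Succeeds.of_step_pure h.δeig_nonneg hcalls hτ (by norm_num) hstep (by norm_num)
        (hexit _ hK (hs.step_pure hstep) hKZ hsmall)
    | succ k ih =>
      intro i s hs hK hKZ hy hV hi hk
      by_cases hsmall : ‖gradient φ s.K‖ < q.εnag
      · have hstep : P.step q eig (.nag Khat Kc s) = PMF.pure (.semi Khat s.K, 7) := by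
          simp only [LQR.step]
          rw [if_pos hsmall]
        refine Succeeds.of_step_pure h.δeig_nonneg hcalls hτ ?_ hstep ?_
          (hexit _ hK (hs.step_pure hstep) hKZ hsmall)
        · push_cast; nlinarith [(Nat.cast_nonneg k : (0 : ℝ) ≤ k)]
        · push_cast; nlinarith [(Nat.cast_nonneg k : (0 : ℝ) ≤ k)]
      have hiI : i < I := by
        refine lt_of_le_of_ne hi fun hiI => hsmall ?_
        have hg := hw.norm_gradient_sq_le_potential hK hKZ hy
        have hLσ : 0 ≤ 2 * L ^ 2 / σ := by positivity
        refine lt_of_pow_lt_pow_left₀ 2 hε (lt_of_le_of_lt (hg.trans ?_) hI)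
        rw [← hiI]
        exact mul_le_mul_of_nonneg_left hV hLσ
      have hstep : P.step q eig (.nag Khat Kc s) =
          PMF.pure (.nag Khat Kc (nagNext P.stab φ Kc L σ s), 14) := by
        simp only [LQR.step]
        rw [if_neg hsmall]
      have hs' := hs.step_pure hstep
      have hgoal : P.Succeeds q eig Y (.nag Khat Kc (nagNext P.stab φ Kc L σ s)) calls
          (14 * (k + 1) + τ) := by
        have hgs := hw.gradient_step hK hKZ
        have hVs := hw.nagPotential_step hK hKZ hy
        by_cases hacc : ((1 + (√(L / σ) - 1) / (√(L / σ) + 1)) • (s.K - (1 / L) • gradient φ s.K) -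
            ((√(L / σ) - 1) / (√(L / σ) + 1)) • s.y) ∈ P.stab ∧
            φ ((1 + (√(L / σ) - 1) / (√(L / σ) + 1)) • (s.K - (1 / L) • gradient φ s.K) -
            ((√(L / σ) - 1) / (√(L / σ) + 1)) • s.y) < φ Kc
        · have hnext : nagNext P.stab φ Kc L σ s =
              ⟨(1 + (√(L / σ) - 1) / (√(L / σ) + 1)) • (s.K - (1 / L) • gradient φ s.K) -
                ((√(L / σ) - 1) / (√(L / σ) + 1)) • s.y,
                s.K - (1 / L) • gradient φ s.K, s.restarts⟩ := by
            simp only [nagNext]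
            rw [if_pos hacc]
          rw [hnext] at hs' ⊢
          refine ih (i + 1) _ hs' hacc.1 hacc.2.le (hw.sublevel_subset ⟨hgs.1, ?_⟩) ?_ hiI ?_
          · have hLpos : 0 < L := hw.pos.trans_le hw.le
            have : 0 ≤ ‖gradient φ s.K‖ ^ 2 / (2 * L) := by positivity
            linarith [hgs.2]
          · refine hVs.trans ?_
            rw [pow_succ', mul_assoc]
            exact mul_le_mul_of_nonneg_left hV hrate
          · simp only
            omega
        · have hnext : nagNext P.stab φ Kc L σ s = ⟨s.K, s.K, s.restarts + 1⟩ := by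
            simp only [nagNext]
            rw [if_neg hacc]
          rw [hnext] at hs' ⊢
          refine ih 0 _ hs' hK hKZ (hw.sublevel_subset ⟨hK, hKZ⟩) ?_ (Nat.zero_le _) ?_
          · rw [pow_zero, one_mul]
            exact (hw.nagPotential_start hK hKZ).trans hgap
          · simp only [Nat.add_mul, one_mul]
            omega
      have := Succeeds.of_step_pure (t := 14) h.δeig_nonneg hcalls (by positivity) (by norm_num) hstep
        (by norm_num) hgoal
      convert this using 1
      push_cast; ring
  have := key (S * (I + 1) + I) 0 ⟨Kc, Kc, 0⟩ hreach hKc le_rfl (hw.sublevel_subset ⟨hKc, le_rfl⟩)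
    (by
      rw [pow_zero, one_mul]
      exact (hw.nagPotential_start hKc le_rfl).trans hgap) (Nat.zero_le _) (by simp)
  convert this using 1
  push_cast; ring

end IsExecution

end LQR

/-! ### Negative curvature descent within an execution -/

namespace LQR

variable {n m r : ℕ} {P : LQR n m r} {q : Params} {eig : EigRoutine} {K₀ K₁ : Gain m r} {S : ℕ} {e : ℝ}

theorem neg_mul_norm_sq_le_of_unit {H : Gain m r →L[ℝ] Gain m r} {a : ℝ}
    (hH : ∀ w, ‖w‖ = 1 → -a ≤ inner ℝ (H w) w) (w : Gain m r) : -a * ‖w‖ ^ 2 ≤ inner ℝ (H w) w := by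
  by_cases hw : w = 0
  · simp [hw]
  have hpos : 0 < ‖w‖ := norm_pos_iff.2 hw
  have h1 := hH (‖w‖⁻¹ • w) (by rw [norm_smul, norm_inv, norm_norm, inv_mul_cancel₀ hpos.ne'])
  rw [map_smul, inner_smul_left, inner_smul_right, conj_trivial] at h1
  have h2 := mul_le_mul_of_nonneg_right h1 (sq_nonneg ‖w‖)
  have e1 : ‖w‖⁻¹ * (‖w‖⁻¹ * inner ℝ (H w) w) * ‖w‖ ^ 2 = inner ℝ (H w) w := by
    field_simp
  linarith

namespace IsExecution

theorem ε_sq_div (h : IsExecution P q eig K₀ K₁ S e) : q.ε ^ 2 / q.α = q.α ^ 3 / q.L₂ ^ 2 := by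
  have h1 := h.α_pos
  have h2 := h.L₂_pos
  have h3 : q.ε = q.α ^ 2 / q.L₂ := by rw [h.α_sq]; field_simp
  rw [h3]; field_simp

/-- A move along a direction of curvature at most `-α / 2` decreases the cost by `ε² / (12 α)`. -/
theorem cost_move_le (h : IsExecution P q eig K₀ K₁ S e) {K v : Gain m r} (hK : K ∈ P.subComp K₀ K₁)
    (hv : ‖v‖ = 1) (hcurv : inner ℝ (hess P.cost K v) v ≤ -q.α / 2) :
    P.cost (K - (2 * |(inner ℝ (hess P.cost K v) v : ℝ)| / q.L₂ *
      (if 0 ≤ (inner ℝ v (gradient P.cost K) : ℝ) then 1 else -1)) • v) ≤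
        P.cost K - 1 / 12 * (q.ε ^ 2 / q.α) := by
  have hα := h.α_pos
  have hL₂ := h.L₂_pos
  set c := |(inner ℝ (hess P.cost K v) v : ℝ)| with hc
  have hneg : (inner ℝ (hess P.cost K v) v : ℝ) < 0 := by linarith
  have hc' : c = -inner ℝ (hess P.cost K v) v := abs_of_neg hneg
  set sgn : ℝ := if 0 ≤ (inner ℝ v (gradient P.cost K) : ℝ) then 1 else -1 with hsgn
  have hsq : sgn * sgn = 1 := by rw [hsgn]; split_ifs <;> norm_num
  have habs : |sgn| = 1 := by rw [hsgn]; split_ifs <;> norm_num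
  have hg : inner ℝ (gradient P.cost K) (-(sgn • v)) ≤ 0 := by
    rw [inner_neg_right, inner_smul_right, real_inner_comm, hsgn]
    split_ifs with h0
    · linarith
    · push Not at h0
      linarith
  have hcc : inner ℝ (fderiv ℝ (gradient P.cost) K (-(sgn • v))) (-(sgn • v)) = -c := by
    rw [map_neg, map_smul, inner_neg_neg, inner_smul_left, inner_smul_right, conj_trivial, ← mul_assoc,
      hsq, one_mul, hc', neg_neg]
    rfl
  have h1 := h.barrier.negative_curvature_step hL₂ h.smooth.2 hK (w := -(sgn • v)) (c := c)
    (by rw [norm_neg, norm_smul, Real.norm_eq_abs, habs, hv, one_mul]) hg (by linarith) hcc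
  have e1 : K - (2 * c / q.L₂ * sgn) • v = K + (2 * c / q.L₂) • -(sgn • v) := by
    rw [smul_neg, smul_smul, sub_eq_add_neg]
  rw [e1]
  refine h1.trans ?_
  have h2 : q.α / 2 ≤ c := by linarith
  have h3 : (q.α / 2) ^ 3 ≤ c ^ 3 := pow_le_pow_left₀ (by positivity) h2 3
  have h4 : 2 * (q.α / 2) ^ 3 / (3 * q.L₂ ^ 2) ≤ 2 * c ^ 3 / (3 * q.L₂ ^ 2) := by gcongr
  have h5 : 2 * (q.α / 2) ^ 3 / (3 * q.L₂ ^ 2) = 1 / 12 * (q.α ^ 3 / q.L₂ ^ 2) := by field_simp; norm_num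
  rw [h.ε_sq_div]
  linarith

/-- One pass through the loop of NCD: except with probability `δeig`, either the cost decreases by
`ε² / (12 α)`, or NCD stops at a point where the Hessian is bounded below by `-α`. -/
theorem ncd_succeeds (h : IsExecution P q eig K₀ K₁ S e) {K : Gain m r} {Y : Set (Gain m r)}
    {calls τ : ℝ} (hcalls : 0 ≤ calls) (hτ : 0 ≤ τ) (hreach : P.Reachable q eig K₁ (.ncd K))
    (hmove : ∀ K', P.Reachable q eig K₁ (.ncd K') → P.cost K' ≤ P.cost K - 1 / 12 * (q.ε ^ 2 / q.α) →
      P.Succeeds q eig Y (.ncd K') calls τ)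
    (hreturn : P.Reachable q eig K₁ (.outer K) →
      (∀ w, -q.α * ‖w‖ ^ 2 ≤ inner ℝ (hess P.cost K w) w) →
      P.Succeeds q eig Y (.outer K) calls τ) :
    P.Succeeds q eig Y (.ncd K) (1 + calls) (e + τ) := by
  have hK := h.confined.1 K hreach
  set law := eig.law q.L₁ (q.α / 2) q.δeig (hess P.cost K) with hlaw
  have he : 1 ≤ e := by
    obtain ⟨p, hp⟩ := law.support_nonempty
    have := (h.eig_support K hK p hp).2
    have h0 : (0 : ℝ) ≤ p.2 := Nat.cast_nonneg _
    linarith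
  classical
  set g : Gain m r × ℕ → Config (Gain m r) × ℕ := fun p =>
    if (inner ℝ (hess P.cost K p.1) p.1 : ℝ) ≤ -q.α / 2 then
      (.ncd (K - (2 * |(inner ℝ (hess P.cost K p.1) p.1 : ℝ)| / q.L₂ *
        (if 0 ≤ (inner ℝ p.1 (gradient P.cost K) : ℝ) then 1 else -1)) • p.1), p.2 + 5)
    else (.outer K, p.2 + 2) with hg
  have hstep : P.step q eig (.ncd K) = law.bind fun p => PMF.pure (g p) := by
    simp only [LQR.step]
    congr 1
    funext p
    by_cases hcurv : (inner ℝ (hess P.cost K p.1) p.1 : ℝ) ≤ -q.α / 2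
    · rw [if_pos hcurv]
      exact congrArg PMF.pure (if_pos hcurv).symm
    · rw [if_neg hcurv]
      exact congrArg PMF.pure (if_neg hcurv).symm
  set good : Set (Gain m r × ℕ) :=
    {p | ∀ w, ‖w‖ = 1 → inner ℝ (hess P.cost K p.1) p.1 ≤ inner ℝ (hess P.cost K w) w + q.α / 2}
    with hgood
  refine Succeeds.of_step (t := e) h.δeig_nonneg hcalls zero_le_one he hτ
    {d | ∃ p ∈ law.support, p ∈ good ∧ d = g p} ?_ ?_
  · rw [one_mul, hstep]
    have e1 : (law.bind fun p => PMF.pure (g p)) = law.map g := rfl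
    rw [e1, PMF.toOuterMeasure_map_apply]
    refine (h.eig_prob K hK).trans ?_
    rw [← PMF.toOuterMeasure_apply_inter_support]
    exact MeasureTheory.measure_mono fun p hp => ⟨p, hp.2, hp.1, rfl⟩
  · rintro d ⟨p, hp, hpg, rfl⟩ hd
    obtain ⟨hp1, hp2⟩ := h.eig_support K hK p hp
    have hreach' := hreach.step hd
    by_cases hcurv : (inner ℝ (hess P.cost K p.1) p.1 : ℝ) ≤ -q.α / 2
    · have e1 : g p = (.ncd (K - (2 * |(inner ℝ (hess P.cost K p.1) p.1 : ℝ)| / q.L₂ *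
        (if 0 ≤ (inner ℝ p.1 (gradient P.cost K) : ℝ) then 1 else -1)) • p.1), p.2 + 5) := if_pos hcurv
      rw [e1] at hreach' ⊢
      refine ⟨by push_cast; linarith, hmove _ hreach' (h.cost_move_le hK hp1 hcurv)⟩
    · have e1 : g p = (.outer K, p.2 + 2) := if_neg hcurv
      rw [e1] at hreach' ⊢
      refine ⟨by push_cast; linarith, hreturn hreach' (neg_mul_norm_sq_le_of_unit fun w hw => ?_)⟩
      have := hpg w hw
      push Not at hcurv
      linarith

end IsExecution

end LQR

/-! ### The potential argument -/

namespace LQR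

variable {n m r : ℕ} {P : LQR n m r} {q : Params} {eig : EigRoutine} {K₀ K₁ : Gain m r} {S : ℕ} {e : ℝ}

/-- The distance of the value `x` to the lower bound `f(K₁) - Δ` of the cost, in units of `ε² / α`. -/
noncomputable def level (P : LQR n m r) (q : Params) (K₁ : Gain m r) (x : ℝ) : ℝ :=
  (x - (P.cost K₁ - q.Δ)) * (q.α / q.ε ^ 2)

/-- The minimum over `d` of `(11 / 48) ε (ε / α - d) + 3 α d²` exceeds `ε² / (24 α)`. -/
theorem far_decrease {ε α s d : ℝ} (hε : 0 < ε) (hα : 0 < α) (h : ε / α ≤ s + d) :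
    1 / 24 * (ε ^ 2 / α) ≤ 11 / 48 * ε * s + 3 * α * d ^ 2 := by
  set ρ := ε / α with hρ
  have hρ0 : 0 < ρ := by positivity
  have e1 : ε = α * ρ := by rw [hρ]; field_simp
  have e2 : ε ^ 2 / α = α * ρ ^ 2 := by rw [e1]; field_simp
  rw [e2, e1]
  have h1 : ρ * ρ ≤ ρ * (s + d) := mul_le_mul_of_nonneg_left h hρ0.le
  have h2 : 1 / 24 * ρ ^ 2 ≤ 11 / 48 * ρ * s + 3 * d ^ 2 := by
    nlinarith [sq_nonneg (d - 11 / 288 * ρ), sq_nonneg ρ]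
  nlinarith [mul_le_mul_of_nonneg_left h2 hα.le]

theorem prox_decrease {ε α d : ℝ} (hε : 0 < ε) (hα : 0 < α) (h : 11 / 144 * (ε / α) ≤ d) :
    11 / 48 * ε * d ≤ 3 * α * d ^ 2 ∧ 1 / 58 * (ε ^ 2 / α) ≤ 3 * α * d ^ 2 := by
  have h0 : 0 < ε / α := by positivity
  have hd : 0 ≤ d := by linarith
  have h1 : 11 / 48 * ε ≤ 3 * α * d := by
    have h2 := h
    rw [← mul_div_assoc, div_le_iff₀ hα] at h2
    linarith
  have h2 : 11 / 48 * ε * d ≤ 3 * α * d ^ 2 := by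
    have := mul_le_mul_of_nonneg_right h1 hd
    linarith
  refine ⟨h2, le_trans ?_ h2⟩
  have h3 := mul_le_mul_of_nonneg_left h (by positivity : 0 ≤ 11 / 48 * ε)
  have h4 : 11 / 48 * ε * (11 / 144 * (ε / α)) = 121 / 6912 * (ε ^ 2 / α) := by ring
  have h5 : 0 < ε ^ 2 / α := by positivity
  linarith

namespace IsExecution

theorem level_le (h : IsExecution P q eig K₀ K₁ S e) {x y t : ℝ} (hxy : x ≤ y - t * (q.ε ^ 2 / q.α)) :
    P.level q K₁ x ≤ P.level q K₁ y - t := by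
  have h1 := h.α_pos
  have h2 := h.ε_pos
  have h3 : 0 < q.α / q.ε ^ 2 := by positivity
  have h4 : t * (q.ε ^ 2 / q.α) * (q.α / q.ε ^ 2) = t := by field_simp
  unfold level
  nlinarith [mul_le_mul_of_nonneg_right hxy h3.le]

theorem level_mono (h : IsExecution P q eig K₀ K₁ S e) {x y : ℝ} (hxy : x ≤ y) :
    P.level q K₁ x ≤ P.level q K₁ y := by
  have := h.level_le (x := x) (y := y) (t := 0) (by linarith)
  linarith

theorem level_nonneg (h : IsExecution P q eig K₀ K₁ S e) {K : Gain m r} (hK : K ∈ P.stab) :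
    0 ≤ P.level q K₁ (P.cost K) := by
  have h1 := h.α_pos
  have h2 := h.ε_pos
  have h3 := h.gap K hK
  exact mul_nonneg (by linarith) (by positivity)

theorem εnag_le (h : IsExecution P q eig K₀ K₁ S e) : q.εnag ≤ q.ε / 24 := by
  have h1 := h.α_pos
  have h2 := h.ε_pos
  have h3 := h.α_le
  have h4 := h.L₁_pos
  have h5 : √(3 * q.α / (50 * (3 * q.L₁ + 2 * (3 * q.α)))) ≤ 1 / 12 := by
    rw [Real.sqrt_le_left (by norm_num), div_le_iff₀ (by positivity)]
    linarith
  unfold Params.εnag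
  nlinarith

/-- Near `Khat` the penalty does not contribute to the gradient. -/
theorem gradient_costPen_of_near (h : IsExecution P q eig K₀ K₁ S e) {Khat K : Gain m r}
    (hK : K ∈ P.stab) (hnear : ‖K - Khat‖ ≤ q.α / q.L₂) :
    gradient (P.costPen q Khat) K = gradient P.cost K := by
  have hr0 : 0 ≤ q.α / q.L₂ := (norm_nonneg _).trans hnear
  have h1 : gradient (P.costPen q Khat) K =
      gradient P.cost K + (2 * q.L₁) • ballGap (q.α / q.L₂) (K - Khat) :=
    (hasGradientAt_penalized (h.barrier.differentiableAt hK) q.L₁ hr0 Khat).gradient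
  rw [h1, ballGap_of_le hnear, smul_zero, add_zero]

/-- If the gradient of `f_k` is not small at the output of NAG, then NAG has moved. -/
theorem le_norm_sub_of_le_gradient (h : IsExecution P q eig K₀ K₁ S e) {Khat K K' : Gain m r}
    (hK' : K' ∈ P.stab) (hG : ‖gradient (P.costReg q Khat K) K'‖ < q.εnag)
    (hF : q.ε / 2 ≤ ‖gradient (P.costPen q Khat) K'‖) : 11 / 144 * (q.ε / q.α) ≤ ‖K' - K‖ := by
  have hα := h.α_pos
  have hr0 : 0 ≤ q.α / q.L₂ := div_nonneg hα.le h.L₂_pos.le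
  have h1 : gradient (P.costReg q Khat K) K' =
      gradient (P.costPen q Khat) K' + (2 * (3 * q.α)) • (K' - K) :=
    (hasGradientAt_proximal (differentiableAt_penalized h.barrier q.L₁ hr0 Khat hK') (3 * q.α) K).gradient
  have h2 : ‖gradient (P.costPen q Khat) K'‖ ≤ q.εnag + 6 * q.α * ‖K' - K‖ := by
    have h3 : gradient (P.costPen q Khat) K' =
        gradient (P.costReg q Khat K) K' - (2 * (3 * q.α)) • (K' - K) := by
      rw [h1, add_sub_cancel_right]
    rw [h3]
    refine (norm_sub_le _ _).trans (add_le_add hG.le ?_)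
    rw [norm_smul, Real.norm_eq_abs, abs_of_pos (by positivity)]
    exact le_of_eq (by ring)
  have h4 := h.εnag_le
  rw [← mul_div_assoc, div_le_iff₀ hα]
  linarith

set_option maxHeartbeats 1000000 in
/-- The loop of Semiconvex-NAG, as long as the gradient of `f_k` is not small.  The quantity
`f_k(K) + (11 / 48) ε ‖K - Khat‖` does not increase: either the loop goes on after a step of length
`d ≥ 11 ε / (144 α)`, and then `f_k` has dropped by `3 α d² ≥ (11 / 48) ε d`; or it ends far from
`Khat`, and then the cost is lower than at `Khat` by at least `ε² / (24 α)`; or it ends near `Khat`,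
where the gradients of `f` and of `f_k` coincide, so that the former is small. -/
theorem semi_succeeds (h : IsExecution P q eig K₀ K₁ S e) {I : ℕ}
    (hI : 2 * (3 * q.L₁ + 2 * (3 * q.α)) ^ 2 / (3 * q.α) *
      ((1 - 1 / √((3 * q.L₁ + 2 * (3 * q.α)) / (3 * q.α))) ^ I * (2 * q.Δ)) < q.εnag ^ 2)
    {Khat : Gain m r} {Y : Set (Gain m r)} (hKhat : Khat ∈ P.stab)
    (hhess : ∀ w, -q.α * ‖w‖ ^ 2 ≤ inner ℝ (hess P.cost Khat w) w)
    (hle : P.cost Khat ≤ P.cost K₁) {T₀ T₁ A B W : ℝ} (hW : W = 8 + 14 * ((S + 1) * (I + 1)))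
    (hT₀ : 0 ≤ T₀) (hT₁ : 0 ≤ T₁) (hA : 116 * W ≤ A) (hB₁ : W + 5 + T₁ ≤ B)
    (hB₀ : W + 5 + T₀ ≤ B + A / 48)
    (hfar : ∀ K, P.Reachable q eig K₁ (.ncd K) →
      P.cost K ≤ P.cost Khat - 1 / 24 * (q.ε ^ 2 / q.α) →
      P.Succeeds q eig Y (.ncd K) (2 + 24 * P.level q K₁ (P.cost K))
        (T₀ + A * P.level q K₁ (P.cost K)))
    (hnear : ∀ K, P.Reachable q eig K₁ (.ncd K) → P.cost K ≤ P.cost Khat →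
      ‖gradient P.cost K‖ < q.ε →
      P.Succeeds q eig Y (.ncd K) (1 + 24 * P.level q K₁ (P.cost K))
        (T₁ + A * P.level q K₁ (P.cost K)))
    (k : ℕ) (K : Gain m r) (hreach : P.Reachable q eig K₁ (.semi Khat K)) (hK : K ∈ P.stab)
    (hinv : P.costPen q Khat K + 11 / 48 * q.ε * ‖K - Khat‖ ≤ P.cost Khat)
    (hgrad : q.ε / 2 ≤ ‖gradient (P.costPen q Khat) K‖)
    (hk : P.level q K₁ (P.costPen q Khat K) < k / 58) :
    P.Succeeds q eig Y (.semi Khat K) (1 + 24 * P.level q K₁ (P.cost Khat))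
      (B + A / 2 * P.level q K₁ (P.costPen q Khat K) + A / 2 * P.level q K₁ (P.cost Khat)) := by
  have hα := h.α_pos
  have hε := h.ε_pos
  have hL₂ := h.L₂_pos
  have hr : q.α / q.L₂ = q.ε / q.α := by
    rw [div_eq_div_iff hL₂.ne' hα.ne', ← sq, h.α_sq, mul_comm]
  have hr0 : 0 ≤ q.α / q.L₂ := by positivity
  have hF : ∀ x, P.cost x ≤ P.costPen q Khat x := fun x => le_penalized P.cost h.L₁_pos.le _ Khat x
  have hlev := h.level_nonneg hKhat
  have hWpos : 0 < W := by rw [hW]; positivity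
  have hApos : 0 < A := by linarith
  have hBpos : 0 < B := by linarith
  induction k generalizing K with
  | zero =>
    have h1 := h.level_nonneg hK
    have h2 := h.level_mono (hF K)
    simp at hk
    linarith
  | succ k ih =>
    have hlevF : 0 ≤ P.level q K₁ (P.costPen q Khat K) := (h.level_nonneg hK).trans (h.level_mono (hF K))
    have hstep : P.step q eig (.semi Khat K) = PMF.pure (.nag Khat K ⟨K, K, 0⟩, 8) := by
      simp only [LQR.step]
      rw [if_neg (not_lt.2 hgrad)]
    set τ := B + A / 2 * P.level q K₁ (P.costPen q Khat K) + A / 2 * P.level q K₁ (P.cost Khat) - W with hτ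
    have hτ0 : 0 ≤ τ := by
      have : 0 ≤ A / 2 * P.level q K₁ (P.costPen q Khat K) := by positivity
      have : 0 ≤ A / 2 * P.level q K₁ (P.cost Khat) := by positivity
      linarith
    have hs0 := norm_nonneg (K - Khat)
    have hnag := h.nag_succeeds hI (Khat := Khat) (Kc := K) (Y := Y)
      (calls := 1 + 24 * P.level q K₁ (P.cost Khat)) (τ := τ) (by positivity) hτ0 hK
      (by
        have : 0 ≤ 11 / 48 * q.ε * ‖K - Khat‖ := by positivity
        linarith) hhess (hreach.step_pure hstep) ?_
    · have := Succeeds.of_step_pure (t := 8) h.δeig_nonneg (by positivity) (by positivity) (by norm_num)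
        hstep (by norm_num) hnag
      convert this using 1
      rw [hτ, hW]; ring
    intro K' hK' hreach' hG hG'
    set d := ‖K' - K‖ with hd
    have hd0 : 0 ≤ d := norm_nonneg _
    set s := ‖K - Khat‖ with hs
    set s' := ‖K' - Khat‖ with hs'
    have htri : s' ≤ s + d := by
      have := norm_add_le (K' - K) (K - Khat)
      rw [sub_add_sub_cancel] at this
      linarith
    have hdrop : P.costPen q Khat K' + 3 * q.α * d ^ 2 ≤ P.costPen q Khat K := by
      have h1 : P.costReg q Khat K K = P.costPen q Khat K := proximal_self (P.costPen q Khat) _ _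
      rw [h1] at hG
      exact hG
    have hlevF' : 0 ≤ P.level q K₁ (P.costPen q Khat K') :=
      (h.level_nonneg hK').trans (h.level_mono (hF K'))
    have hcost' := h.level_mono (hF K')
    have hcostK' := h.level_nonneg hK'
    have hsq : 0 ≤ 3 * q.α * d ^ 2 := by positivity
    by_cases hterm : ‖gradient (P.costPen q Khat) K'‖ < q.ε / 2
    · have hstep' : P.step q eig (.semi Khat K') = PMF.pure (.ncd K', 5) := by
        simp only [LQR.step]
        rw [if_pos hterm]
      have hreach₂ := hreach'.step_pure hstep'
      by_cases hfar' : s' ≤ q.α / q.L₂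
      · have hgradeq := h.gradient_costPen_of_near hK' hfar'
        have hle' : P.cost K' ≤ P.cost Khat := by
          have := hF K'
          have : 0 ≤ 11 / 48 * q.ε * s := by positivity
          linarith
        have h1 := hnear K' hreach₂ hle' (by rw [← hgradeq]; linarith)
        have h2 := Succeeds.of_step_pure (t := 5) h.δeig_nonneg (by positivity) (by positivity)
          (by norm_num) hstep' (by norm_num) h1
        have h3 := h.level_mono hle'
        have h4 := h.level_mono (show P.cost K' ≤ P.costPen q Khat K by linarith [hF K'])
        refine h2.mono h.δeig_nonneg (by linarith) ?_
        have h5 := mul_le_mul_of_nonneg_left h3 (by positivity : 0 ≤ A / 2)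
        have h6 := mul_le_mul_of_nonneg_left h4 (by positivity : 0 ≤ A / 2)
        linarith
      · push Not at hfar'
        rw [hr] at hfar'
        have hle' : P.cost K' ≤ P.cost Khat - 1 / 24 * (q.ε ^ 2 / q.α) := by
          have h1 := hF K'
          have h2 := far_decrease hε hα (hfar'.le.trans htri)
          linarith
        have h1 := hfar K' hreach₂ hle'
        have h2 := Succeeds.of_step_pure (t := 5) h.δeig_nonneg (by positivity) (by positivity)
          (by norm_num) hstep' (by norm_num) h1
        have h3 := h.level_le hle'
        have h4 := h.level_mono (show P.cost K' ≤ P.costPen q Khat K by linarith [hF K'])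
        refine h2.mono h.δeig_nonneg (by linarith) ?_
        have h5 := mul_le_mul_of_nonneg_left h3 (by positivity : 0 ≤ A / 2)
        have h6 := mul_le_mul_of_nonneg_left h4 (by positivity : 0 ≤ A / 2)
        linarith
    · push Not at hterm
      have hdlow : 11 / 144 * (q.ε / q.α) ≤ d := h.le_norm_sub_of_le_gradient hK' hG' hterm
      obtain ⟨hquad, hUd⟩ := prox_decrease hε hα hdlow
      have hlev' := h.level_le (x := P.costPen q Khat K') (y := P.costPen q Khat K) (t := 1 / 58)
        (by linarith)
      have h1 := ih K' hreach' hK'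
        (by
          have : 11 / 48 * q.ε * s' ≤ 11 / 48 * q.ε * (s + d) :=
            mul_le_mul_of_nonneg_left htri (by positivity)
          rw [← hs']
          linarith) hterm (by push_cast at hk; linarith)
      refine h1.mono h.δeig_nonneg le_rfl ?_
      have h5 := mul_le_mul_of_nonneg_left hlev' (by positivity : 0 ≤ A / 2)
      linarith

/-- The recursion over the value of the cost: the number of eigenvector computations and the number
of operations until A-OLQR returns are affine functions of the level of the cost.  The bounds are better
by one computation if the gradient is already small, because A-OLQR then returns as soon as NCD stops;
this pays for the calls of Semiconvex-NAG that end near `Khat` and need not decrease the cost. -/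
theorem ncd_succeeds_of_level (h : IsExecution P q eig K₀ K₁ S e) {I : ℕ}
    (hI : 2 * (3 * q.L₁ + 2 * (3 * q.α)) ^ 2 / (3 * q.α) *
      ((1 - 1 / √((3 * q.L₁ + 2 * (3 * q.α)) / (3 * q.α))) ^ I * (2 * q.Δ)) < q.εnag ^ 2)
    {Y : Set (Gain m r)}
    (hY : ∀ K ∈ P.stab, ‖gradient P.cost K‖ < q.ε →
      (∀ w, -q.α * ‖w‖ ^ 2 ≤ inner ℝ (hess P.cost K w) w) → K ∈ Y)
    {W : ℝ} (hW : W = 8 + 14 * ((S + 1) * (I + 1))) (he : 0 ≤ e) (k : ℕ) (K : Gain m r)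
    (hreach : P.Reachable q eig K₁ (.ncd K)) (hle : P.cost K ≤ P.cost K₁)
    (hk : P.level q K₁ (P.cost K) < k / 58) :
    P.Succeeds q eig Y (.ncd K) (2 + 24 * P.level q K₁ (P.cost K))
        (2 * e + W + 11 + 116 * (W + e + 7) * P.level q K₁ (P.cost K)) ∧
      (‖gradient P.cost K‖ < q.ε →
        P.Succeeds q eig Y (.ncd K) (1 + 24 * P.level q K₁ (P.cost K))
          (e + 4 + 116 * (W + e + 7) * P.level q K₁ (P.cost K))) := by
  have hα := h.α_pos
  have hε := h.ε_pos
  have hWpos : 0 < W := by rw [hW]; positivity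
  have hUpos : 0 < q.ε ^ 2 / q.α := by positivity
  set A := 116 * (W + e + 7) with hA
  have hApos : 0 < A := by positivity
  have hstab : ∀ K, P.Reachable q eig K₁ (.ncd K) → K ∈ P.stab := fun K hK =>
    P.subComp_subset K₀ K₁ (h.confined.1 K hK)
  induction k generalizing K with
  | zero =>
    have := h.level_nonneg (hstab K hreach)
    simp at hk
    linarith
  | succ k ih =>
    push_cast at hk
    have hflag : ∀ K, P.Reachable q eig K₁ (.ncd K) → P.cost K ≤ P.cost K₁ →
        P.level q K₁ (P.cost K) < (k + 1) / 58 → ‖gradient P.cost K‖ < q.ε →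
        P.Succeeds q eig Y (.ncd K) (1 + 24 * P.level q K₁ (P.cost K))
          (e + 4 + A * P.level q K₁ (P.cost K)) := by
      intro K hreach hle hk hgrad
      have hlev := h.level_nonneg (hstab K hreach)
      have h1 := h.ncd_succeeds (Y := Y) (calls := 24 * P.level q K₁ (P.cost K))
        (τ := 4 + A * P.level q K₁ (P.cost K)) (by positivity) (by positivity) hreach ?_ ?_
      · rwa [← add_assoc] at h1
      · intro K' hreach' hdrop
        have hlev' := h.level_le hdrop
        refine (ih K' hreach' (by linarith) (by linarith)).1.mono h.δeig_nonneg (by linarith) ?_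
        have := mul_le_mul_of_nonneg_left hlev' hApos.le
        linarith
      · intro hreach' hhess
        have hstep : P.step q eig (.outer K) = PMF.pure (.done K, 2) := by
          simp only [LQR.step]
          rw [if_pos hgrad]
        have h2 := Succeeds.of_step_pure (t := 2) h.δeig_nonneg le_rfl le_rfl (by norm_num) hstep
          (by norm_num) (succeeds_done (hY K (hstab K hreach) hgrad hhess))
        refine h2.mono h.δeig_nonneg (by positivity) ?_
        have : 0 ≤ A * P.level q K₁ (P.cost K) := by positivity
        linarith
    refine ⟨?_, hflag K hreach hle hk⟩
    have hK := hstab K hreach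
    have hlev := h.level_nonneg hK
    have h1 := h.ncd_succeeds (Y := Y) (calls := 1 + 24 * P.level q K₁ (P.cost K))
      (τ := e + W + 11 + A * P.level q K₁ (P.cost K)) (by positivity) (by positivity) hreach ?_ ?_
    · refine h1.mono h.δeig_nonneg (by linarith) (by linarith)
    · intro K' hreach' hdrop
      have hlev' := h.level_le hdrop
      refine (ih K' hreach' (by linarith) (by linarith)).1.mono h.δeig_nonneg (by linarith) ?_
      have := mul_le_mul_of_nonneg_left hlev' hApos.le
      linarith
    · intro hreach' hhess
      by_cases hgrad : ‖gradient P.cost K‖ < q.ε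
      · have hstep : P.step q eig (.outer K) = PMF.pure (.done K, 2) := by
          simp only [LQR.step]
          rw [if_pos hgrad]
        have h2 := Succeeds.of_step_pure (t := 2) h.δeig_nonneg le_rfl le_rfl (by norm_num) hstep
          (by norm_num) (succeeds_done (hY K hK hgrad hhess))
        refine h2.mono h.δeig_nonneg (by positivity) ?_
        have : 0 ≤ A * P.level q K₁ (P.cost K) := by positivity
        linarith
      · have hstep : P.step q eig (.outer K) = PMF.pure (.semi K K, 2) := by
          simp only [LQR.step]
          rw [if_neg hgrad]
        have hr0 : 0 ≤ q.α / q.L₂ := by have := h.L₂_pos; positivity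
        have hFK : P.costPen q K K = P.cost K := penalized_self P.cost q.L₁ hr0 K
        have hgradF : gradient (P.costPen q K) K = gradient P.cost K :=
          h.gradient_costPen_of_near hK (by rw [sub_self, norm_zero]; exact hr0)
        have h2 := h.semi_succeeds hI (Khat := K) (Y := Y) hK hhess hle (T₀ := 2 * e + W + 11)
          (T₁ := e + 4) (A := A) (B := W + 9 + e) hW (by positivity) (by positivity)
          (by linarith) (by linarith) (by linarith)
          (fun K' hreach' hdrop => by
            have hlev' := h.level_le hdrop
            exact (ih K' hreach' (by linarith) (by linarith)).1)
          (fun K' hreach' hdrop hg => by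
            have hlev' := h.level_mono hdrop
            exact hflag K' hreach' (hdrop.trans hle) (by linarith) hg)
          (k + 1) K (hreach'.step_pure hstep) hK
          (by rw [hFK, sub_self, norm_zero, mul_zero, add_zero])
          (by rw [hgradF]; push Not at hgrad; linarith) (by rw [hFK]; push_cast; exact hk)
        rw [hFK] at h2
        have h3 := Succeeds.of_step_pure (t := 2) h.δeig_nonneg (by positivity) (by positivity)
          (by norm_num) hstep (by norm_num) h2
        refine h3.mono h.δeig_nonneg le_rfl (by linarith)

end IsExecution

end LQR

/-! ### Parameters and complexity -/

namespace Params

/-- The relations between the inputs of A-OLQR under which it is analysed. -/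
structure IsAdmissible (q : Params) : Prop where
  ε_pos : 0 < q.ε
  L₁_pos : 0 < q.L₁
  L₂_pos : 0 < q.L₂
  α_pos : 0 < q.α
  Δ_pos : 0 < q.Δ
  δ_pos : 0 < q.δ
  δ_lt_one : q.δ < 1
  α_sq : q.α ^ 2 = q.L₂ * q.ε
  α_le : q.α ≤ q.L₁
  ε_sq_le : q.ε ^ 2 ≤ q.Δ * q.α

/-- The admissible decrease `Δ` of the cost in units of `ε² / α`. -/
noncomputable def budget (q : Params) : ℝ := q.Δ * q.α / q.ε ^ 2

namespace IsAdmissible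

variable {q : Params}

theorem one_le_budget (h : q.IsAdmissible) : 1 ≤ q.budget := by
  have := h.ε_pos
  rw [budget, one_le_div (by positivity)]
  exact h.ε_sq_le

theorem eig_calls_eq_budget (h : q.IsAdmissible) : q.L₂ ^ 2 * q.Δ / q.α ^ 3 = q.budget := by
  have h1 := h.ε_pos
  have h2 := h.α_pos
  have h3 := h.L₂_pos
  rw [budget, div_eq_div_iff (by positivity) (by positivity)]
  have : q.α ^ 3 * q.α = (q.L₂ * q.ε) ^ 2 := by rw [← h.α_sq]; ring
  calc q.L₂ ^ 2 * q.Δ * q.ε ^ 2 = q.Δ * (q.L₂ * q.ε) ^ 2 := by ring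
    _ = q.Δ * q.α * q.α ^ 3 := by rw [← this]; ring

theorem moves_eq_budget (h : q.IsAdmissible) : q.Δ * (q.L₂ / (q.α * q.ε)) = q.budget := by
  have h1 := h.ε_pos
  have h2 := h.α_pos
  rw [budget, ← mul_div_assoc, div_eq_div_iff (by positivity) (by positivity)]
  calc q.Δ * q.L₂ * q.ε ^ 2 = q.Δ * q.ε * (q.L₂ * q.ε) := by ring
    _ = q.Δ * q.α * (q.α * q.ε) := by rw [← h.α_sq]; ring

theorem Xi_arg (h : q.IsAdmissible) :
    1 + q.Δ * (12 * q.L₂ ^ 2 / q.α ^ 3 + √10 * q.L₂ / (q.α * q.ε)) = 1 + (12 + √10) * q.budget := by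
  have h1 : q.Δ * (12 * q.L₂ ^ 2 / q.α ^ 3 + √10 * q.L₂ / (q.α * q.ε)) =
      12 * (q.L₂ ^ 2 * q.Δ / q.α ^ 3) + √10 * (q.Δ * (q.L₂ / (q.α * q.ε))) := by ring
  rw [h1, h.eig_calls_eq_budget, h.moves_eq_budget]
  ring

theorem le_Xi (h : q.IsAdmissible) : 1 + 15 * q.budget ≤ q.Xi := by
  have h1 : (3 : ℝ) ≤ √10 := Real.le_sqrt_of_sq_le (by norm_num)
  have h2 := h.one_le_budget
  refine le_trans ?_ (Nat.le_ceil _)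
  rw [h.Xi_arg]
  nlinarith

theorem Xi_le (h : q.IsAdmissible) : (q.Xi : ℝ) ≤ 18 * q.budget := by
  have h1 : √10 ≤ (4 : ℝ) := Real.sqrt_le_iff.2 (by norm_num)
  have h2 := h.one_le_budget
  have h3 : 0 ≤ 1 + (12 + √10) * q.budget := by positivity
  have h4 := (Nat.ceil_lt_add_one h3).le
  rw [Xi, h.Xi_arg]
  nlinarith

theorem δeig_eq (h : q.IsAdmissible) : q.δeig = q.δ / (q.Xi * (1 + q.budget)) := by
  rw [δeig, δcall, h.eig_calls_eq_budget, div_div]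

theorem δeig_pos (h : q.IsAdmissible) : 0 < q.δeig := by
  have h1 := h.le_Xi
  have h2 := h.one_le_budget
  have h3 := h.δ_pos
  have h4 : (0 : ℝ) < q.Xi := by linarith
  rw [h.δeig_eq]
  positivity

/-- The failure probabilities of the eigenvector computations of a whole execution sum up to `δ`. -/
theorem calls_mul_δeig_le (h : q.IsAdmissible) : (2 + 24 * q.budget) * q.δeig ≤ q.δ := by
  have h1 := h.le_Xi
  have h2 := h.one_le_budget
  have h3 := h.δ_pos
  have h4 : (0 : ℝ) < q.Xi := by linarith
  rw [h.δeig_eq, ← mul_div_assoc, div_le_iff₀ (by positivity), mul_comm]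
  refine mul_le_mul_of_nonneg_left ?_ h3.le
  nlinarith

theorem δeig_lt_one (h : q.IsAdmissible) : q.δeig < 1 := by
  have h1 := h.calls_mul_δeig_le
  have h2 := h.one_le_budget
  have h3 := h.δ_lt_one
  have h4 := h.δeig_pos
  nlinarith

theorem one_div_δeig_le (h : q.IsAdmissible) : 1 / q.δeig ≤ 36 * q.budget ^ 2 / q.δ := by
  have h1 := h.le_Xi
  have h2 := h.one_le_budget
  have h3 := h.δ_pos
  have h4 := h.Xi_le
  rw [h.δeig_eq, one_div_div]
  refine div_le_div_of_nonneg_right ?_ h3.le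
  calc (q.Xi : ℝ) * (1 + q.budget) ≤ 18 * q.budget * (q.budget + q.budget) := by gcongr
    _ = 36 * q.budget ^ 2 := by ring

theorem sqrt_ratio (h : q.IsAdmissible) : (√(q.L₁ * q.Δ) / q.ε) ^ 2 = q.L₁ * q.Δ / q.ε ^ 2 := by
  have h1 := h.L₁_pos
  have h2 := h.Δ_pos
  rw [div_pow, Real.sq_sqrt (by positivity)]

theorem budget_le (h : q.IsAdmissible) : q.budget ≤ (√(q.L₁ * q.Δ) / q.ε) ^ 2 := by
  have h1 := h.ε_pos
  have h2 := h.Δ_pos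
  have h3 := h.α_le
  rw [h.sqrt_ratio, budget, mul_comm q.L₁]
  gcongr

theorem one_le_sqrt_ratio (h : q.IsAdmissible) : 1 ≤ √(q.L₁ * q.Δ) / q.ε := by
  have h1 := h.ε_pos
  by_contra hlt
  push Not at hlt
  have h2 := h.budget_le
  have h3 := h.one_le_budget
  have h4 : 0 ≤ √(q.L₁ * q.Δ) / q.ε := by positivity
  nlinarith

theorem one_le_scale (h : q.IsAdmissible) {d : ℝ} (hd : 1 ≤ d) : 1 ≤ d * √(q.L₁ * q.Δ) / (q.δ * q.ε) := by
  have h1 := h.one_le_sqrt_ratio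
  have h2 := h.δ_pos
  have h3 := h.ε_pos
  have h4 : 1 ≤ d / q.δ := by
    rw [one_le_div h2]; linarith [h.δ_lt_one]
  have e1 : d * √(q.L₁ * q.Δ) / (q.δ * q.ε) = d / q.δ * (√(q.L₁ * q.Δ) / q.ε) := by
    field_simp
  rw [e1]
  nlinarith

theorem log_div_δeig_le (h : q.IsAdmissible) {d : ℝ} (hd : 1 ≤ d) :
    Real.log (d / q.δeig) ≤
      Real.log 36 + 4 * Real.log (d * √(q.L₁ * q.Δ) / (q.δ * q.ε)) := by
  have h1 := h.one_le_sqrt_ratio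
  have h2 := h.δ_pos
  have h3 := h.ε_pos
  have h4 : 1 ≤ d / q.δ := by
    rw [one_le_div h2]; linarith [h.δ_lt_one]
  have h5 := h.one_le_scale hd
  have h6 := h.δeig_pos
  have h7 := h.one_le_budget
  set y := √(q.L₁ * q.Δ) / q.ε with hy
  have e1 : d * √(q.L₁ * q.Δ) / (q.δ * q.ε) = d / q.δ * y := by
    rw [hy]; field_simp
  rw [e1] at h5 ⊢
  have h8 : d / q.δeig ≤ 36 * (d / q.δ * y) ^ 4 := by
    calc d / q.δeig = d * (1 / q.δeig) := by ring
      _ ≤ d * (36 * q.budget ^ 2 / q.δ) := 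
        mul_le_mul_of_nonneg_left h.one_div_δeig_le (by linarith)
      _ ≤ d * (36 * (y ^ 2) ^ 2 / q.δ) := by gcongr; exact h.budget_le
      _ = 36 * ((d / q.δ) * y ^ 4) := by ring
      _ ≤ 36 * ((d / q.δ) ^ 4 * y ^ 4) := by
        gcongr
        exact le_self_pow₀ h4 (by norm_num)
      _ = 36 * (d / q.δ * y) ^ 4 := by rw [mul_pow]
  calc Real.log (d / q.δeig) ≤ Real.log (36 * (d / q.δ * y) ^ 4) := by
        apply Real.log_le_log (by positivity) h8
    _ = _ := by
        rw [Real.log_mul (by norm_num) (by positivity), Real.log_pow]; norm_num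

/-- The number of steps, without a restart, after which NAG has reached its accuracy. -/
theorem nag_steps (h : q.IsAdmissible) {d : ℝ} (hd : 1 ≤ d) {I : ℕ}
    (hI : 2 * √(q.L₁ / q.α) *
      (Real.log 64800 + 6 * Real.log (d * √(q.L₁ * q.Δ) / (q.δ * q.ε))) < I) :
    2 * (3 * q.L₁ + 2 * (3 * q.α)) ^ 2 / (3 * q.α) *
      ((1 - 1 / √((3 * q.L₁ + 2 * (3 * q.α)) / (3 * q.α))) ^ I * (2 * q.Δ)) < q.εnag ^ 2 := by
  have hε := h.ε_pos
  have hα := h.α_pos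
  have hL₁ := h.L₁_pos
  have hΔ := h.Δ_pos
  have hαL := h.α_le
  have hscale := h.one_le_scale hd
  have hδ := h.δ_pos
  set Y := d * √(q.L₁ * q.Δ) / (q.δ * q.ε) with hY
  set L := 3 * q.L₁ + 2 * (3 * q.α) with hL
  set σ := 3 * q.α with hσ
  have hσ0 : 0 < σ := by positivity
  have hL0 : 0 < L := by positivity
  have hL9 : L ≤ 9 * q.L₁ := by rw [hL]; linarith
  set k := √(L / σ) with hk
  have hk1 : 1 ≤ k := by
    rw [hk, Real.one_le_sqrt, one_le_div hσ0]
    linarith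
  have hk2 : k ≤ 2 * √(q.L₁ / q.α) := by
    have e1 : 2 * √(q.L₁ / q.α) = √(4 * (q.L₁ / q.α)) := by
      rw [Real.sqrt_mul (by norm_num)]
      congr 1
      rw [show (4 : ℝ) = 2 ^ 2 by norm_num, Real.sqrt_sq (by norm_num)]
    rw [e1]
    apply Real.sqrt_le_sqrt
    rw [← mul_div_assoc, div_le_div_iff₀ hσ0 hα]
    nlinarith
  set M := 800 * L ^ 3 * q.Δ / (σ ^ 2 * q.ε ^ 2) with hM
  have hM0 : 0 < M := by positivity
  have hMY : M ≤ 64800 * Y ^ 6 := by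
    have h1 : √(q.L₁ * q.Δ) / q.ε ≤ Y := by
      have h4 : 1 ≤ d / q.δ := by
        rw [one_le_div hδ]; linarith [h.δ_lt_one]
      have e1 : Y = d / q.δ * (√(q.L₁ * q.Δ) / q.ε) := by rw [hY]; field_simp
      rw [e1]
      exact le_mul_of_one_le_left (by positivity) h4
    have h2 : q.L₁ * q.Δ / q.ε ^ 2 ≤ Y ^ 2 := by
      rw [← h.sqrt_ratio]; gcongr
    have h3 : q.L₁ / q.α ≤ q.L₁ * q.Δ / q.ε ^ 2 := by
      rw [div_le_div_iff₀ hα (by positivity), mul_assoc]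
      exact mul_le_mul_of_nonneg_left h.ε_sq_le hL₁.le
    calc M ≤ 800 * (9 * q.L₁) ^ 3 * q.Δ / (σ ^ 2 * q.ε ^ 2) := by rw [hM]; gcongr
      _ = 64800 * ((q.L₁ / q.α) * (q.L₁ / q.α) * (q.L₁ * q.Δ / q.ε ^ 2)) := by
        rw [hσ]; field_simp; norm_num
      _ ≤ 64800 * (Y ^ 2 * Y ^ 2 * Y ^ 2) := by
        have := h3.trans h2
        gcongr
      _ = 64800 * Y ^ 6 := by ring
  have hlogM : Real.log M ≤ Real.log 64800 + 6 * Real.log Y := by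
    refine (Real.log_le_log hM0 hMY).trans (le_of_eq ?_)
    rw [Real.log_mul (by norm_num) (by positivity), Real.log_pow]; norm_num
  have hl0 : 0 ≤ Real.log 64800 + 6 * Real.log Y := by
    have := Real.log_nonneg hscale
    have : 0 ≤ Real.log 64800 := Real.log_nonneg (by norm_num)
    positivity
  have hlog : Real.log M < I / k := by
    rw [lt_div_iff₀ (by linarith)]
    calc Real.log M * k ≤ (Real.log 64800 + 6 * Real.log Y) * k := by gcongr
      _ ≤ (Real.log 64800 + 6 * Real.log Y) * (2 * √(q.L₁ / q.α)) := by gcongr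
      _ < I := by rw [mul_comm]; exact hI
  have hpow : (1 - 1 / k) ^ I < M⁻¹ := by
    have h1 : 1 - 1 / k ≤ Real.exp (-(1 / k)) := by
      have := Real.add_one_le_exp (-(1 / k)); linarith
    have h0 : 0 ≤ 1 - 1 / k := by
      have : 1 / k ≤ 1 := by rw [div_le_one (by linarith)]; exact hk1
      linarith
    calc (1 - 1 / k) ^ I ≤ Real.exp (-(1 / k)) ^ I := pow_le_pow_left₀ h0 h1 I
      _ = Real.exp (-(I / k)) := by rw [← Real.exp_nat_mul]; congr 1; ring
      _ < Real.exp (-Real.log M) := Real.exp_lt_exp.2 (by linarith)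
      _ = M⁻¹ := by rw [Real.exp_neg, Real.exp_log hM0]
  have hεnag : q.εnag ^ 2 = q.ε ^ 2 * σ / (200 * L) := by
    have e1 : q.εnag = q.ε / 2 * √(σ / (50 * L)) := rfl
    rw [e1, mul_pow, Real.sq_sqrt (by positivity)]
    field_simp; norm_num
  calc 2 * L ^ 2 / σ * ((1 - 1 / k) ^ I * (2 * q.Δ))
      < 2 * L ^ 2 / σ * (M⁻¹ * (2 * q.Δ)) := by gcongr
    _ = q.εnag ^ 2 := by
      rw [hεnag, hM]; field_simp; norm_num

theorem budget_mul_sqrt (h : q.IsAdmissible) (hα : q.α = q.L₂ ^ (1 / 2 : ℝ) * q.ε ^ (1 / 2 : ℝ)) :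
    q.budget * √(q.L₁ / q.α) =
      q.Δ * q.L₁ ^ (1 / 2 : ℝ) * q.L₂ ^ (1 / 4 : ℝ) / q.ε ^ (7 / 4 : ℝ) := by
  have hε := h.ε_pos
  have hα0 := h.α_pos
  have hL₁ := h.L₁_pos
  have hL₂ := h.L₂_pos
  have h1 : √q.α = q.L₂ ^ (1 / 4 : ℝ) * q.ε ^ (1 / 4 : ℝ) := by
    rw [Real.sqrt_eq_rpow, hα, Real.mul_rpow (by positivity) (by positivity), ← Real.rpow_mul hL₂.le,
      ← Real.rpow_mul hε.le]
    norm_num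
  have h2 : q.ε ^ 2 = q.ε ^ (1 / 4 : ℝ) * q.ε ^ (7 / 4 : ℝ) := by
    rw [← Real.rpow_add hε]; norm_num
  have h3 : q.α = √q.α * √q.α := (Real.mul_self_sqrt hα0.le).symm
  have h4 : 0 < √q.α := Real.sqrt_pos.2 hα0
  have h5 : 0 < q.ε ^ (1 / 4 : ℝ) := by positivity
  have h6 : 0 < q.ε ^ (7 / 4 : ℝ) := by positivity
  rw [budget, Real.sqrt_div hL₁.le, ← Real.sqrt_eq_rpow, h2]
  calc q.Δ * q.α / (q.ε ^ (1 / 4 : ℝ) * q.ε ^ (7 / 4 : ℝ)) * (√q.L₁ / √q.α)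
      = q.Δ * (√q.α * √q.α) / (q.ε ^ (1 / 4 : ℝ) * q.ε ^ (7 / 4 : ℝ)) * (√q.L₁ / √q.α) := by rw [← h3]
    _ = q.Δ * √q.α * √q.L₁ / (q.ε ^ (1 / 4 : ℝ) * q.ε ^ (7 / 4 : ℝ)) := by field_simp
    _ = _ := by rw [h1]; field_simp

end IsAdmissible

theorem isAdmissible {ε L₁ L₂ Δ δ : ℝ} (hε : 0 < ε) (hL₁ : 0 < L₁) (hL₂ : 0 < L₂) (hΔ : 0 ≤ Δ)
    (hδ : 0 < δ) (hδ1 : δ < 1) (h : ε ≤ min (Δ ^ (2 / 3 : ℝ) * L₂ ^ (1 / 3 : ℝ)) (L₁ ^ 2 / L₂)) :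
    IsAdmissible ⟨ε, L₁, L₂, L₂ ^ (1 / 2 : ℝ) * ε ^ (1 / 2 : ℝ), Δ, δ⟩ := by
  have hα0 : 0 < L₂ ^ (1 / 2 : ℝ) * ε ^ (1 / 2 : ℝ) := by positivity
  have hαsq : (L₂ ^ (1 / 2 : ℝ) * ε ^ (1 / 2 : ℝ)) ^ 2 = L₂ * ε := by
    rw [← Real.sqrt_eq_rpow, ← Real.sqrt_eq_rpow, mul_pow, Real.sq_sqrt hL₂.le, Real.sq_sqrt hε.le]
  obtain ⟨h1, h2⟩ := le_min_iff.1 h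
  have hΔ0 : 0 < Δ := by
    refine lt_of_le_of_ne hΔ ?_
    rintro rfl
    rw [Real.zero_rpow (by norm_num), zero_mul] at h1
    linarith
  have h3 : ε ^ 3 ≤ Δ ^ 2 * L₂ := by
    calc ε ^ 3 ≤ (Δ ^ (2 / 3 : ℝ) * L₂ ^ (1 / 3 : ℝ)) ^ 3 := by gcongr
      _ = Δ ^ 2 * L₂ := by
        rw [mul_pow, ← Real.rpow_mul_natCast hΔ, ← Real.rpow_mul_natCast hL₂.le]
        norm_num
  refine ⟨hε, hL₁, hL₂, hα0, hΔ0, hδ, hδ1, hαsq, ?_, ?_⟩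
  · refine (sq_le_sq₀ (by positivity) (by positivity)).1 ?_
    rw [hαsq, mul_comm]
    exact (le_div_iff₀ hL₂).1 h2
  · refine (sq_le_sq₀ (by positivity) (by positivity)).1 ?_
    rw [mul_pow, hαsq]
    nlinarith [mul_le_mul_of_nonneg_left h3 hε.le]

end Params

/-! ### The guarantee of A-OLQR -/

namespace LQR

variable {n m r : ℕ} {P : LQR n m r} {q : Params} {eig : EigRoutine} {K₀ K₁ : Gain m r} {S : ℕ} {e : ℝ}

theorem isBarrierCost_cost (hQ : P.Q.PosDef) (hR : P.R.PosDef) (hS : P.Sig.PosDef) :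
    IsBarrierCost P.stab P.cost :=
  ⟨P.isOpen_stab hQ hR, fun _ hK => P.contDiffAt_cost hQ hR hK, P.isClosed_sublevel hQ hR hS⟩

/-- A bound for the number of operations of one pass through the loop of NCD in dimension `d`.  The
constant of an eigenvector routine may have any sign, hence the absolute value. -/
noncomputable def eigOps (q : Params) (c₀ : ℝ) (d : ℕ) : ℝ :=
  |c₀| * √(q.L₁ / (q.α / 2)) * (1 + Real.log (d / q.δeig)) + 5

theorem isExecution {c₀ : ℝ} (heig : IsApproxSmallestEig c₀ eig) (hm : 0 < m) (hr : 0 < r)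
    (hf : IsBarrierCost P.stab P.cost) (hq : q.IsAdmissible)
    (hsmooth : P.SmoothOn (P.subComp K₀ K₁) q.L₁ q.L₂)
    (hgap : ∀ K ∈ P.stab, P.cost K₁ - P.cost K ≤ q.Δ)
    (hconf : P.Confined q eig (P.subComp K₀ K₁) K₁) (hrest : P.RestartsAtMost q eig K₁ S) :
    IsExecution P q eig K₀ K₁ S (eigOps q c₀ (m * r)) := by
  have hα := hq.α_pos
  have hαL := hq.α_le
  have : Nonempty (Fin m × Fin r) := ⟨⟨⟨0, hm⟩, ⟨0, hr⟩⟩⟩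
  have key := fun K (hK : K ∈ P.subComp K₀ K₁) =>
    heig (Fin m × Fin r) (hess P.cost K) q.L₁ (q.α / 2) q.δeig
      (hf.hess_symm (P.subComp_subset K₀ K₁ hK)) (hsmooth.1 K hK) (by positivity) (by linarith)
      hq.δeig_pos hq.δeig_lt_one
  refine ⟨hf, hq.ε_pos, hq.L₁_pos, hq.L₂_pos, hα, hq.α_sq, hαL, hq.δeig_pos.le, hsmooth,
    hgap, hconf, hrest, fun K hK p hp => ?_, fun K hK => (key K hK).2⟩
  obtain ⟨h1, h2⟩ := (key K hK).1 p hp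
  refine ⟨h1, ?_⟩
  rw [Fintype.card_prod, Fintype.card_fin, Fintype.card_fin] at h2
  rw [eigOps]
  have hd : (1 : ℝ) ≤ ((m * r : ℕ) : ℝ) := by exact_mod_cast Nat.mul_pos hm hr
  have h3 : 0 ≤ Real.log (((m * r : ℕ) : ℝ) / q.δeig) := by
    apply Real.log_nonneg
    rw [one_le_div hq.δeig_pos]
    linarith [hq.δeig_lt_one]
  have h4 : c₀ * √(q.L₁ / (q.α / 2)) * (1 + Real.log (((m * r : ℕ) : ℝ) / q.δeig)) ≤
      |c₀| * √(q.L₁ / (q.α / 2)) * (1 + Real.log (((m * r : ℕ) : ℝ) / q.δeig)) := by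
    gcongr
    exact le_abs_self c₀
  linarith

end LQR

/-- The constant of the running time bound. -/
noncomputable def timeConst (c₀ : ℝ) (S : ℕ) : ℝ :=
  118 * (20 + 14 * ((S + 1) * (2 * (Real.log 64800 + 6) + 2)) + 2 * |c₀| * (5 + Real.log 36))

theorem timeConst_pos (c₀ : ℝ) (S : ℕ) : 0 < timeConst c₀ S := by
  have h1 : 0 ≤ Real.log 64800 := Real.log_nonneg (by norm_num)
  have h2 : 0 ≤ Real.log 36 := Real.log_nonneg (by norm_num)
  unfold timeConst
  positivity

/-- The bound for the operations of a whole execution in terms of `Δ / U` and `√(L₁ / α)`, where `I` steps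
suffice for NAG and `W` bounds the cost of one pass through the loop of Semiconvex-NAG. -/
theorem Params.IsAdmissible.total_time_le {q : Params} (h : q.IsAdmissible) (c₀ : ℝ) (S : ℕ) {d : ℕ}
    (hd : 1 ≤ d) {I : ℕ}
    (hI : (I : ℝ) ≤ 2 * √(q.L₁ / q.α) * (Real.log 64800 +
      6 * Real.log (d * √(q.L₁ * q.Δ) / (q.δ * q.ε))) + 1) {W e : ℝ}
    (hW : W = 8 + 14 * ((S + 1) * (I + 1))) (he : e = LQR.eigOps q c₀ d) :
    2 * e + W + 11 + 116 * (W + e + 7) * q.budget ≤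
      timeConst c₀ S * ((q.budget * √(q.L₁ / q.α)) *
        (1 + Real.log (d * √(q.L₁ * q.Δ) / (q.δ * q.ε)))) := by
  have hd' : (1 : ℝ) ≤ d := by exact_mod_cast hd
  have hα := h.α_pos
  have hL₁ := h.L₁_pos
  have hX := h.one_le_budget
  have hlog := Real.log_nonneg (h.one_le_scale hd')
  have heig := h.log_div_δeig_le hd'
  have hδe : 0 ≤ Real.log (d / q.δeig) := by
    apply Real.log_nonneg
    rw [one_le_div h.δeig_pos]
    linarith [h.δeig_lt_one]
  set ℓ := Real.log (d * √(q.L₁ * q.Δ) / (q.δ * q.ε)) with hℓ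
  set s := √(q.L₁ / q.α) with hs
  set X := q.budget with hXdef
  have hs1 : 1 ≤ s := by
    rw [hs, Real.one_le_sqrt, one_le_div hα]; exact h.α_le
  have hl1 : 0 ≤ Real.log 64800 := Real.log_nonneg (by norm_num)
  have hl2 : 0 ≤ Real.log 36 := Real.log_nonneg (by norm_num)
  set a := Real.log 64800 with ha
  set b := Real.log 36 with hb
  have hsℓ : 1 ≤ s * (1 + ℓ) := by nlinarith
  have hI' : (I : ℝ) + 1 ≤ s * (1 + ℓ) * (2 * (a + 6) + 2) := by
    have h1 : 2 * s * (a + 6 * ℓ) ≤ s * (1 + ℓ) * (2 * (a + 6)) := by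
      have : 0 ≤ s * (6 + a * ℓ) := by positivity
      nlinarith
    nlinarith
  have he0 : 0 ≤ e := by rw [he, LQR.eigOps]; positivity
  have he' : e ≤ s * (1 + ℓ) * (2 * |c₀| * (5 + b) + 5) := by
    have h1 : √(q.L₁ / (q.α / 2)) ≤ 2 * s := by
      have e1 : q.L₁ / (q.α / 2) = 2 * (q.L₁ / q.α) := by field_simp
      have e2 : √(2 : ℝ) ≤ 2 := Real.sqrt_le_iff.2 (by norm_num)
      rw [e1, Real.sqrt_mul (by norm_num), ← hs]
      gcongr
    have h2 : 1 + Real.log (d / q.δeig) ≤ (1 + ℓ) * (5 + b) := by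
      have : 0 ≤ b * ℓ := by positivity
      nlinarith
    have h3 : |c₀| * √(q.L₁ / (q.α / 2)) * (1 + Real.log (d / q.δeig)) ≤
        |c₀| * (2 * s) * ((1 + ℓ) * (5 + b)) := by gcongr
    rw [he, LQR.eigOps]
    linarith
  have hW' : W ≤ s * (1 + ℓ) * (8 + 14 * ((S + 1) * (2 * (a + 6) + 2))) := by
    have h1 : ((S : ℝ) + 1) * (I + 1) ≤ (S + 1) * (s * (1 + ℓ) * (2 * (a + 6) + 2)) := by gcongr
    rw [hW]
    linarith
  have hW0 : 0 ≤ W := by rw [hW]; positivity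
  have hsum : W + e + 7 ≤
      s * (1 + ℓ) * (20 + 14 * ((S + 1) * (2 * (a + 6) + 2)) + 2 * |c₀| * (5 + b)) := by linarith
  have hfirst : 2 * e + W + 11 ≤ 2 * (W + e + 7) * X := by
    have : 2 * (W + e + 7) * 1 ≤ 2 * (W + e + 7) * X := by gcongr
    linarith
  calc 2 * e + W + 11 + 116 * (W + e + 7) * X ≤ 118 * X * (W + e + 7) := by linarith
    _ ≤ 118 * X * (s * (1 + ℓ) *
        (20 + 14 * ((S + 1) * (2 * (a + 6) + 2)) + 2 * |c₀| * (5 + b))) := by gcongr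
    _ = timeConst c₀ S * ((X * s) * (1 + ℓ)) := by
      rw [timeConst, ← ha, ← hb]; ring

theorem theorem9 :
    -- the eigenvector subroutine of NCD exists within the cost model
    (∃ c₀ : ℝ, ∃ eig : EigRoutine, IsApproxSmallestEig c₀ eig) ∧
    -- and with any such subroutine A-OLQR has the stated guarantee
    ∀ (c₀ : ℝ) (S : ℕ), ∃ Cst : ℝ, 0 < Cst ∧
      ∀ eig : EigRoutine, IsApproxSmallestEig c₀ eig →
      ∀ (n m r : ℕ) (P : LQR n m r), 0 < m → 0 < r →
      P.Q.PosDef → P.R.PosDef → P.Sig.PosDef →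
      ∀ (K₀ K₁ : Gain m r) (ε L₁ L₂ Δ δ Tgrad : ℝ),
      K₀ ∈ P.stab → K₁ ∈ P.stab → P.cost K₁ ≤ P.cost K₀ →
      0 < L₁ → 0 < L₂ → P.SmoothOn (P.subComp K₀ K₁) L₁ L₂ →
      (∀ K ∈ P.stab, P.cost K₁ - P.cost K ≤ Δ) →
      0 < δ → δ < 1 →
      0 < ε → ε ≤ min (Δ ^ (2 / 3 : ℝ) * L₂ ^ (1 / 3 : ℝ)) (L₁ ^ 2 / L₂) →
      0 < Tgrad →
      let q : Params := ⟨ε, L₁, L₂, L₂ ^ (1 / 2 : ℝ) * ε ^ (1 / 2 : ℝ), Δ, δ⟩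
      P.Confined q eig (P.subComp K₀ K₁) K₁ →
      P.RestartsAtMost q eig K₁ S →
      ∃ N : ℕ, ENNReal.ofReal (1 - δ) ≤ (P.run q eig K₁ N).toOuterMeasure
        {c | ∃ K : Gain m r, c.1 = Config.done K ∧
          K ∈ P.stab ∧
          ‖gradient P.cost K‖ ≤ ε ∧
          (∀ E : Gain m r, -(2 * L₂ ^ (1 / 2 : ℝ) * ε ^ (1 / 2 : ℝ)) * ‖E‖ ^ 2 ≤
            inner ℝ (LQR.hess P.cost K E) E) ∧
          Tgrad * (c.2 : ℝ) ≤ Cst * (Tgrad *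
            (Δ * L₁ ^ (1 / 2 : ℝ) * L₂ ^ (1 / 4 : ℝ) / ε ^ (7 / 4 : ℝ)) *
            (1 + Real.log ((m : ℝ) * (r : ℝ) * √(L₁ * Δ) / (δ * ε))))} := by
  refine ⟨⟨73, krylovRoutine, krylovRoutine_isApproxSmallestEig⟩, fun c₀ S =>
    ⟨timeConst c₀ S, timeConst_pos c₀ S, ?_⟩⟩
  intro eig heig n m r P hm hr hQ hR hSig K₀ K₁ ε L₁ L₂ Δ δ Tgrad hK₀ hK₁ hle hL₁ hL₂ hsmooth hgap
    hδ hδ1 hε hεle hT q hconf hrest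
  have hq : q.IsAdmissible := Params.isAdmissible hε hL₁ hL₂ (by simpa using hgap K₁ hK₁) hδ hδ1 hεle
  have hf := P.isBarrierCost_cost hQ hR hSig
  have h := LQR.isExecution heig hm hr hf hq hsmooth hgap hconf hrest
  have hd : 1 ≤ m * r := Nat.mul_pos hm hr
  have hd' : (1 : ℝ) ≤ ((m * r : ℕ) : ℝ) := by exact_mod_cast hd
  have hlog := Real.log_nonneg (hq.one_le_scale hd')
  set ℓ := Real.log (((m * r : ℕ) : ℝ) * √(q.L₁ * q.Δ) / (q.δ * q.ε)) with hℓ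
  set a := 2 * √(q.L₁ / q.α) * (Real.log 64800 + 6 * ℓ) with ha
  have ha0 : 0 ≤ a := by
    have : 0 ≤ Real.log 64800 := Real.log_nonneg (by norm_num)
    positivity
  have hI := hq.nag_steps hd' (I := ⌊a⌋₊ + 1) (by rw [Nat.cast_add_one]; exact Nat.lt_floor_add_one a)
  have hIle : ((⌊a⌋₊ + 1 : ℕ) : ℝ) ≤ a + 1 := by
    push_cast
    linarith [Nat.floor_le ha0]
  set Y : Set (Gain m r) := {K | K ∈ P.stab ∧ ‖gradient P.cost K‖ < q.ε ∧
    ∀ w, -q.α * ‖w‖ ^ 2 ≤ inner ℝ (LQR.hess P.cost K w) w} with hY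
  set e := LQR.eigOps q c₀ (m * r) with he
  set W : ℝ := 8 + 14 * ((S + 1) * ((⌊a⌋₊ + 1 : ℕ) + 1)) with hW
  have he0 : 0 ≤ e := by
    have hδe : 0 ≤ Real.log (((m * r : ℕ) : ℝ) / q.δeig) := by
      apply Real.log_nonneg
      rw [one_le_div hq.δeig_pos]
      linarith [hq.δeig_lt_one]
    rw [he, LQR.eigOps]; positivity
  have hlevel : P.level q K₁ (P.cost K₁) = q.budget := by
    rw [LQR.level, Params.budget]; ring
  obtain ⟨k, hk⟩ := exists_nat_gt (58 * q.budget)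
  have hsucc := (h.ncd_succeeds_of_level hI (Y := Y) (fun K h1 h2 h3 => ⟨h1, h2, h3⟩) hW he0 k K₁
    (LQR.reachable_start K₁) le_rfl (by rw [hlevel]; linarith)).1
  rw [hlevel] at hsucc
  have htime := hq.total_time_le c₀ S hd hIle hW he
  obtain ⟨N, hN⟩ := exists_nat_ge (2 * e + W + 11 + 116 * (W + e + 7) * q.budget)
  refine ⟨N, ?_⟩
  rw [LQR.run_eq_runFrom]
  refine (ENNReal.ofReal_le_ofReal ?_).trans ((hsucc N hN).trans (MeasureTheory.measure_mono ?_))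
  · have := hq.calls_mul_δeig_le
    have : q.δ = δ := rfl
    linarith
  · rintro x ⟨⟨K, ⟨hK, hg, hH⟩, hx⟩, hxt⟩
    refine ⟨K, hx, hK, hg.le, fun E => ?_, ?_⟩
    · have h1 := hH E
      have h2 : -(2 * L₂ ^ (1 / 2 : ℝ) * ε ^ (1 / 2 : ℝ)) = -q.α - q.α := by
        change _ = -(L₂ ^ (1 / 2 : ℝ) * ε ^ (1 / 2 : ℝ)) - L₂ ^ (1 / 2 : ℝ) * ε ^ (1 / 2 : ℝ)
        ring
      rw [h2, sub_mul]
      have h3 : 0 ≤ q.α * ‖E‖ ^ 2 := by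
        have := hq.α_pos
        positivity
      linarith
    · have h1 := hxt.trans htime
      rw [hq.budget_mul_sqrt rfl, ← hℓ] at h1
      have h2 : ℓ = Real.log ((m : ℝ) * (r : ℝ) * √(L₁ * Δ) / (δ * ε)) := by
        rw [hℓ, Nat.cast_mul]
      rw [← h2]
      calc Tgrad * (x.2 : ℝ) ≤ Tgrad * _ := mul_le_mul_of_nonneg_left h1 hT.le
        _ = _ := by ring
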